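/- **Setting.** Let $W=(\mathbb R/\mathbb Z)^2$ be the flat torus $[0,1]^2$, let $x=(x(s))_{s\in W}$ be a Gaussian random field with stationary covariance function $c$, i.e. $\operatorname{Cov}(x(s),x(t))=c(s-t)$, and with almost surely continuous paths. For $n_1,n_2\ge 1$ put $n=n_1n_2$, $h^2=1/n$, let $s_{ij}=(i/n_1,j/n_2)$ be the points of the $n_1\times n_2$ lattice, and let $\mathbf x=(x(s_{ij}))_{ij}$. Assume that every lattice covariance matrix $(c(s_a-s_b))_{a,b}$ is positive definite, and let $Q_n$ be its inverse. Given $x$, let $\mathbf y$ be $k<\infty$ independent realisations of the discretised log-Gaussian Cox process: independent counts $y_{r,ij}\sim\mathrm{Poisson}(h^2e^{x_{ij}})$, $r=1,\dots,k$. Let $H_n$ be the Fisher information matrix of $\mathbf y\mid\mathbf x$. For a step size $\delta$, the sMMALA proposal at $\mathbf x$ is $$N\Big(\mathbf x+\tfrac{\delta^2}{2}(Q_n+H_n)^{-1}\nabla_{\mathbf x}\log\pi(\mathbf y\mid\mathbf x),\ \delta^2(Q_n+H_n)^{-1}\Big).$$ Let $(\alpha_n)$ be real numbers with $n\alpha_n\to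 C_\alpha\in\mathbb R$ and let $M_n=Q_n+\alpha_nI$; assume that $M_n-\rho Q_n$ is positive semidefinite on all lattices for some $\rho>0$ (if all $\alpha_n\ge 0$, then $\rho=1$ works). Let $M_n=FF^T$ be any factorisation with $F$ square, put $A=F^{-1}(Q_n+H_n)F^{-T}$, and for $z\in\mathbb R^n$ let $u=A^{-1/2}z$ and let $u_m=\|z\|V_mT_m^{-1/2}e_1$ be its approximation by $m$ steps of the Lanczos recursion for $A$ started at $z$ ($V_m$: Lanczos vectors, $T_m$: tridiagonal Lanczos matrix). All norms are Euclidean. **Theorem.** 1. If $z\sim N(0,I)$, then $\mathbf x+\frac{\delta^2}{2}(Q_n+H_n)^{-1}\nabla_{\mathbf x}\log\pi(\mathbf y\mid\mathbf x)+\delta F^{-T}u$ has the law of the sMMALA proposal. 2. For almost every realisation of $x$ with $\int_We^{x(s)}ds\ne C_\alpha$ the following holds. There is a constant $C$ with $$\|u-u_m\|\le C\,\|z\|\left(\frac{\left|\int_We^{x(s)}ds-C_\alpha\right|}{m}\right)^m\qquad\text{for all } n_1,n_2,\ F,\ z\in\mathbb R^n,\ m\ge1.$$ Moreover, for every $\eta>0$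 there is a constant $C$ such that for all $n_1,n_2$ and $F$, with probability at least $1-\eta$ over $z\sim N(0,I)$, $$\|u-u_m\|\le C\left(\frac{\left|\int_We^{x(s)}ds-C_\alpha\right|}{m}\right)^m\qquad\text{for all } m\ge1.$$ In both statements $C$ depends neither on $n_1,n_2$ nor on $m$. 3. The proposal can be generated to any accuracy with a number of iterations independent of $n$ and with $O(n\log n)$ operations. Precisely: there are straight-line programs $\mathcal P_{m,n_1,n_2}$ (operations: real constants, $+,-,\times,/,\sqrt{\ },\exp$; inputs $\mathbf x,\mathbf y,z$; the programs may depend on $c,(\alpha_n),k,\delta$, but not on the inputs) of length at most $K_m\,n\log n$ for $n\ge2$, such that for almost every realisation of $x$ and all $\varepsilon,\eta>0$ there is an $m$ such that for all $n_1,n_2\geq 1$ the following holds with $\mathbf y$ as above and $z\sim N(0,I)$ independent. (a) For every factorisation $M_n=FF^T$, with probability at least $1-\eta$: $\|u-u_m\|\le\varepsilon$, and the proposal computed by $m$ Lanczos steps (with $u_m$ in place of $u$, and $m$ steps of the equally preconditioned conjugate gradient method for the linear system in the mean) differs from the exact draw in part 1 by at most $\varepsilon$ in every coordinate. (b) With probability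 at least $1-\eta$, the output of $\mathcal P_{m,n_1,n_2}$ differs from the exact draw in part 1 with $F=M_n^{1/2}$ by at most $\varepsilon$ in every coordinate. -/

import Mathlib

open MeasureTheory ProbabilityTheory Filter Topology
open scoped ENNReal NNReal

namespace LGCP

noncomputable section

/-! ### Lattices on the flat torus -/

/-- The flat torus `W = [0,1]²` (with opposite edges identified). Its `volume` is the product of the
Haar measures of total mass one on the circles. -/
abbrev Torus : Type := UnitAddCircle × UnitAddCircle

/-- Index set of the `n₁ × n₂` lattice. -/
abbrev Lattice (n₁ n₂ : ℕ) : Type := Fin n₁ × Fin n₂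

/-- Vectors indexed by a finite set, with the Euclidean norm. -/
abbrev Vec (ι : Type*) : Type _ := EuclideanSpace ℝ ι

/-- The lattice point `(i / n₁, j / n₂)` of the torus. -/
def latticePoint {n₁ n₂ : ℕ} (i : Lattice n₁ n₂) : Torus :=
  (((((i.1 : ℕ) : ℝ) / (n₁ : ℝ) : ℝ) : UnitAddCircle),
    ((((i.2 : ℕ) : ℝ) / (n₂ : ℝ) : ℝ) : UnitAddCircle))

/-- Covariance matrix, on the lattice, of a random field with stationary covariance function `c`. -/
def covMatrix (c : Torus → ℝ) (n₁ n₂ : ℕ) : Matrix (Lattice n₁ n₂) (Lattice n₁ n₂) ℝ :=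
  Matrix.of fun i j => c (latticePoint i - latticePoint j)

/-- Prior precision matrix `Q_n` of the discretised random field. -/
def precision (c : Torus → ℝ) (n₁ n₂ : ℕ) : Matrix (Lattice n₁ n₂) (Lattice n₁ n₂) ℝ :=
  (covMatrix c n₁ n₂)⁻¹

/-- The preconditioner `M_n = Q_n + α_n I`, where `n = n₁ n₂`. -/
def precond (c : Torus → ℝ) (α : ℕ → ℝ) (n₁ n₂ : ℕ) :
    Matrix (Lattice n₁ n₂) (Lattice n₁ n₂) ℝ :=
  precision c n₁ n₂ + α (n₁ * n₂) • (1 : Matrix (Lattice n₁ n₂) (Lattice n₁ n₂) ℝ)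

/-! ### The discretised log-Gaussian Cox process -/

section Likelihood

variable {n₁ n₂ : ℕ}

/-- Poisson mean of the count in a cell: cell area times `exp` of the latent field. -/
def cellRate (x : Lattice n₁ n₂ → ℝ) (i : Lattice n₁ n₂) : ℝ≥0 :=
  Real.toNNReal (Real.exp (x i) / ((n₁ : ℝ) * (n₂ : ℝ)))

/-- Conditional law, given the discretised field `x`, of `k` independent realisations
`y = (y_{r,i})` of the discretised log-Gaussian Cox process: the counts are independent,
`y_{r,i} ∼ Poisson (h² exp (x i))`, where `h² = 1 / (n₁ n₂)`. -/
def obsLaw (k : ℕ) (x : Lattice n₁ n₂ → ℝ) : Measure (Fin k → Lattice n₁ n₂ → ℕ) :=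
  Measure.pi fun _ : Fin k => Measure.pi fun i => poissonMeasure (cellRate x i)

/-- Log-likelihood `log π(y | x)`. -/
def logLik {k : ℕ} (x : Lattice n₁ n₂ → ℝ) (y : Fin k → Lattice n₁ n₂ → ℕ) : ℝ :=
  ∑ r, ∑ i, Real.log ((poissonMeasure (cellRate x i)).real {y r i})

/-- The score `∇ₓ log π(y | x)`. -/
def score {k : ℕ} (x : Lattice n₁ n₂ → ℝ) (y : Fin k → Lattice n₁ n₂ → ℕ) :
    Vec (Lattice n₁ n₂) :=
  WithLp.toLp 2 fun i => deriv (fun t : ℝ => logLik (Function.update x i t) y) (x i)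

/-- Fisher information matrix `H` of `y | x` (second moments of the score). -/
def fisher (k : ℕ) (x : Lattice n₁ n₂ → ℝ) : Matrix (Lattice n₁ n₂) (Lattice n₁ n₂) ℝ :=
  Matrix.of fun i j => ∫ y, score x y i * score x y j ∂(obsLaw k x)

end Likelihood

/-! ### The Krylov (Lanczos) sampler -/

section Krylov

variable {ι : Type*} [Fintype ι] [DecidableEq ι]

/-- Matrix times vector. -/
def mulV (A : Matrix ι ι ℝ) (v : Vec ι) : Vec ι := WithLp.toLp 2 (A.mulVec v.ofLp)

/-- Inverse `A^{-1/2}` of the principal square root of a symmetric positive definite matrix. -/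
def invSqrt (A : Matrix ι ι ℝ) : Matrix ι ι ℝ := cfc (fun t : ℝ => (√t)⁻¹) A

/-- Principal square root `A^{1/2}` of a symmetric positive definite matrix. -/
def matSqrt (A : Matrix ι ι ℝ) : Matrix ι ι ℝ := cfc (fun t : ℝ => √t) A

/-- The Lanczos recursion started at `z`. With indices from zero, `lanczos A z j` is the triple
`(v_{j-1}, v_j, β_j)`, where `β_j` couples `v_{j-1}` and `v_j`. If the Krylov space is exhausted
(`β_j = 0`), then `v_j` and all the later vectors are zero. -/
def lanczos (A : Matrix ι ι ℝ) (z : Vec ι) : ℕ → Vec ι × Vec ι × ℝ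
  | 0 => (0, ‖z‖⁻¹ • z, 0)
  | j + 1 =>
    let vprev := (lanczos A z j).1
    let v := (lanczos A z j).2.1
    let β := (lanczos A z j).2.2
    let q := mulV A v - β • vprev
    let a := inner ℝ v q
    let q' := q - a • v
    (v, ‖q'‖⁻¹ • q', ‖q'‖)

/-- Lanczos vector `v_j`, `j = 0, 1, …`. -/
def lanczosVec (A : Matrix ι ι ℝ) (z : Vec ι) (j : ℕ) : Vec ι := (lanczos A z j).2.1

/-- Off-diagonal Lanczos coefficient, coupling `v_{j-1}` and `v_j`. -/
def lanczosOffDiag (A : Matrix ι ι ℝ) (z : Vec ι) (j : ℕ) : ℝ := (lanczos A z j).2.2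

/-- Diagonal Lanczos coefficient at `v_j`. -/
def lanczosDiag (A : Matrix ι ι ℝ) (z : Vec ι) (j : ℕ) : ℝ :=
  inner ℝ (lanczosVec A z j)
    (mulV A (lanczosVec A z j) - lanczosOffDiag A z j • (lanczos A z j).1)

/-- The `m × m` symmetric tridiagonal Lanczos matrix `T_m`. -/
def lanczosT (A : Matrix ι ι ℝ) (z : Vec ι) (m : ℕ) : Matrix (Fin m) (Fin m) ℝ :=
  Matrix.of fun i j =>
    if (i : ℕ) = j then lanczosDiag A z i
    else if (i : ℕ) + 1 = j then lanczosOffDiag A z j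
    else if (j : ℕ) + 1 = i then lanczosOffDiag A z i
    else 0

/-- The Krylov approximation `‖z‖ V_m f(T_m) e₁` to `f(A) z` after `m` Lanczos steps.
For `f t = t⁻¹` it is the `m`-th conjugate gradient iterate for `A w = z`. -/
def krylov (f : ℝ → ℝ) (A : Matrix ι ι ℝ) (z : Vec ι) (m : ℕ) : Vec ι :=
  ∑ j : Fin m,
    (‖z‖ * (cfc f (lanczosT A z m)).mulVec (fun l : Fin m => if (l : ℕ) = 0 then 1 else 0) j) •
      lanczosVec A z j

/-- The Krylov sampler: approximation to `A^{-1/2} z` after `m` steps. -/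
def krylovSample (A : Matrix ι ι ℝ) (z : Vec ι) (m : ℕ) : Vec ι :=
  krylov (fun t : ℝ => (√t)⁻¹) A z m

/-- The Krylov (conjugate gradient) approximation to `A⁻¹ b` after `m` steps. -/
def krylovSolve (A : Matrix ι ι ℝ) (b : Vec ι) (m : ℕ) : Vec ι :=
  krylov (fun t : ℝ => t⁻¹) A b m

/-- `F⁻¹ B F⁻ᵀ`. -/
def conjInv (F B : Matrix ι ι ℝ) : Matrix ι ι ℝ := F⁻¹ * B * (F⁻¹).transpose

end Krylov

/-! ### The sMMALA proposal -/

section Proposal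

variable {n₁ n₂ : ℕ}

/-- `Q_n + H_n`, with `H_n` the Fisher information at `x`. -/
def postPrecision (c : Torus → ℝ) (k : ℕ) (x : Lattice n₁ n₂ → ℝ) :
    Matrix (Lattice n₁ n₂) (Lattice n₁ n₂) ℝ :=
  precision c n₁ n₂ + fisher k x

/-- The preconditioned precision matrix `F⁻¹ (Q_n + H_n) F⁻ᵀ`. -/
def precondMatrix (c : Torus → ℝ) (k : ℕ) (x : Lattice n₁ n₂ → ℝ)
    (F : Matrix (Lattice n₁ n₂) (Lattice n₁ n₂) ℝ) :
    Matrix (Lattice n₁ n₂) (Lattice n₁ n₂) ℝ :=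
  conjInv F (postPrecision c k x)

/-- The preconditioned sample `u = (F⁻¹ (Q_n + H_n) F⁻ᵀ)^{-1/2} z`. -/
def sampleU (c : Torus → ℝ) (k : ℕ) (x : Lattice n₁ n₂ → ℝ)
    (F : Matrix (Lattice n₁ n₂) (Lattice n₁ n₂) ℝ) (z : Vec (Lattice n₁ n₂)) :
    Vec (Lattice n₁ n₂) :=
  mulV (invSqrt (precondMatrix c k x F)) z

/-- Its Krylov approximation `u_m`. -/
def sampleUApprox (c : Torus → ℝ) (k : ℕ) (x : Lattice n₁ n₂ → ℝ)
    (F : Matrix (Lattice n₁ n₂) (Lattice n₁ n₂) ℝ) (z : Vec (Lattice n₁ n₂)) (m : ℕ) :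
    Vec (Lattice n₁ n₂) :=
  krylovSample (precondMatrix c k x F) z m

/-- Mean of the sMMALA proposal with step size `δ`:
`x + (δ²/2) (Q_n + H_n)⁻¹ ∇ₓ log π(y | x)`. -/
def proposalMean (c : Torus → ℝ) (δ : ℝ) {k : ℕ} (x : Lattice n₁ n₂ → ℝ)
    (y : Fin k → Lattice n₁ n₂ → ℕ) : Vec (Lattice n₁ n₂) :=
  WithLp.toLp 2 x + (δ ^ 2 / 2) • mulV (postPrecision c k x)⁻¹ (score x y)

/-- The law of the sMMALA proposal. -/
def proposalLaw (c : Torus → ℝ) (δ : ℝ) {k : ℕ} (x : Lattice n₁ n₂ → ℝ)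
    (y : Fin k → Lattice n₁ n₂ → ℕ) : Measure (Vec (Lattice n₁ n₂)) :=
  multivariateGaussian (proposalMean c δ x y) (δ ^ 2 • (postPrecision c k x)⁻¹)

/-- The exact draw of the proposal obtained from the noise vector `z`: proposal mean plus `δ` times
the solution of `Fᵀ w = u`. -/
def proposalDraw (c : Torus → ℝ) (δ : ℝ) {k : ℕ} (x : Lattice n₁ n₂ → ℝ)
    (y : Fin k → Lattice n₁ n₂ → ℕ) (F : Matrix (Lattice n₁ n₂) (Lattice n₁ n₂) ℝ)
    (z : Vec (Lattice n₁ n₂)) : Vec (Lattice n₁ n₂) :=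
  proposalMean c δ x y + δ • mulV (F.transpose)⁻¹ (sampleU c k x F z)

/-- The draw computed with `m` iterations: `u` is replaced by `u_m`, and the linear system in the
mean is solved by `m` steps of the conjugate gradient method with the same preconditioner. -/
def proposalApprox (c : Torus → ℝ) (δ : ℝ) {k : ℕ} (x : Lattice n₁ n₂ → ℝ)
    (y : Fin k → Lattice n₁ n₂ → ℕ) (F : Matrix (Lattice n₁ n₂) (Lattice n₁ n₂) ℝ)
    (z : Vec (Lattice n₁ n₂)) (m : ℕ) : Vec (Lattice n₁ n₂) :=
  WithLp.toLp 2 x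
    + (δ ^ 2 / 2) • mulV (F.transpose)⁻¹
        (krylovSolve (precondMatrix c k x F) (mulV F⁻¹ (score x y)) m)
    + δ • mulV (F.transpose)⁻¹ (sampleUApprox c k x F z m)

end Proposal

/-! ### Cost model: straight-line programs in real arithmetic -/

/-- Registers: read-only inputs (indexed by `ι`) and numbered work registers. -/
abbrev Reg (ι : Type) : Type := ι ⊕ ℕ

/-- Elementary operations. -/
inductive Op (R : Type) : Type
  | const (a : ℝ) : Op R
  | add (a b : R) : Op R
  | sub (a b : R) : Op R
  | mul (a b : R) : Op R
  | div (a b : R) : Op R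
  | sqrt (a : R) : Op R
  | exp (a : R) : Op R

/-- Value of an elementary operation, given the contents of the registers. -/
def Op.eval {R : Type} (mem : R → ℝ) : Op R → ℝ
  | .const a => a
  | .add a b => mem a + mem b
  | .sub a b => mem a - mem b
  | .mul a b => mem a * mem b
  | .div a b => mem a / mem b
  | .sqrt a => √(mem a)
  | .exp a => Real.exp (mem a)

/-- A straight-line program with inputs `ι` and outputs `κ`: a list of instructions
`(destination, operation)`, and the registers from which the output is read. -/
structure Program (ι κ : Type) : Type where
  ops : List (ℕ × Op (Reg ι))
  out : κ → Reg ι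

/-- Execution of a list of instructions. -/
def runOps {ι : Type} (inp : ι → ℝ) (ops : List (ℕ × Op (Reg ι))) : ℕ → ℝ :=
  ops.foldl (fun w o => Function.update w o.1 (o.2.eval (Sum.elim inp w))) 0

/-- Output of a program. -/
def Program.run {ι κ : Type} (p : Program ι κ) (inp : ι → ℝ) (a : κ) : ℝ :=
  Sum.elim inp (runOps inp p.ops) (p.out a)

/-- Cost of a program: number of elementary operations executed. -/
def Program.cost {ι κ : Type} (p : Program ι κ) : ℕ := p.ops.length

/-- Inputs of a program that generates a proposal: the field `x`, the `k` data vectors `y`, and the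
noise vector `z`. -/
abbrev ProposalInput (k n₁ n₂ : ℕ) : Type :=
  Lattice n₁ n₂ ⊕ (Fin k × Lattice n₁ n₂) ⊕ Lattice n₁ n₂

/-- Loading of the inputs. -/
def proposalInput {k n₁ n₂ : ℕ} (x : Lattice n₁ n₂ → ℝ) (y : Fin k → Lattice n₁ n₂ → ℕ)
    (z : Vec (Lattice n₁ n₂)) : ProposalInput k n₁ n₂ → ℝ :=
  Sum.elim x (Sum.elim (fun q => (y q.1 q.2 : ℝ)) (fun i => z i))

end

end LGCP

namespace LGCP

noncomputable section

/-! ### Matrices acting on Euclidean vectors -/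

section MulV

variable {ι : Type*} [Fintype ι]

/-! Write C for the lattice covariance, so that Q = C⁻¹. The Fisher information is diagonal with
entries k h² exp(x_i), hence A = 1 + E with E = F⁻¹ D Fᵀ⁻¹ and D = H - α_n I diagonal. For a
realisation with continuous paths, |D_i| ≤ d / n with d independent of the lattice. The theorem
rests on the decay of the eigenvalues μ_j of E (ordered by decreasing modulus), uniformly in the
lattice and in F.

Eigenvalue decay. Suppose that E or -E is at least t on a span of eigenvectors. Transporting this
span by Fᵀ⁻¹ and using M ≥ ρ C⁻¹ together with Cauchy–Schwarz gives t ρ ≤ (d / n) ⟨y, C y⟩ for every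
unit vector y of the image. Summing over orthonormal families bounds the eigenvalue count by a trace
of C (`card_mul_le`). The full trace is n c(0), so |μ_j| = O(1 / j). Path continuity makes the
variogram tend to 0 at 0 (`tendsto_variogram`). On vectors whose sums over the blocks of a fixed
partition of the torus vanish, the trace of C is therefore only n ε (`kernelTraceBound_blockSum`).
The constraints are finitely many, independently of n, so j |μ_j| → 0 uniformly
(`exists_countBound`).

Krylov error. The Krylov approximation applies to A the interpolant of f at the Ritz values. For
t⁻¹, and for t^{-1/2} as an integral of resolvents, the interpolation error is at most a constant
times a^{-m} times the nodal polynomial, where a > 0 is a lower bound of the spectrum. The nodal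
polynomial minimises ‖q(A) z‖ among monic q of degree m (`norm_sub_krylov_le`). Placing the roots of
q at 1 and at 1 + μ_j for the m - 1 largest |μ_j| gives a bound of order ε^m / m! times ‖E z‖ for
every ε > 0, and this beats (K / m)^m for every K > 0 (`norm_sub_krylov_le_superlinear`). The number
|∫ exp(x) - C_α| enters only as one such positive K.

Probability. For Gaussian z the mean of ‖E z‖² is ∑ μ_j², which is bounded although ‖z‖² has mean n.
The preconditioned score also has bounded second moment (`exists_tight`). Coordinates of Fᵀ⁻¹ v are
at most √(c(0) / ρ) ‖v‖, so errors in norm become errors in each coordinate.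

Operation count. The matrix M^{-1/2} is invariant under lattice translations, so it acts by a
convolution that costs O(n log n) (`TransInvariant.gen`). The programs replace the functions of A by
fixed Weierstrass polynomials, evaluated by Horner's scheme; the interval containing the spectrum of
A does not depend on the lattice. -/

lemma mulV_apply (A : Matrix ι ι ℝ) (v : Vec ι) (i : ι) : mulV A v i = ∑ j, A i j * v j := rfl

@[simp] lemma mulV_zero (A : Matrix ι ι ℝ) : mulV A 0 = 0 := by
  ext i; simp [mulV_apply]

lemma mulV_add (A : Matrix ι ι ℝ) (v w : Vec ι) : mulV A (v + w) = mulV A v + mulV A w := by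
  ext i; simp [mulV_apply, mul_add, Finset.sum_add_distrib]

lemma mulV_sub (A : Matrix ι ι ℝ) (v w : Vec ι) : mulV A (v - w) = mulV A v - mulV A w := by
  ext i; simp [mulV_apply, mul_sub, Finset.sum_sub_distrib]

lemma mulV_smul (A : Matrix ι ι ℝ) (r : ℝ) (v : Vec ι) : mulV A (r • v) = r • mulV A v := by
  ext i; simp [mulV_apply, Finset.mul_sum, mul_left_comm]

lemma add_mulV (A B : Matrix ι ι ℝ) (v : Vec ι) : mulV (A + B) v = mulV A v + mulV B v := by
  ext i; simp [mulV_apply, add_mul, Finset.sum_add_distrib]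

lemma sub_mulV (A B : Matrix ι ι ℝ) (v : Vec ι) : mulV (A - B) v = mulV A v - mulV B v := by
  ext i; simp [mulV_apply, sub_mul, Finset.sum_sub_distrib]

lemma smul_mulV (A : Matrix ι ι ℝ) (r : ℝ) (v : Vec ι) : mulV (r • A) v = r • mulV A v := by
  ext i; simp [mulV_apply, Finset.mul_sum, mul_assoc]

lemma mul_mulV (A B : Matrix ι ι ℝ) (v : Vec ι) : mulV (A * B) v = mulV A (mulV B v) := by
  simp [mulV, Matrix.mulVec_mulVec]

lemma mulV_sum {κ : Type*} (A : Matrix ι ι ℝ) (s : Finset κ) (v : κ → Vec ι) :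
    mulV A (∑ k ∈ s, v k) = ∑ k ∈ s, mulV A (v k) := by
  classical
  induction s using Finset.induction_on with
  | empty => simp
  | insert a s ha ih => rw [Finset.sum_insert ha, Finset.sum_insert ha, mulV_add, ih]

/-- `mulV A` as a linear map. -/
def mulVLin (A : Matrix ι ι ℝ) : Vec ι →ₗ[ℝ] Vec ι where
  toFun := mulV A
  map_add' := mulV_add A
  map_smul' := mulV_smul A

@[simp] lemma mulVLin_apply (A : Matrix ι ι ℝ) (v : Vec ι) : mulVLin A v = mulV A v := rfl

lemma inner_eq_sum (v w : Vec ι) : inner ℝ v w = ∑ i, v i * w i := by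
  simp [PiLp.inner_apply, mul_comm]

lemma inner_mulV_left (A : Matrix ι ι ℝ) (v w : Vec ι) :
    inner ℝ (mulV A v) w = inner ℝ v (mulV A.transpose w) := by
  simp only [inner_eq_sum, mulV_apply, Finset.sum_mul, Finset.mul_sum, Matrix.transpose_apply]
  rw [Finset.sum_comm]
  exact Finset.sum_congr rfl fun i _ => Finset.sum_congr rfl fun j _ => by ring

lemma inner_mulV_right (A : Matrix ι ι ℝ) (v w : Vec ι) :
    inner ℝ v (mulV A w) = inner ℝ (mulV A.transpose v) w := by
  rw [inner_mulV_left, Matrix.transpose_transpose]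

lemma continuous_mulV (A : Matrix ι ι ℝ) : Continuous (mulV A) :=
  (mulVLin A).continuous_of_finiteDimensional

lemma measurable_mulV (A : Matrix ι ι ℝ) : Measurable (mulV A) := (continuous_mulV A).measurable

variable [DecidableEq ι]

@[simp] lemma one_mulV (v : Vec ι) : mulV (1 : Matrix ι ι ℝ) v = v := by
  simp [mulV]

lemma mulV_single (A : Matrix ι ι ℝ) (i j : ι) :
    mulV A (EuclideanSpace.single i 1) j = A j i := by
  simp [mulV]

lemma inner_single_mulV (A : Matrix ι ι ℝ) (v : Vec ι) (j : ι) :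
    inner ℝ (EuclideanSpace.single j 1) (mulV A v) = mulV A v j := by
  simp [EuclideanSpace.inner_single_left]

lemma mulV_diagonal (d : ι → ℝ) (v : Vec ι) (i : ι) :
    mulV (Matrix.diagonal d) v i = d i * v i := by
  simp [mulV, Matrix.mulVec_diagonal]

lemma inner_diagonal (d : ι → ℝ) (v : Vec ι) :
    inner ℝ v (mulV (Matrix.diagonal d) v) = ∑ i, d i * v i ^ 2 := by
  rw [inner_eq_sum]
  exact Finset.sum_congr rfl fun i _ => by rw [mulV_diagonal]; ring

end MulV

/-! ### Functions of symmetric matrices -/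

section Spectral

variable {ι : Type*} [Fintype ι] [DecidableEq ι] {A : Matrix ι ι ℝ}

open Polynomial

lemma mulV_eigenvectorBasis (hA : A.IsHermitian) (i : ι) :
    mulV A (hA.eigenvectorBasis i) = hA.eigenvalues i • hA.eigenvectorBasis i := by
  have := hA.mulVec_eigenvectorBasis i
  ext j
  simpa [mulV] using congrFun this j

lemma mulV_cfc_eigenvectorBasis (hA : A.IsHermitian) (f : ℝ → ℝ) (i : ι) :
    mulV (cfc f A) (hA.eigenvectorBasis i) = f (hA.eigenvalues i) • hA.eigenvectorBasis i := by
  have h1 : (cfc f A).mulVec (hA.eigenvectorBasis i).ofLp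
      = f (hA.eigenvalues i) • (hA.eigenvectorBasis i).ofLp := by
    rw [hA.cfc_eq, Matrix.IsHermitian.cfc, Unitary.conjStarAlgAut_apply, ← Matrix.mulVec_mulVec,
      ← Matrix.mulVec_mulVec, hA.star_eigenvectorUnitary_mulVec, Matrix.diagonal_mulVec_single,
      Function.comp_apply, Function.comp_apply, mul_one]
    have : (Pi.single i (RCLike.ofReal (f (hA.eigenvalues i)) : ℝ) : ι → ℝ)
        = f (hA.eigenvalues i) • Pi.single i 1 := by
      rw [← Pi.single_smul]; simp
    rw [this, Matrix.mulVec_smul, hA.eigenvectorUnitary_mulVec]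
  ext j
  simpa [mulV] using congrFun h1 j

lemma isHermitian_cfc (f : ℝ → ℝ) : (cfc f A).IsHermitian :=
  cfc_predicate f A

lemma transpose_cfc (f : ℝ → ℝ) : (cfc f A).transpose = cfc f A := by
  have := isHermitian_cfc (A := A) f
  rwa [Matrix.IsHermitian, Matrix.conjTranspose_eq_transpose_of_trivial] at this

lemma transpose_eq_of_isHermitian {κ : Type*} {A : Matrix κ κ ℝ} (hA : A.IsHermitian) : A.transpose = A := by
  rwa [Matrix.IsHermitian, Matrix.conjTranspose_eq_transpose_of_trivial] at hA

lemma norm_sq_mulV_cfc (hA : A.IsHermitian) (f : ℝ → ℝ) (z : Vec ι) :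
    ‖mulV (cfc f A) z‖ ^ 2
      = ∑ i, f (hA.eigenvalues i) ^ 2 * (inner ℝ (hA.eigenvectorBasis i) z) ^ 2 := by
  rw [← hA.eigenvectorBasis.sum_sq_inner_right]
  refine Finset.sum_congr rfl fun i _ => ?_
  rw [inner_mulV_right, transpose_cfc, mulV_cfc_eigenvectorBasis, real_inner_smul_left]
  ring

/-- The spectrum is finite, so every function is continuous on it; this settles all continuity
conditions of the functional calculus. -/
lemma continuousOn_spectrum (f : ℝ → ℝ) : ContinuousOn f (spectrum ℝ A) :=
  A.finite_real_spectrum.continuousOn f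

lemma eigenvalues_mem (hA : A.IsHermitian) (i : ι) : hA.eigenvalues i ∈ spectrum ℝ A :=
  hA.eigenvalues_mem_spectrum_real i

/-- Pointwise domination on the spectrum gives domination of the matrix functions. -/
lemma norm_mulV_cfc_le (hA : A.IsHermitian) {f g : ℝ → ℝ} {G : ℝ} (hG : 0 ≤ G)
    (h : ∀ t ∈ spectrum ℝ A, |f t| ≤ G * |g t|) (z : Vec ι) :
    ‖mulV (cfc f A) z‖ ≤ G * ‖mulV (cfc g A) z‖ := by
  have hr : 0 ≤ G * ‖mulV (cfc g A) z‖ := mul_nonneg hG (norm_nonneg _)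
  refine (sq_le_sq₀ (norm_nonneg _) hr).1 ?_
  rw [mul_pow, norm_sq_mulV_cfc hA, norm_sq_mulV_cfc hA, Finset.mul_sum]
  refine Finset.sum_le_sum fun i _ => ?_
  rw [← mul_assoc]
  refine mul_le_mul_of_nonneg_right ?_ (by positivity)
  rw [← sq_abs (f _), ← sq_abs (g _), ← mul_pow]
  exact pow_le_pow_left₀ (abs_nonneg _) (h _ (eigenvalues_mem hA i)) 2

lemma cfc_eval_eq_aeval (hA : A.IsHermitian) (p : ℝ[X]) : cfc (fun t => p.eval t) A = aeval A p :=
  cfc_polynomial p A hA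

lemma aeval_mulV_add (p q : ℝ[X]) (z : Vec ι) :
    mulV (aeval A (p + q)) z = mulV (aeval A p) z + mulV (aeval A q) z := by
  rw [map_add, add_mulV]

lemma aeval_mulV_X_mul (p : ℝ[X]) (z : Vec ι) :
    mulV (aeval A (X * p)) z = mulV A (mulV (aeval A p) z) := by
  rw [map_mul, aeval_X, mul_mulV]

lemma aeval_mulV_C (r : ℝ) (z : Vec ι) : mulV (aeval A (C r)) z = r • z := by
  rw [aeval_C, Algebra.algebraMap_eq_smul_one, smul_mulV, one_mulV]

lemma cfc_congr_spectrum {f g : ℝ → ℝ} (h : ∀ t ∈ spectrum ℝ A, f t = g t) :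
    cfc f A = cfc g A := cfc_congr h

lemma spectrum_eq_range (hA : A.IsHermitian) : spectrum ℝ A = Set.range hA.eigenvalues :=
  hA.spectrum_real_eq_range_eigenvalues

/-- Rayleigh quotient bound for the spectrum from below. -/
lemma le_of_mem_spectrum (hA : A.IsHermitian) {a t : ℝ}
    (h : ∀ v : Vec ι, a * ‖v‖ ^ 2 ≤ inner ℝ v (mulV A v)) (ht : t ∈ spectrum ℝ A) : a ≤ t := by
  rw [spectrum_eq_range hA] at ht
  obtain ⟨i, rfl⟩ := ht
  have := h (hA.eigenvectorBasis i)
  rw [mulV_eigenvectorBasis, real_inner_smul_right, real_inner_self_eq_norm_sq] at this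
  simpa using this

end Spectral

/-! ### Interpolation error for `t⁻¹` and `t^{-1/2}` -/

section Interpolation

open Polynomial Lagrange

/-- With w the nodal polynomial, 1 - w(x) / w(-u) vanishes at x = -u. Its quotient by x + u is a
polynomial of degree below the number of nodes that takes the values (θ + u)⁻¹ at the nodes, hence
it is the interpolant. -/
lemma inv_add_sub_interpolate {s : Finset ℝ} {a u t : ℝ} (ha : 0 < a) (hs : ∀ θ ∈ s, a ≤ θ)
    (hu : 0 ≤ u) (ht : a ≤ t) :
    (t + u)⁻¹ - (interpolate s id fun θ => (θ + u)⁻¹).eval t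
      = (nodal s id).eval t * ((t + u)⁻¹ * ((nodal s id).eval (-u))⁻¹) := by
  set w := nodal s (id : ℝ → ℝ) with hw
  have hw0 : w.eval (-u) ≠ 0 := by
    rw [hw, eval_nodal, Finset.prod_ne_zero_iff]
    intro θ hθ
    have := hs θ hθ
    simp only [id]; linarith
  have hroot : (1 - C (w.eval (-u))⁻¹ * w).IsRoot (-u) := by
    simp [IsRoot.def, inv_mul_cancel₀ hw0]
  obtain ⟨p, hp⟩ := dvd_iff_isRoot.2 hroot
  have hdeg : p.degree < s.card := by
    have h1 : (1 - C (w.eval (-u))⁻¹ * w).natDegree ≤ s.card := by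
      refine (natDegree_sub_le _ _).trans (max_le (by simp) ?_)
      exact (natDegree_C_mul_le _ _).trans (natDegree_nodal).le
    rcases eq_or_ne p 0 with rfl | hp0
    · simp
    · rw [hp, natDegree_mul (X_sub_C_ne_zero _) hp0, natDegree_X_sub_C] at h1
      rw [degree_eq_natDegree hp0]
      exact_mod_cast by omega
  have hev : ∀ x, 1 - (w.eval (-u))⁻¹ * w.eval x = (x + u) * p.eval x := by
    intro x
    have := congrArg (eval x) hp
    simpa using this
  have heq : p = interpolate s id fun θ => (θ + u)⁻¹ := by
    refine eq_interpolate_of_eval_eq _ Function.injective_id.injOn hdeg fun θ hθ => ?_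
    have h2 := hev θ
    have h3 : w.eval θ = 0 := eval_nodal_at_node (v := id) hθ
    rw [h3, mul_zero, sub_zero] at h2
    exact eq_inv_of_mul_eq_one_right h2.symm
  rw [← heq]
  have htu : t + u ≠ 0 := by linarith
  have := hev t
  field_simp at this ⊢
  linarith

lemma abs_inv_add_sub_interpolate_le {s : Finset ℝ} {a u t : ℝ} (ha : 0 < a)
    (hs : ∀ θ ∈ s, a ≤ θ) (hu : 0 ≤ u) (ht : a ≤ t) :
    |(t + u)⁻¹ - (interpolate s id fun θ => (θ + u)⁻¹).eval t|
      ≤ (a ^ s.card)⁻¹ * |(nodal s id).eval t| * (t + u)⁻¹ := by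
  rw [inv_add_sub_interpolate ha hs hu ht, abs_mul, abs_mul, abs_inv, abs_inv,
    abs_of_pos (by linarith : 0 < t + u)]
  -- All factors of the nodal polynomial at -u have modulus θ + u ≥ a.
  have h1 : a ^ s.card ≤ |(nodal s id).eval (-u)| := by
    rw [eval_nodal, Finset.abs_prod, ← Finset.prod_const]
    refine Finset.prod_le_prod (fun _ _ => ha.le) fun θ hθ => ?_
    have := hs θ hθ
    simp only [id]
    rw [abs_of_neg (by linarith)]; linarith
  have h2 : |(nodal s id).eval (-u)|⁻¹ ≤ (a ^ s.card)⁻¹ := inv_anti₀ (by positivity) h1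
  have h3 : 0 ≤ (t + u)⁻¹ := inv_nonneg.2 (by linarith)
  calc _ = |(nodal s id).eval (-u)|⁻¹ * |(nodal s id).eval t| * (t + u)⁻¹ := by ring
    _ ≤ _ := by gcongr

lemma inv_add_sq_eq {t : ℝ} (ht : 0 < t) (x : ℝ) :
    (t + x ^ 2)⁻¹ = t⁻¹ * (1 + (x / √t) ^ 2)⁻¹ := by
  rw [div_pow, Real.sq_sqrt ht.le, ← mul_inv]
  congr 1; field_simp

lemma integrable_inv_add_sq {t : ℝ} (ht : 0 < t) : Integrable fun x : ℝ => (t + x ^ 2)⁻¹ := by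
  simp_rw [inv_add_sq_eq ht]
  exact (integrable_inv_one_add_sq.comp_div (Real.sqrt_ne_zero'.2 ht)).const_mul _

lemma integral_inv_add_sq {t : ℝ} (ht : 0 < t) :
    ∫ x : ℝ, (t + x ^ 2)⁻¹ = Real.pi * (√t)⁻¹ := by
  simp_rw [inv_add_sq_eq ht]
  rw [integral_const_mul, Measure.integral_comp_div (fun x : ℝ => (1 + x ^ 2)⁻¹),
    integral_univ_inv_one_add_sq, abs_of_nonneg (Real.sqrt_nonneg t), smul_eq_mul]
  have h := Real.sq_sqrt ht.le
  have h' := Real.sqrt_ne_zero'.2 ht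
  field_simp
  linarith

lemma abs_inv_sub_interpolate_le {s : Finset ℝ} {a t : ℝ} (ha : 0 < a)
    (hs : ∀ θ ∈ s, a ≤ θ) (ht : a ≤ t) :
    |t⁻¹ - (interpolate s id fun θ => θ⁻¹).eval t|
      ≤ (a ^ s.card)⁻¹ * |(nodal s id).eval t| * t⁻¹ := by
  simpa using abs_inv_add_sub_interpolate_le ha hs le_rfl ht

/-- Interpolation is linear in the data and π t^{-1/2} = ∫ (t + x²)⁻¹ dx, so the error is an average
over u = x² of the errors for (t + u)⁻¹. The bounds for these have the same prefactor for all u and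
integrate back to t^{-1/2}. -/
lemma abs_inv_sqrt_sub_interpolate_le {s : Finset ℝ} {a t : ℝ} (ha : 0 < a)
    (hs : ∀ θ ∈ s, a ≤ θ) (ht : a ≤ t) :
    |(√t)⁻¹ - (interpolate s id fun θ => (√θ)⁻¹).eval t|
      ≤ (a ^ s.card)⁻¹ * |(nodal s id).eval t| * (√t)⁻¹ := by
  have hpi := Real.pi_pos
  have hev : ∀ r : ℝ → ℝ, (interpolate s id r).eval t
      = ∑ θ ∈ s, r θ * (Lagrange.basis s id θ).eval t := fun r => by
    simp [interpolate_apply, eval_finsetSum]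
  have hint : ∀ θ ∈ s, Integrable fun x : ℝ => (θ + x ^ 2)⁻¹ * (Lagrange.basis s id θ).eval t :=
    fun θ hθ => (integrable_inv_add_sq (ha.trans_le (hs θ hθ))).mul_const _
  have key : Real.pi * ((√t)⁻¹ - (interpolate s id fun θ => (√θ)⁻¹).eval t)
      = ∫ x : ℝ, ((t + x ^ 2)⁻¹ - (interpolate s id fun θ => (θ + x ^ 2)⁻¹).eval t) := by
    simp_rw [hev]
    rw [integral_sub (integrable_inv_add_sq (ha.trans_le ht)) (integrable_finsetSum _ hint),
      integral_inv_add_sq (ha.trans_le ht), integral_finsetSum _ hint, mul_sub, Finset.mul_sum]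
    congr 1
    refine Finset.sum_congr rfl fun θ hθ => ?_
    rw [integral_mul_const, integral_inv_add_sq (ha.trans_le (hs θ hθ)), mul_assoc]
  have hb : Real.pi * |(√t)⁻¹ - (interpolate s id fun θ => (√θ)⁻¹).eval t|
      ≤ Real.pi * ((a ^ s.card)⁻¹ * |(nodal s id).eval t| * (√t)⁻¹) := by
    have h1 := norm_integral_le_of_norm_le
      (f := fun x : ℝ => (t + x ^ 2)⁻¹ - (interpolate s id fun θ => (θ + x ^ 2)⁻¹).eval t)
      ((integrable_inv_add_sq (ha.trans_le ht)).const_mul ((a ^ s.card)⁻¹ * |(nodal s id).eval t|))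
      (Eventually.of_forall fun x => abs_inv_add_sub_interpolate_le ha hs (sq_nonneg x) ht)
    rw [← key, integral_const_mul, integral_inv_add_sq (ha.trans_le ht), Real.norm_eq_abs,
      abs_mul, abs_of_pos hpi] at h1
    linarith
  exact le_of_mul_le_mul_left hb hpi

end Interpolation

/-! ### The Lanczos relation -/

section Lanczos

open Polynomial

variable {ι : Type*} [Fintype ι] (A : Matrix ι ι ℝ) (z : Vec ι)

lemma lanczos_fst_succ (j : ℕ) : (lanczos A z (j + 1)).1 = lanczosVec A z j := rfl

lemma lanczosOffDiag_zero : lanczosOffDiag A z 0 = 0 := rfl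

/-- The residual vector of the `j`-th Lanczos step. -/
def lanczosRes (j : ℕ) : Vec ι :=
  mulV A (lanczosVec A z j) - lanczosOffDiag A z j • (lanczos A z j).1
    - lanczosDiag A z j • lanczosVec A z j

lemma lanczosVec_zero : lanczosVec A z 0 = ‖z‖⁻¹ • z := rfl

lemma lanczosVec_succ (j : ℕ) :
    lanczosVec A z (j + 1) = ‖lanczosRes A z j‖⁻¹ • lanczosRes A z j := rfl

lemma lanczosOffDiag_succ (j : ℕ) : lanczosOffDiag A z (j + 1) = ‖lanczosRes A z j‖ := rfl

/-- This remains true at breakdown, where the residual and the normalised vector are both zero. -/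
lemma offDiag_smul_vec (j : ℕ) :
    lanczosOffDiag A z (j + 1) • lanczosVec A z (j + 1) = lanczosRes A z j := by
  rw [lanczosOffDiag_succ, lanczosVec_succ, smul_smul]
  rcases eq_or_ne (lanczosRes A z j) 0 with h | h
  · simp [h]
  · rw [mul_inv_cancel₀ (norm_ne_zero_iff.2 h), one_smul]

/-- The three-term recurrence. -/
lemma mulV_lanczosVec (j : ℕ) :
    mulV A (lanczosVec A z j) = lanczosOffDiag A z j • (lanczos A z j).1
      + lanczosDiag A z j • lanczosVec A z j
      + lanczosOffDiag A z (j + 1) • lanczosVec A z (j + 1) := by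
  rw [offDiag_smul_vec, lanczosRes]; abel

lemma norm_smul_lanczosVec_zero : ‖z‖ • lanczosVec A z 0 = z := by
  rw [lanczosVec_zero, smul_smul]
  rcases eq_or_ne z 0 with rfl | h
  · simp
  · rw [mul_inv_cancel₀ (norm_ne_zero_iff.2 h), one_smul]

variable {A z}

lemma norm_lanczosVec {j : ℕ} (h : lanczosVec A z j ≠ 0) : ‖lanczosVec A z j‖ = 1 := by
  cases j with
  | zero =>
    rw [lanczosVec_zero] at h ⊢
    have : z ≠ 0 := by rintro rfl; simp at h
    rw [norm_smul, norm_inv, norm_norm, inv_mul_cancel₀ (norm_ne_zero_iff.2 this)]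
  | succ j =>
    rw [lanczosVec_succ] at h ⊢
    have : lanczosRes A z j ≠ 0 := by intro h'; simp [h'] at h
    rw [norm_smul, norm_inv, norm_norm, inv_mul_cancel₀ (norm_ne_zero_iff.2 this)]

lemma lanczosOffDiag_eq_zero {j : ℕ} (h : lanczosVec A z j = 0) : lanczosOffDiag A z j = 0 := by
  cases j with
  | zero => rfl
  | succ j =>
    by_contra hne
    rw [lanczosOffDiag_succ, norm_eq_zero] at hne
    rw [lanczosVec_succ, smul_eq_zero, inv_eq_zero, norm_eq_zero] at h
    tauto

lemma lanczosVec_succ_eq_zero {j : ℕ} (h : lanczosVec A z j = 0) :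
    lanczosVec A z (j + 1) = 0 := by
  rw [lanczosVec_succ, lanczosRes, lanczosOffDiag_eq_zero h, h]; simp

lemma lanczosVec_eq_zero_of_le {j l : ℕ} (hjl : j ≤ l) (h : lanczosVec A z j = 0) :
    lanczosVec A z l = 0 := by
  induction l, hjl using Nat.le_induction with
  | base => exact h
  | succ l _ ih => exact lanczosVec_succ_eq_zero ih

lemma inner_lanczosRes_self {j : ℕ} (h : lanczosVec A z j ≠ 0) :
    inner ℝ (lanczosVec A z j) (lanczosRes A z j) = 0 := by
  rw [lanczosRes, inner_sub_right, real_inner_smul_right, real_inner_self_eq_norm_sq,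
    norm_lanczosVec h, lanczosDiag]
  ring

/-- Orthogonality of the Lanczos vectors. -/
lemma inner_lanczosVec (hA : A.IsHermitian) {j : ℕ} (h : ∀ i < j, lanczosVec A z i ≠ 0) :
    ∀ i < j, inner ℝ (lanczosVec A z i) (lanczosVec A z j) = 0 := by
  induction j using Nat.strong_induction_on with
  | _ j ih =>
  cases j with
  | zero => intro i hi; omega
  | succ j =>
    intro i hi
    rw [lanczosVec_succ, real_inner_smul_right, mul_eq_zero]
    right
    rcases Nat.lt_succ_iff_lt_or_eq.1 hi with hij | rfl
    swap
    · exact inner_lanczosRes_self (h _ (by omega))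
    have horth : ∀ a b, a < b → b ≤ j →
        inner ℝ (lanczosVec A z a) (lanczosVec A z b) = 0 := fun a b hab hb =>
      ih b (by omega) (fun i hi => h i (by omega)) a hab
    obtain ⟨l, rfl⟩ : ∃ l, j = l + 1 := ⟨j - 1, by omega⟩
    rw [lanczosRes, inner_sub_right, inner_sub_right, real_inner_smul_right,
      real_inner_smul_right, horth i (l + 1) hij le_rfl, mul_zero, sub_zero, inner_mulV_right,
      transpose_eq_of_isHermitian hA, lanczos_fst_succ, mulV_lanczosVec, inner_add_left,
      inner_add_left, real_inner_smul_left, real_inner_smul_left, real_inner_smul_left,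
      horth i (l + 1) hij le_rfl, mul_zero, add_zero]
    -- For i = 0 there is no previous vector and the coefficient is zero.
    have h0 : lanczosOffDiag A z i * inner ℝ (lanczos A z i).1 (lanczosVec A z (l + 1)) = 0 := by
      cases i with
      | zero => simp [lanczosOffDiag_zero]
      | succ i => rw [lanczos_fst_succ, horth i (l + 1) (by omega) le_rfl, mul_zero]
    rw [h0, zero_add]
    -- It remains to compare β_{i+1} ⟨v_{i+1}, v_{l+1}⟩ with β_{l+1} ⟨v_i, v_l⟩. Both vanish for i <
    -- l; for i = l they agree because the vectors have norm one.
    rcases Nat.lt_succ_iff_lt_or_eq.1 hij with hil | rfl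
    · rw [horth (i + 1) (l + 1) (by omega) le_rfl, horth i l hil (by omega)]; simp
    · rw [real_inner_self_eq_norm_sq, real_inner_self_eq_norm_sq, norm_lanczosVec (h _ (by omega)),
        norm_lanczosVec (h _ (by omega))]; simp

variable (A z) in
/-- The linear combination `V_m c` of the first `m` Lanczos vectors. -/
def lanczosComb (m : ℕ) (c : Fin m → ℝ) : Vec ι := ∑ j : Fin m, c j • lanczosVec A z j

lemma lanczosComb_add (m : ℕ) (c d : Fin m → ℝ) :
    lanczosComb A z m (c + d) = lanczosComb A z m c + lanczosComb A z m d := by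
  simp [lanczosComb, add_smul, Finset.sum_add_distrib]

lemma lanczosComb_smul (m : ℕ) (r : ℝ) (c : Fin m → ℝ) :
    lanczosComb A z m (r • c) = r • lanczosComb A z m c := by
  simp [lanczosComb, mul_smul, Finset.smul_sum]

/-- The last coordinate of a coefficient vector (zero if there is none). -/
def lastCoord {m : ℕ} (c : Fin m → ℝ) : ℝ := if h : m - 1 < m then c ⟨m - 1, h⟩ else 0

lemma lanczosT_apply (m : ℕ) (i j : Fin m) :
    lanczosT A z m i j = (if i = j then lanczosDiag A z j else 0)
      + (if (i : ℕ) + 1 = j then lanczosOffDiag A z j else 0)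
      + (if (j : ℕ) + 1 = i then lanczosOffDiag A z i else 0) := by
  simp only [lanczosT, Matrix.of_apply, Fin.ext_iff]
  split_ifs <;> first | omega | simp_all

lemma sum_lanczosT_smul (m : ℕ) (j : Fin m) :
    mulV A (lanczosVec A z j) = ∑ i, lanczosT A z m i j • lanczosVec A z i
      + if (j : ℕ) + 1 = m then lanczosOffDiag A z m • lanczosVec A z m else 0 := by
  simp_rw [lanczosT_apply, add_smul, ite_smul, zero_smul, Finset.sum_add_distrib]
  rw [mulV_lanczosVec, Finset.sum_ite_eq' Finset.univ j, if_pos (Finset.mem_univ _)]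
  have h1 : ∑ i : Fin m, (if (i : ℕ) + 1 = j then lanczosOffDiag A z j • lanczosVec A z i else 0)
      = lanczosOffDiag A z j • (lanczos A z j).1 := by
    obtain ⟨j, hj⟩ := j
    cases j with
    | zero => simp [lanczosOffDiag_zero]
    | succ j =>
      rw [Finset.sum_eq_single ⟨j, by omega⟩]
      · simp [lanczos_fst_succ]
      · intro b _ hb
        rw [if_neg]
        intro h; exact hb (Fin.ext (by simpa using h))
      · simp
  have h2 : ∑ i : Fin m, (if (j : ℕ) + 1 = i then lanczosOffDiag A z i • lanczosVec A z i else 0)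
      + (if (j : ℕ) + 1 = m then lanczosOffDiag A z m • lanczosVec A z m else 0)
      = lanczosOffDiag A z (j + 1) • lanczosVec A z (j + 1) := by
    by_cases hj : (j : ℕ) + 1 = m
    · rw [Finset.sum_eq_zero, if_pos hj, zero_add, hj]
      intro i _
      rw [if_neg]; omega
    · rw [if_neg hj, add_zero, Finset.sum_eq_single ⟨j + 1, by omega⟩]
      · simp
      · intro b _ hb
        rw [if_neg]
        intro h; exact hb (Fin.ext (by simpa using h.symm))
      · simp
  rw [h1, ← h2]; abel

/-- This is A V_m = V_m T_m + β_m v_m e_mᵀ. It is a rewriting of the recurrence and needs neither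
symmetry nor orthogonality. -/
lemma lanczosComb_mulVec (m : ℕ) (c : Fin m → ℝ) :
    mulV A (lanczosComb A z m c) = lanczosComb A z m ((lanczosT A z m).mulVec c)
      + lastCoord c • lanczosOffDiag A z m • lanczosVec A z m := by
  have h1 : lanczosComb A z m ((lanczosT A z m).mulVec c)
      = ∑ j, c j • ∑ i, lanczosT A z m i j • lanczosVec A z i := by
    simp only [lanczosComb, Matrix.mulVec, dotProduct, Finset.sum_smul, Finset.smul_sum]
    rw [Finset.sum_comm]
    refine Finset.sum_congr rfl fun i _ => Finset.sum_congr rfl fun j _ => ?_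
    rw [smul_smul, mul_comm]
  have h2 : ∑ j : Fin m, c j •
      (if (j : ℕ) + 1 = m then lanczosOffDiag A z m • lanczosVec A z m else 0)
      = lastCoord c • lanczosOffDiag A z m • lanczosVec A z m := by
    unfold lastCoord
    split_ifs with h
    · rw [Finset.sum_eq_single ⟨m - 1, h⟩]
      · rw [if_pos]; simp only; omega
      · intro b _ hb
        rw [if_neg, smul_zero]
        intro h'; exact hb (Fin.ext (by simp only; omega))
      · simp
    · have : m = 0 := by omega
      subst this; simp
  rw [h1, ← h2, lanczosComb, mulV_sum, ← Finset.sum_add_distrib]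
  refine Finset.sum_congr rfl fun j _ => ?_
  rw [mulV_smul, sum_lanczosT_smul, smul_add]

/-- The first unit vector. -/
def unitZero (m : ℕ) : Fin m → ℝ := fun l => if (l : ℕ) = 0 then 1 else 0

lemma isHermitian_lanczosT (m : ℕ) : (lanczosT A z m).IsHermitian := by
  ext i j
  rw [Matrix.conjTranspose_apply, star_trivial, lanczosT_apply, lanczosT_apply]
  by_cases h : i = j
  · subst h; simp
  · have h' : j ≠ i := Ne.symm h
    simp only [h, h', if_false]; ring

lemma krylov_eq (f : ℝ → ℝ) (m : ℕ) :
    krylov f A z m = ‖z‖ • lanczosComb A z m ((cfc f (lanczosT A z m)).mulVec (unitZero m)) := by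
  simp only [krylov, lanczosComb, Finset.smul_sum, smul_smul]
  rfl

lemma norm_smul_lanczosComb_unitZero {m : ℕ} (hm : 1 ≤ m) :
    ‖z‖ • lanczosComb A z m (unitZero m) = z := by
  rw [lanczosComb, Finset.sum_eq_single ⟨0, hm⟩]
  · simp [unitZero, norm_smul_lanczosVec_zero]
  · intro b _ hb
    rw [unitZero, if_neg, zero_smul]
    intro h; exact hb (Fin.ext h)
  · simp

/-- The powers of `T_m` applied to the first unit vector have growing support. -/
lemma pow_lanczosT_support (m d : ℕ) (i : Fin m) (h : d < i) :
    ((lanczosT A z m) ^ d).mulVec (unitZero m) i = 0 := by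
  induction d generalizing i with
  | zero =>
    rw [pow_zero, Matrix.one_mulVec, unitZero, if_neg (by omega)]
  | succ d ih =>
    rw [pow_succ', ← Matrix.mulVec_mulVec, Matrix.mulVec, dotProduct]
    refine Finset.sum_eq_zero fun j _ => ?_
    by_cases hj : d < j
    · rw [ih j hj, mul_zero]
    · rw [lanczosT_apply, if_neg (by rintro rfl; omega), if_neg (by omega), if_neg (by omega)]
      simp

/-- Each multiplication by the tridiagonal T_m moves the support by at most one position, so degree
below m - 1 does not reach the last coordinate. -/
lemma lastCoord_aeval {m : ℕ} {p : ℝ[X]} (hp : p.natDegree + 1 < m) :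
    lastCoord ((aeval (lanczosT A z m) p).mulVec (unitZero m)) = 0 := by
  rw [lastCoord, dif_pos (by omega), aeval_eq_sum_range, Matrix.sum_mulVec, Finset.sum_apply]
  refine Finset.sum_eq_zero fun d hd => ?_
  rw [Finset.mem_range] at hd
  rw [Matrix.smul_mulVec, Pi.smul_apply, pow_lanczosT_support, smul_zero]
  simp only; omega

variable [DecidableEq ι]

/-- Polynomials in `A` applied to `z`, in terms of the Lanczos matrix. -/
lemma aeval_mulV_eq {m : ℕ} (hm : 1 ≤ m) (p : ℝ[X]) :
    (p.natDegree < m ∨ lanczosVec A z m = 0 →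
      mulV (aeval A p) z
        = ‖z‖ • lanczosComb A z m ((aeval (lanczosT A z m) p).mulVec (unitZero m))) ∧
    (p.natDegree ≤ m → ∃ κ : ℝ, mulV (aeval A p) z
        = ‖z‖ • lanczosComb A z m ((aeval (lanczosT A z m) p).mulVec (unitZero m))
          + κ • lanczosVec A z m) := by
  induction hd : p.natDegree using Nat.strong_induction_on generalizing p with
  | _ d ih =>
  have hC : ∀ r : ℝ, mulV (aeval A (C r)) z
      = ‖z‖ • lanczosComb A z m ((aeval (lanczosT A z m) (C r)).mulVec (unitZero m)) := by
    intro r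
    rw [aeval_mulV_C, aeval_C, Algebra.algebraMap_eq_smul_one, Matrix.smul_mulVec,
      Matrix.one_mulVec, lanczosComb_smul, smul_comm, norm_smul_lanczosComb_unitZero hm]
  rcases Nat.eq_zero_or_pos d with rfl | hpos
  · rw [natDegree_eq_zero] at hd
    obtain ⟨r, rfl⟩ := hd
    exact ⟨fun _ => hC r, fun _ => ⟨0, by rw [hC r, zero_smul, add_zero]⟩⟩
  -- Induction along p = X * p.divX + p(0): multiplication by A commutes with V_m except for the
  -- term along v_m, whose coefficient is the last coordinate of `divX` of p at T_m, applied to the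
  -- first unit vector.
  have hdec := X_mul_divX_add p
  have hdeg : p.divX.natDegree = d - 1 := by rw [natDegree_divX_eq_natDegree_tsub_one, hd]
  obtain ⟨ih1, -⟩ := ih (d - 1) (by omega) p.divX hdeg
  have key : (d - 1 < m ∨ lanczosVec A z m = 0) → mulV (aeval A p) z
      = ‖z‖ • lanczosComb A z m ((aeval (lanczosT A z m) p).mulVec (unitZero m))
        + (‖z‖ * lastCoord ((aeval (lanczosT A z m) p.divX).mulVec (unitZero m))
          * lanczosOffDiag A z m) • lanczosVec A z m := by
    intro h
    conv_lhs => rw [← hdec, aeval_mulV_add, aeval_mulV_X_mul, ih1 h, hC, mulV_smul,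
      lanczosComb_mulVec]
    conv_rhs => rw [← hdec, map_add, map_mul, aeval_X, Matrix.add_mulVec, lanczosComb_add,
      ← Matrix.mulVec_mulVec, smul_add]
    rw [hdec, smul_add, smul_smul, smul_smul]
    abel
  refine ⟨fun h => ?_, fun h => ⟨_, key (Or.inl (by omega))⟩⟩
  rw [key (h.imp_left fun _ => by omega)]
  rcases h with h | h
  · rw [lastCoord_aeval (by omega)]; simp
  · rw [h]; simp

end Lanczos

/-! ### The Krylov approximation error -/

section KrylovError

open Polynomial Lagrange

variable {ι : Type*} [Fintype ι] {A : Matrix ι ι ℝ} {z : Vec ι}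

/-- The node set may be larger than the spectrum, so that one polynomial can represent the same
function on two matrices at once. -/
lemma cfc_eq_aeval_interpolate {κ : Type*} [Fintype κ] [DecidableEq κ] {B : Matrix κ κ ℝ}
    (hB : B.IsHermitian) (f : ℝ → ℝ) {s : Finset ℝ} (hs : spectrum ℝ B ⊆ s) :
    cfc f B = aeval B (interpolate s id f) := by
  rw [← cfc_eval_eq_aeval hB]
  refine cfc_congr_spectrum fun t ht => ?_
  exact (eval_interpolate_at_node (v := id) f Function.injective_id.injOn (hs ht)).symm

/-- Vectors after a breakdown are zero, so a nonzero v_m guarantees that v_0, …, v_m are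
orthonormal. -/
lemma inner_lanczosVec_of_ne {m : ℕ} (hA : A.IsHermitian) (hm : lanczosVec A z m ≠ 0) {i j : ℕ}
    (hi : i ≤ m) (hj : j ≤ m) :
    inner ℝ (lanczosVec A z i) (lanczosVec A z j) = if i = j then 1 else 0 := by
  have hne : ∀ l ≤ m, lanczosVec A z l ≠ 0 := fun l hl h => hm (lanczosVec_eq_zero_of_le hl h)
  rcases lt_trichotomy i j with h | rfl | h
  · rw [if_neg h.ne, inner_lanczosVec hA (fun l hl => hne l (by omega)) i h]
  · rw [if_pos rfl, real_inner_self_eq_norm_sq, norm_lanczosVec (hne _ hi), one_pow]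
  · rw [if_neg h.ne', real_inner_comm, inner_lanczosVec hA (fun l hl => hne l (by omega)) j h]

lemma inner_lanczosComb {m : ℕ} (hA : A.IsHermitian) (hm : lanczosVec A z m ≠ 0)
    (c d : Fin m → ℝ) :
    inner ℝ (lanczosComb A z m c) (lanczosComb A z m d) = ∑ i, c i * d i := by
  simp only [lanczosComb, sum_inner, inner_sum, real_inner_smul_left, real_inner_smul_right]
  refine Finset.sum_congr rfl fun i _ => ?_
  rw [Finset.sum_eq_single i]
  · rw [inner_lanczosVec_of_ne hA hm i.2.le i.2.le]; simp [mul_comm]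
  · intro j _ hj
    rw [inner_lanczosVec_of_ne hA hm j.2.le i.2.le, if_neg (fun h => hj (Fin.ext h))]; simp
  · simp

lemma inner_lanczosComb_vec {m : ℕ} (hA : A.IsHermitian) (hm : lanczosVec A z m ≠ 0)
    (c : Fin m → ℝ) : inner ℝ (lanczosComb A z m c) (lanczosVec A z m) = 0 := by
  simp only [lanczosComb, sum_inner, real_inner_smul_left]
  refine Finset.sum_eq_zero fun i _ => ?_
  rw [inner_lanczosVec_of_ne hA hm i.2.le le_rfl, if_neg i.2.ne, mul_zero]

/-- Ritz values are bounded below by the bottom of the spectrum. -/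
lemma le_of_mem_spectrum_lanczosT {m : ℕ} (hA : A.IsHermitian) (hm : lanczosVec A z m ≠ 0)
    {a : ℝ} (ha : ∀ v : Vec ι, a * ‖v‖ ^ 2 ≤ inner ℝ v (mulV A v)) {t : ℝ}
    (ht : t ∈ spectrum ℝ (lanczosT A z m)) : a ≤ t := by
  refine le_of_mem_spectrum (isHermitian_lanczosT m) (fun v => ?_) ht
  have h := ha (lanczosComb A z m v.ofLp)
  rw [lanczosComb_mulVec, inner_add_right, smul_smul, real_inner_smul_right,
    inner_lanczosComb_vec hA hm, mul_zero, add_zero, inner_lanczosComb hA hm,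
    ← real_inner_self_eq_norm_sq, inner_lanczosComb hA hm] at h
  rw [← real_inner_self_eq_norm_sq, inner_eq_sum, inner_eq_sum]
  exact h

/-- A function whose interpolation error at nodes in `[a, ∞)` is controlled by the nodal
polynomial. -/
def InterpolationBound (f : ℝ → ℝ) (a G : ℝ) : Prop :=
  ∀ s : Finset ℝ, (∀ θ ∈ s, a ≤ θ) → ∀ t, a ≤ t →
    |f t - (interpolate s id f).eval t| ≤ G * (a ^ s.card)⁻¹ * |(nodal s id).eval t|

lemma interpolationBound_inv {a : ℝ} (ha : 0 < a) :
    InterpolationBound (fun t => t⁻¹) a a⁻¹ := by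
  intro s hs t ht
  refine (abs_inv_sub_interpolate_le ha hs ht).trans ?_
  have : t⁻¹ ≤ a⁻¹ := inv_anti₀ ha ht
  calc _ ≤ (a ^ s.card)⁻¹ * |(nodal s id).eval t| * a⁻¹ := by gcongr
    _ = _ := by ring

lemma interpolationBound_inv_sqrt {a : ℝ} (ha : 0 < a) :
    InterpolationBound (fun t => (√t)⁻¹) a (√a)⁻¹ := by
  intro s hs t ht
  refine (abs_inv_sqrt_sub_interpolate_le ha hs ht).trans ?_
  have : (√t)⁻¹ ≤ (√a)⁻¹ := inv_anti₀ (Real.sqrt_pos.2 ha) (Real.sqrt_le_sqrt ht)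
  calc _ ≤ (a ^ s.card)⁻¹ * |(nodal s id).eval t| * (√a)⁻¹ := by gcongr
    _ = _ := by ring

variable [DecidableEq ι]

/-- The Krylov error is bounded by any monic polynomial of degree `m` in `A`, applied to `z`. -/
theorem norm_sub_krylov_le (hA : A.IsHermitian) {a G : ℝ} (ha : 0 < a) (hG : 0 ≤ G)
    (hlow : ∀ v : Vec ι, a * ‖v‖ ^ 2 ≤ inner ℝ v (mulV A v)) {f : ℝ → ℝ}
    (hf : InterpolationBound f a G) {m : ℕ} (hm : 1 ≤ m) {q : ℝ[X]} (hq : q.Monic)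
    (hqm : q.natDegree = m) :
    ‖mulV (cfc f A) z - krylov f A z m‖ ≤ G * (a ^ m)⁻¹ * ‖mulV (aeval A q) z‖ := by
  have hT := isHermitian_lanczosT (A := A) (z := z) m
  have hr : 0 ≤ G * (a ^ m)⁻¹ * ‖mulV (aeval A q) z‖ := by positivity
  by_cases hv : lanczosVec A z m = 0
  -- Breakdown: the Krylov space is invariant. One polynomial that interpolates f on the spectra of
  -- both A and T_m shows that the approximation is exact.
  · set s : Finset ℝ :=
      A.finite_real_spectrum.toFinset ∪ (lanczosT A z m).finite_real_spectrum.toFinset with hs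
    have h1 : cfc f A = aeval A (interpolate s id f) :=
      cfc_eq_aeval_interpolate hA f (by rw [hs]; simp)
    have h2 : cfc f (lanczosT A z m) = aeval (lanczosT A z m) (interpolate s id f) :=
      cfc_eq_aeval_interpolate hT f (by rw [hs]; simp)
    rw [krylov_eq, h1, h2, (aeval_mulV_eq hm _).1 (Or.inr hv), sub_self, norm_zero]
    exact hr
  set s : Finset ℝ := (lanczosT A z m).finite_real_spectrum.toFinset with hs
  have hsle : ∀ θ ∈ s, a ≤ θ := fun θ hθ =>
    le_of_mem_spectrum_lanczosT hA hv hlow (by simpa [hs] using hθ)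
  have hcard : s.card ≤ m := by
    have : s = Finset.image hT.eigenvalues Finset.univ := by
      ext t; simp [hs, spectrum_eq_range hT]
    rw [this]
    exact Finset.card_image_le.trans (by simp)
  have hpdeg : (interpolate s id f).natDegree < m := by
    have := degree_interpolate_lt f (Function.injective_id.injOn (s := (s : Set ℝ)))
    rcases eq_or_ne (interpolate s id f) 0 with h | h
    · rw [h, natDegree_zero]; exact hm
    · exact (natDegree_lt_iff_degree_lt h).2 (this.trans_le (by exact_mod_cast hcard))
  have h2 : cfc f (lanczosT A z m) = aeval (lanczosT A z m) (interpolate s id f) :=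
    cfc_eq_aeval_interpolate hT f (by rw [hs]; simp)
  -- The nodal polynomial of the Ritz values annihilates T_m.
  have hw0 : aeval (lanczosT A z m) (nodal s (id : ℝ → ℝ)) = 0 := by
    rw [← cfc_eval_eq_aeval hT, cfc_congr_spectrum (g := fun _ => 0), cfc_const_zero]
    intro t ht
    exact eval_nodal_at_node (v := id) (by simpa [hs] using ht)
  have h3 : mulV (cfc f A) z - krylov f A z m
      = mulV (cfc (fun t => f t - (interpolate s id f).eval t) A) z := by
    rw [krylov_eq, h2, ← (aeval_mulV_eq hm _).1 (Or.inl hpdeg), ← sub_mulV,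
      ← cfc_eval_eq_aeval hA, cfc_sub _ _ _ (continuousOn_spectrum _) (continuousOn_spectrum _)]
  have h4 : ‖mulV (cfc f A) z - krylov f A z m‖
      ≤ G * (a ^ s.card)⁻¹ * ‖mulV (aeval A (nodal s (id : ℝ → ℝ))) z‖ := by
    rw [h3, ← cfc_eval_eq_aeval hA]
    exact norm_mulV_cfc_le hA (by positivity)
      (fun t ht => hf s hsle t (le_of_mem_spectrum hA hlow ht)) z
  rcases hcard.lt_or_eq with hlt | heq
  -- With fewer than m distinct Ritz values the nodal polynomial has degree below m, so it
  -- annihilates z and the error is zero.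
  · rw [(aeval_mulV_eq hm _).1 (Or.inl (by rw [natDegree_nodal]; exact hlt)), hw0] at h4
    refine h4.trans (le_of_eq_of_le ?_ hr)
    simp [lanczosComb]
  · rw [heq] at h4
    refine h4.trans ?_
    gcongr
    obtain ⟨κ, hκ⟩ := (aeval_mulV_eq (A := A) (z := z) hm (nodal s (id : ℝ → ℝ))).2
      (by rw [natDegree_nodal, heq])
    rw [hw0] at hκ
    have hw : mulV (aeval A (nodal s (id : ℝ → ℝ))) z = κ • lanczosVec A z m := by
      rw [hκ]; simp [lanczosComb]
    have hqw : (q - nodal s (id : ℝ → ℝ)).natDegree < m := by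
      rcases eq_or_ne (q - nodal s (id : ℝ → ℝ)) 0 with h | h
      · rw [h, natDegree_zero]; exact hm
      · rw [natDegree_lt_iff_degree_lt h]
        have := degree_sub_lt_left (p := q) (q := nodal s (id : ℝ → ℝ))
          (by rw [degree_eq_natDegree hq.ne_zero, degree_nodal, hqm, heq]) hq.ne_zero
          (by rw [hq.leadingCoeff, nodal_monic.leadingCoeff])
        rwa [degree_eq_natDegree hq.ne_zero, hqm] at this
    -- The monic q differs from the nodal polynomial by degree below m, that is, by an element of
    -- the Krylov space. This is orthogonal to v_m, so Pythagoras shows that the nodal polynomial is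
    -- optimal.
    have hq' : mulV (aeval A q) z = κ • lanczosVec A z m
        + ‖z‖ • lanczosComb A z m
          ((aeval (lanczosT A z m) (q - nodal s (id : ℝ → ℝ))).mulVec (unitZero m)) := by
      rw [← hw, ← (aeval_mulV_eq hm _).1 (Or.inl hqw), ← aeval_mulV_add]
      congr 2; ring
    rw [hw, hq']
    refine (sq_le_sq₀ (norm_nonneg _) (norm_nonneg _)).1 ?_
    rw [norm_add_sq_real, real_inner_smul_left, real_inner_smul_right, real_inner_comm,
      inner_lanczosComb_vec hA hv]
    nlinarith [sq_nonneg ‖‖z‖ • lanczosComb A z m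
          ((aeval (lanczosT A z m) (q - nodal s (id : ℝ → ℝ))).mulVec (unitZero m))‖]

end KrylovError

/-! ### Superlinear convergence from the decay of the eigenvalues -/

section Superlinear

open Polynomial

variable {ι : Type*} [Fintype ι]

/-- Decreasing (in absolute value) enumeration of a finite family. -/
lemma exists_sorted_abs (μ : ι → ℝ) : ∃ ν : ℕ → ℝ,
    (∀ N l, (∃ j < N, μ l = ν j) ∨ ∀ j < N, |μ l| ≤ |ν j|) ∧
    (∀ j, ν j ≠ 0 → j + 1 ≤ (Finset.univ.filter fun l => |ν j| ≤ |μ l|).card) ∧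
    ∃ N, ∑ l, μ l ^ 2 = ∑ j ∈ Finset.range N, ν j ^ 2 := by
  set n := Fintype.card ι
  let e₀ : Fin n ≃ ι := (Fintype.equivFin ι).symm
  let g : Fin n → ℝ := fun i => -|μ (e₀ i)|
  let e : Fin n ≃ ι := (Tuple.sort g).trans e₀
  have hanti : ∀ i j : Fin n, i ≤ j → |μ (e j)| ≤ |μ (e i)| := fun i j hij =>
    neg_le_neg_iff.1 (Tuple.monotone_sort g hij)
  -- The enumeration is continued by zero past the cardinality; this is why the counting clause is
  -- restricted to nonzero terms.
  refine ⟨fun j => if h : j < n then μ (e ⟨j, h⟩) else 0, fun N l => ?_, fun j hj => ?_, n, ?_⟩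
  · obtain ⟨i, rfl⟩ := e.surjective l
    by_cases hi : (i : ℕ) < N
    · exact Or.inl ⟨i, hi, by simp⟩
    · refine Or.inr fun j hj => ?_
      have hjn : j < n := by omega
      simp only [dif_pos hjn]
      exact hanti _ _ (Fin.mk_le_of_le_val (by omega))
  · have hjn : j < n := by by_contra h; simp [h] at hj
    simp only [dif_pos hjn]
    calc j + 1 = ((Finset.Iic (⟨j, hjn⟩ : Fin n)).map e.toEmbedding).card := by simp
      _ ≤ _ := by
        refine Finset.card_le_card fun l hl => ?_
        rw [Finset.mem_map] at hl
        obtain ⟨i, hi, rfl⟩ := hl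
        simp only [Finset.mem_filter, Finset.mem_univ, true_and]
        exact hanti _ _ (Finset.mem_Iic.1 hi)
  · rw [← e.sum_comp, Finset.sum_range]
    simp

/-- Eigenvalue counting bound `#{l : t ≤ |μ l|} t ≤ p t + r`. -/
def CountBound (μ : ι → ℝ) (p : ℕ) (r : ℝ) : Prop :=
  ∀ t, 0 < t → ((Finset.univ.filter fun l => t ≤ |μ l|).card : ℝ) * t ≤ p * t + r

/-- At the threshold t = |μ l| the count is at least one. -/
lemma CountBound.abs_le {μ : ι → ℝ} {r : ℝ} (h : CountBound μ 0 r) (hr : 0 ≤ r) (l : ι) :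
    |μ l| ≤ r := by
  rcases eq_or_ne (μ l) 0 with h0 | h0
  · simpa [h0] using hr
  have hpos := abs_pos.2 h0
  have h1 := h _ hpos
  have h2 : (1 : ℝ) ≤ (Finset.univ.filter fun l' => |μ l| ≤ |μ l'|).card := by
    exact_mod_cast Finset.card_pos.2 ⟨l, by simp⟩
  simp only [CharP.cast_eq_zero, zero_mul, zero_add] at h1
  nlinarith

/-- At the threshold t = |x| the count bound reads (j + 1) |x| ≤ p |x| + r, and p ≤ (j + 1) / 2
absorbs the middle term. -/
lemma abs_mul_succ_le {μ : ι → ℝ} {p : ℕ} {r : ℝ} (h : CountBound μ p r) (hr : 0 ≤ r) {j : ℕ}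
    {x : ℝ} (hx : x ≠ 0 → j + 1 ≤ (Finset.univ.filter fun l => |x| ≤ |μ l|).card)
    (hj : 2 * p ≤ j + 1) : |x| * (j + 1) ≤ 2 * r := by
  rcases eq_or_ne x 0 with h0 | h0
  · simpa [h0] using hr
  have hpos := abs_pos.2 h0
  have h1 := h _ hpos
  have h2 : ((j : ℝ) + 1) ≤ (Finset.univ.filter fun l => |x| ≤ |μ l|).card := by
    exact_mod_cast hx h0
  have h3 : (2 * p : ℝ) ≤ j + 1 := by exact_mod_cast hj
  nlinarith [mul_le_mul_of_nonneg_right h2 hpos.le, mul_le_mul_of_nonneg_right h3 hpos.le]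

/-- Uniform bound for the sum of the squares of the eigenvalues. -/
lemma CountBound.sum_sq_le {μ : ι → ℝ} {r : ℝ} (h : CountBound μ 0 r) (hr : 0 ≤ r) :
    ∑ l, μ l ^ 2 ≤ (2 * r) ^ 2 * ∑' j : ℕ, (1 / ((j : ℝ) + 1) ^ 2) := by
  obtain ⟨ν, -, h2, N, h3⟩ := exists_sorted_abs μ
  have hs : Summable fun j : ℕ => 1 / ((j : ℝ) + 1) ^ 2 := by
    have := (summable_nat_add_iff 1).2 (Real.summable_one_div_nat_pow.2 (one_lt_two))
    simpa using this
  rw [h3]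
  calc ∑ j ∈ Finset.range N, ν j ^ 2
      ≤ ∑ j ∈ Finset.range N, (2 * r) ^ 2 * (1 / ((j : ℝ) + 1) ^ 2) := by
        refine Finset.sum_le_sum fun j _ => ?_
        have h4 := abs_mul_succ_le h hr (h2 j) (by simp)
        rw [mul_one_div, le_div_iff₀ (by positivity), ← sq_abs, ← mul_pow]
        exact pow_le_pow_left₀ (by positivity) h4 2
    _ = (2 * r) ^ 2 * ∑ j ∈ Finset.range N, (1 / ((j : ℝ) + 1) ^ 2) := by rw [Finset.mul_sum]
    _ ≤ _ := by
        gcongr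
        exact hs.sum_le_tsum _ fun j _ => by positivity

/-- Only the first p factors can pay the extra L; thus the crude bound on the leading eigenvalues
costs a constant that does not grow with N. -/
lemma prod_range_le_of_eventually_le {x : ℕ → ℝ} {ε L : ℝ} {p : ℕ} (hx : ∀ j, 0 ≤ x j)
    (hL : 1 ≤ L) (hε : 0 < ε) (h1 : ∀ j, x j ≤ L * ε) (h2 : ∀ j, p ≤ j → x j ≤ ε) (N : ℕ) :
    ∏ j ∈ Finset.range N, x j ≤ L ^ p * ε ^ N := by
  have h3 : ∏ j ∈ Finset.range N, x j ≤ L ^ (min N p) * ε ^ N := by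
    induction N with
    | zero => simp
    | succ N ih =>
      rw [Finset.prod_range_succ]
      rcases lt_or_ge N p with h | h
      · rw [min_eq_left (by omega)] at ih ⊢
        calc _ ≤ (L ^ N * ε ^ N) * (L * ε) :=
              mul_le_mul ih (h1 N) (hx N) (by positivity)
          _ = _ := by ring
      · rw [min_eq_right (by omega)] at ih ⊢
        calc _ ≤ (L ^ p * ε ^ N) * ε := mul_le_mul ih (h2 N h) (hx N) (by positivity)
          _ = _ := by ring
  refine h3.trans (mul_le_mul_of_nonneg_right ?_ (by positivity))
  exact pow_le_pow_right₀ hL (min_le_right _ _)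

variable [DecidableEq ι]

/-- A monic polynomial of degree `m` that is small on the spectrum of `1 + E`. -/
lemma exists_monic_small {E : Matrix ι ι ℝ} (hE : E.IsHermitian) {ε L : ℝ} {p : ℕ} (hL : 1 ≤ L)
    (hε : 0 < ε) (h0 : CountBound hE.eigenvalues 0 (L * ε / 2))
    (h1 : CountBound hE.eigenvalues p (ε / 2)) {m : ℕ} (hm : 1 ≤ m) (z : Vec ι) :
    ∃ q : ℝ[X], q.Monic ∧ q.natDegree = m ∧
      ‖mulV (aeval (1 + E) q) z‖
        ≤ L ^ (2 * p) * (2 * ε) ^ (m - 1) / (m - 1).factorial * ‖mulV E z‖ := by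
  obtain ⟨ν, hν1, hν2, -⟩ := exists_sorted_abs hE.eigenvalues
  -- The factor X yields E z, which stays bounded in probability, unlike z. The other m - 1 roots
  -- are the leading eigenvalues of E.
  set q₀ : ℝ[X] := X * ∏ j ∈ Finset.range (m - 1), (X - C (ν j)) with hq₀
  have hmon₀ : (∏ j ∈ Finset.range (m - 1), (X - C (ν j))).Monic :=
    monic_prod_of_monic _ _ fun j _ => monic_X_sub_C _
  have hmon : q₀.Monic := monic_X.mul hmon₀
  have hdeg : q₀.natDegree = m := by
    rw [hq₀, natDegree_X_mul hmon₀.ne_zero, natDegree_prod_of_monic _ _ fun j _ => monic_X_sub_C _]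
    simp; omega
  have hae : aeval (1 + E) (q₀.comp (X - C 1)) = aeval E q₀ := by
    rw [aeval_comp]; congr 1; simp
  refine ⟨q₀.comp (X - C 1), hmon.comp_X_sub_C 1, by
    rw [natDegree_comp, hdeg, natDegree_X_sub_C, mul_one], ?_⟩
  have hprod : ∏ j ∈ Finset.range (m - 1), (2 * |ν j|)
      ≤ L ^ (2 * p) * (2 * ε) ^ (m - 1) / (m - 1).factorial := by
    rw [le_div_iff₀ (by positivity), ← Finset.prod_range_add_one_eq_factorial, Nat.cast_prod,
      ← Finset.prod_mul_distrib, mul_pow]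
    have h2 : ∏ j ∈ Finset.range (m - 1), (2 * |ν j| * ((j + 1 : ℕ) : ℝ))
        = 2 ^ (m - 1) * ∏ j ∈ Finset.range (m - 1), (|ν j| * ((j : ℝ) + 1)) := by
      rw [← Finset.card_range (m - 1), ← Finset.prod_const, Finset.card_range,
        ← Finset.prod_mul_distrib]
      exact Finset.prod_congr rfl fun j _ => by push_cast; ring
    have h3 := prod_range_le_of_eventually_le (x := fun j => |ν j| * ((j : ℝ) + 1)) (p := 2 * p)
      (fun j => by positivity) hL hε
      (fun j => by
        have := abs_mul_succ_le h0 (by positivity) (hν2 j) (by simp)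
        linarith)
      (fun j hj => by
        have := abs_mul_succ_le h1 (by positivity) (hν2 j) (by omega)
        linarith) (m - 1)
    rw [h2]
    nlinarith [pow_pos (two_pos : (0 : ℝ) < 2) (m - 1)]
  have hid : cfc (fun t : ℝ => t) E = E := cfc_id' ℝ E hE
  refine le_trans ?_ (mul_le_mul_of_nonneg_right hprod (norm_nonneg _))
  rw [hae, ← cfc_eval_eq_aeval hE]
  conv_rhs => rw [← hid]
  refine norm_mulV_cfc_le hE (Finset.prod_nonneg fun j _ => by positivity) (fun t ht => ?_) z
  rw [spectrum_eq_range hE] at ht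
  obtain ⟨l, rfl⟩ := ht
  rw [hq₀, eval_mul, eval_X, eval_prod, abs_mul, mul_comm, Finset.abs_prod]
  refine mul_le_mul_of_nonneg_right ?_ (abs_nonneg _)
  -- An eigenvalue is either one of the roots or dominated by all of them; in the latter case |t -
  -- ν_j| ≤ 2 |ν_j|.
  rcases hν1 (m - 1) l with ⟨j, hj, h⟩ | h
  · rw [Finset.prod_eq_zero (Finset.mem_range.2 hj) (by simp [h])]
    exact Finset.prod_nonneg fun j _ => by positivity
  · refine Finset.prod_le_prod (fun _ _ => abs_nonneg _) fun j hj => ?_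
    simp only [eval_sub, eval_X, eval_C]
    have := h j (Finset.mem_range.1 hj)
    exact (abs_sub _ _).trans (by linarith)

/-- The scale of the eigenvalue tail that produces the convergence factor `K`. -/
def tailScale (a K : ℝ) : ℝ := K * a / (4 * Real.exp 1)

/-- The constant in the superlinear bound. -/
def superConst (a G T K : ℝ) (p : ℕ) : ℝ :=
  G * (max 1 (2 * T / tailScale a K)) ^ (2 * p) / (2 * tailScale a K)

lemma tailScale_pos {a K : ℝ} (ha : 0 < a) (hK : 0 < K) : 0 < tailScale a K := by
  unfold tailScale; positivity

lemma superConst_nonneg {a G T K : ℝ} (p : ℕ) (ha : 0 < a) (hG : 0 ≤ G) (hK : 0 < K) :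
    0 ≤ superConst a G T K p := by
  have := tailScale_pos ha hK
  unfold superConst; positivity

/-- From m^m / m! ≤ e^m; the factor m lost in passing from m! to (m - 1)! is at most 2^m. -/
lemma inv_factorial_le {m : ℕ} (hm : 1 ≤ m) :
    (((m - 1).factorial : ℕ) : ℝ)⁻¹ ≤ 2 ^ m * Real.exp 1 ^ m / m ^ m := by
  have hm0 : (0 : ℝ) < m := by exact_mod_cast hm
  have h1 : (m : ℝ) ^ m / m.factorial ≤ Real.exp 1 ^ m := by
    rw [← Real.exp_nat_mul, mul_one]
    exact Real.pow_div_factorial_le_exp (m : ℝ) hm0.le m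
  have h2 : (m.factorial : ℝ) = m * (m - 1).factorial := by
    exact_mod_cast (Nat.mul_factorial_pred (by omega)).symm
  have h3 : (m : ℝ) ≤ 2 ^ m := by exact_mod_cast Nat.lt_two_pow_self.le
  have hf : (0 : ℝ) < (m - 1).factorial := by positivity
  rw [h2, div_le_iff₀ (by positivity)] at h1
  rw [le_div_iff₀ (by positivity), inv_mul_le_iff₀ hf]
  calc (m : ℝ) ^ m ≤ Real.exp 1 ^ m * (m * (m - 1).factorial) := h1
    _ ≤ Real.exp 1 ^ m * (2 ^ m * (m - 1).factorial) := by gcongr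
    _ = _ := by ring

/-- Superlinear convergence of Krylov approximations, with an explicit constant. -/
theorem norm_sub_krylov_le_superlinear {E : Matrix ι ι ℝ} (hE : E.IsHermitian) {a G T K : ℝ}
    (ha : 0 < a) (hG : 0 ≤ G) (hK : 0 < K)
    (hlow : ∀ v : Vec ι, a * ‖v‖ ^ 2 ≤ inner ℝ v (mulV (1 + E) v)) {f : ℝ → ℝ}
    (hf : InterpolationBound f a G) {p : ℕ} (h0 : CountBound hE.eigenvalues 0 T)
    (h1 : CountBound hE.eigenvalues p (tailScale a K / 2)) {m : ℕ} (hm : 1 ≤ m) (z : Vec ι) :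
    ‖mulV (cfc f (1 + E)) z - krylov f (1 + E) z m‖
      ≤ superConst a G T K p * (K / m) ^ m * ‖mulV E z‖ := by
  have hs := tailScale_pos ha hK
  have hA : (1 + E).IsHermitian := Matrix.isHermitian_one.add hE
  set ε := tailScale a K with hε
  set L := max 1 (2 * T / ε) with hL
  have hL1 : 1 ≤ L := le_max_left _ _
  -- The choice of L makes the global bound T at most L ε / 2, the form needed for the leading
  -- factors.
  have h0' : CountBound hE.eigenvalues 0 (L * ε / 2) := by
    intro t ht
    refine (h0 t ht).trans ?_
    have : 2 * T / ε ≤ L := le_max_right _ _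
    rw [div_le_iff₀ hs] at this
    linarith
  obtain ⟨q, hq, hqm, hqz⟩ := exists_monic_small hE hL1 hs h0' h1 hm z
  refine (norm_sub_krylov_le hA ha hG hlow hf hm hq hqm).trans ?_
  have hm0 : (0 : ℝ) < m := by exact_mod_cast hm
  have hfac := inv_factorial_le hm
  calc G * (a ^ m)⁻¹ * ‖mulV (aeval (1 + E) q) z‖
      ≤ G * (a ^ m)⁻¹ * (L ^ (2 * p) * (2 * ε) ^ (m - 1) / (m - 1).factorial * ‖mulV E z‖) := by
        gcongr
    _ = G * (a ^ m)⁻¹ * (L ^ (2 * p) * (2 * ε) ^ (m - 1)) * ‖mulV E z‖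
          * ((m - 1).factorial : ℝ)⁻¹ := by ring
    _ ≤ G * (a ^ m)⁻¹ * (L ^ (2 * p) * (2 * ε) ^ (m - 1)) * ‖mulV E z‖
          * (2 ^ m * Real.exp 1 ^ m / m ^ m) := by gcongr
    _ = superConst a G T K p * (K / m) ^ m * ‖mulV E z‖ := by
        have h2 : (2 * ε) ^ (m - 1) = (2 * ε) ^ m / (2 * ε) := by
          rw [eq_div_iff (by positivity), ← pow_succ, Nat.sub_add_cancel hm]
        -- This fixes the 4 e in `tailScale`: one 2 comes from |t - ν_j| ≤ 2 |ν_j|, and 2 e comes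
        -- from the factorial.
        have h3 : (a ^ m)⁻¹ * (2 * ε) ^ m * (2 ^ m * Real.exp 1 ^ m) = K ^ m := by
          rw [← inv_pow, ← mul_pow, ← mul_pow, ← mul_pow]
          congr 1
          rw [hε, tailScale]; field_simp; norm_num
        rw [h2, superConst, ← hε, ← hL, div_pow, ← h3]
        field_simp

end Superlinear

/-! ### Quadratic forms -/

section QuadraticForm

variable {ι : Type*} [Fintype ι] {A C : Matrix ι ι ℝ}

lemma inner_mulV_eq_dotProduct (A : Matrix ι ι ℝ) (v w : Vec ι) :
    inner ℝ v (mulV A w) = dotProduct v.ofLp (A.mulVec w.ofLp) := by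
  rw [inner_eq_sum]; rfl

lemma inner_mulV_nonneg (hA : A.PosSemidef) (v : Vec ι) : 0 ≤ inner ℝ v (mulV A v) := by
  rw [inner_mulV_eq_dotProduct]
  simpa using hA.dotProduct_mulVec_nonneg v.ofLp

lemma inner_mulV_pos (hA : A.PosDef) {v : Vec ι} (hv : v ≠ 0) : 0 < inner ℝ v (mulV A v) := by
  rw [inner_mulV_eq_dotProduct]
  have : v.ofLp ≠ 0 := by simpa using hv
  simpa using hA.dotProduct_mulVec_pos this

variable [DecidableEq ι]

lemma mulV_mulV_inv {F : Matrix ι ι ℝ} (hF : IsUnit F.det) (v : Vec ι) :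
    mulV F (mulV F⁻¹ v) = v := by
  rw [← mul_mulV, Matrix.mul_nonsing_inv _ hF, one_mulV]

lemma mulV_inv_mulV {F : Matrix ι ι ℝ} (hF : IsUnit F.det) (v : Vec ι) :
    mulV F⁻¹ (mulV F v) = v := by
  rw [← mul_mulV, Matrix.nonsing_inv_mul _ hF, one_mulV]

lemma Matrix.PosDef.isUnit_det' (hA : A.PosDef) : IsUnit A.det :=
  (Matrix.isUnit_iff_isUnit_det A).1 hA.isUnit

/-- Cauchy–Schwarz inequality for a quadratic form and its inverse. -/
lemma sq_inner_le_mul (hC : C.PosDef) (x y : Vec ι) :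
    inner ℝ x y ^ 2 ≤ inner ℝ x (mulV C⁻¹ x) * inner ℝ y (mulV C y) := by
  rcases eq_or_ne y 0 with rfl | hy
  · simp
  have hpos := inner_mulV_pos hC hy
  have hdet := Matrix.PosDef.isUnit_det' hC
  -- This t minimises the form of C⁻¹ at x - t C y, and nonnegativity of the minimum is the claim.
  set t := inner ℝ x y / inner ℝ y (mulV C y) with ht
  have h := inner_mulV_nonneg hC.inv.posSemidef (x - t • mulV C y)
  have hs : inner ℝ (mulV C y) (mulV C⁻¹ x) = inner ℝ x y := by
    rw [inner_mulV_left, transpose_eq_of_isHermitian hC.isHermitian, mulV_mulV_inv hdet,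
      real_inner_comm]
  have hs' : inner ℝ (mulV C y) y = inner ℝ y (mulV C y) := real_inner_comm _ _
  rw [mulV_sub, mulV_smul, mulV_inv_mulV hdet, inner_sub_left, inner_sub_right, inner_sub_right,
    real_inner_smul_left, real_inner_smul_left, real_inner_smul_right, real_inner_smul_right, hs,
    hs'] at h
  have h2 : t * inner ℝ y (mulV C y) = inner ℝ x y := div_mul_cancel₀ _ hpos.ne'
  have h3 : t * inner ℝ x y ≤ inner ℝ x (mulV C⁻¹ x) := by
    rw [← h2] at h ⊢; nlinarith
  calc inner ℝ x y ^ 2 = (t * inner ℝ x y) * inner ℝ y (mulV C y) := by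
        rw [sq]; nth_rewrite 1 [← h2]; ring
    _ ≤ _ := mul_le_mul_of_nonneg_right h3 hpos.le

lemma inner_mulV_eq_sum (hA : A.IsHermitian) (v : Vec ι) :
    inner ℝ v (mulV A v) = ∑ l, hA.eigenvalues l * inner ℝ (hA.eigenvectorBasis l) v ^ 2 := by
  rw [← hA.eigenvectorBasis.sum_inner_mul_inner v (mulV A v)]
  refine Finset.sum_congr rfl fun l _ => ?_
  rw [inner_mulV_right, transpose_eq_of_isHermitian hA, mulV_eigenvectorBasis,
    real_inner_smul_left, real_inner_comm]
  ring

/-- The quadratic form summed over an orthonormal family is at most the trace. -/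
lemma sum_inner_mulV_le_trace (hA : A.PosSemidef) {κ : Type*} [Fintype κ] {y : κ → Vec ι}
    (hy : Orthonormal ℝ y) : ∑ i, inner ℝ (y i) (mulV A (y i)) ≤ A.trace := by
  have hH := hA.isHermitian
  have htr : A.trace = ∑ l, hH.eigenvalues l := by
    simpa using hH.trace_eq_sum_eigenvalues
  simp_rw [inner_mulV_eq_sum hH]
  rw [Finset.sum_comm, htr]
  refine Finset.sum_le_sum fun l _ => ?_
  rw [← Finset.mul_sum]
  -- Bessel's inequality for the unit eigenvector.
  have h1 : ∑ i, inner ℝ (hH.eigenvectorBasis l) (y i) ^ 2 ≤ 1 := by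
    have := hy.sum_inner_products_le (hH.eigenvectorBasis l) (s := Finset.univ)
    simp only [OrthonormalBasis.norm_eq_one, one_pow] at this
    refine le_of_eq_of_le (Finset.sum_congr rfl fun i _ => ?_) this
    rw [real_inner_comm, Real.norm_eq_abs, sq_abs]
  have := hA.eigenvalues_nonneg l
  nlinarith

end QuadraticForm

/-! ### Preconditioned matrices -/

/-- `F` is a factor of a preconditioner `M` which dominates `ρ C⁻¹`. -/
structure IsPreconditioner {ι : Type*} [Fintype ι] [DecidableEq ι] (C M F : Matrix ι ι ℝ)
    (ρ : ℝ) : Prop where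
  posDef : C.PosDef
  rho_pos : 0 < ρ
  posSemidef : (M - ρ • C⁻¹).PosSemidef
  mul_transpose : F * F.transpose = M

namespace IsPreconditioner

variable {ι : Type*} [Fintype ι] [DecidableEq ι] {C M F : Matrix ι ι ℝ} {ρ : ℝ}

lemma posDef_precond (h : IsPreconditioner C M F ρ) : M.PosDef := by
  have := (h.posDef.inv.smul h.rho_pos).posSemidef_add h.posSemidef
  simpa using this

lemma isUnit_det (h : IsPreconditioner C M F ρ) : IsUnit F.det := by
  have h1 := Matrix.PosDef.isUnit_det' h.posDef_precond
  rw [← h.mul_transpose, Matrix.det_mul] at h1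
  exact isUnit_of_mul_isUnit_left h1

lemma isUnit_det_transpose (h : IsPreconditioner C M F ρ) : IsUnit F.transpose.det := by
  rw [Matrix.det_transpose]; exact h.isUnit_det

lemma inv_eq (h : IsPreconditioner C M F ρ) : M⁻¹ = F⁻¹.transpose * F⁻¹ := by
  rw [← h.mul_transpose, Matrix.mul_inv_rev, Matrix.transpose_nonsing_inv]

lemma mul_inner_le (h : IsPreconditioner C M F ρ) (y : Vec ι) :
    ρ * inner ℝ y (mulV C⁻¹ y) ≤ inner ℝ y (mulV M y) := by
  have := inner_mulV_nonneg h.posSemidef y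
  rw [sub_mulV, smul_mulV, inner_sub_right, real_inner_smul_right] at this
  linarith

lemma transpose_mulV (h : IsPreconditioner C M F ρ) (v : Vec ι) :
    mulV F.transpose (mulV F⁻¹.transpose v) = v := by
  rw [Matrix.transpose_nonsing_inv, mulV_mulV_inv h.isUnit_det_transpose]

lemma norm_sq_eq (h : IsPreconditioner C M F ρ) (v : Vec ι) :
    ‖v‖ ^ 2 = inner ℝ (mulV F⁻¹.transpose v) (mulV M (mulV F⁻¹.transpose v)) := by
  rw [← h.mul_transpose, mul_mulV, inner_mulV_right, h.transpose_mulV,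
    real_inner_self_eq_norm_sq]

lemma conjInv_self (h : IsPreconditioner C M F ρ) : conjInv F M = 1 := by
  rw [conjInv, ← h.mul_transpose, ← Matrix.mul_assoc, Matrix.nonsing_inv_mul _ h.isUnit_det,
    Matrix.one_mul, ← Matrix.transpose_mul, Matrix.nonsing_inv_mul _ h.isUnit_det,
    Matrix.transpose_one]

/-- The left side is a diagonal entry of M⁻¹, and M ≥ ρ C⁻¹ suggests M⁻¹ ≤ C / ρ. With y = M⁻¹ e and
s = ⟨y, e⟩ = ⟨y, M y⟩, Cauchy–Schwarz gives ρ s² ≤ s C_jj, which avoids inverting the matrix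
inequality. -/
lemma norm_sq_inv_single_le (h : IsPreconditioner C M F ρ) (j : ι) :
    ‖mulV F⁻¹ (EuclideanSpace.single j 1)‖ ^ 2 ≤ C j j / ρ := by
  set e : Vec ι := EuclideanSpace.single j 1
  set y : Vec ι := mulV M⁻¹ e with hy
  have hMdet := Matrix.PosDef.isUnit_det' h.posDef_precond
  have h1 : inner ℝ y e = ‖mulV F⁻¹ e‖ ^ 2 := by
    rw [hy, h.inv_eq, mul_mulV, inner_mulV_left, Matrix.transpose_transpose,
      real_inner_self_eq_norm_sq]
  have h2 : inner ℝ y (mulV M y) = ‖mulV F⁻¹ e‖ ^ 2 := by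
    rw [← h1, hy, mulV_mulV_inv hMdet]
  have h3 := sq_inner_le_mul h.posDef y e
  have h4 := h.mul_inner_le y
  have h5 : inner ℝ e (mulV C e) = C j j := by
    rw [inner_single_mulV, mulV_single]
  rw [h5, h1] at h3
  rw [h2] at h4
  have hC : 0 ≤ C j j := h.posDef.posSemidef.diag_nonneg
  set s := ‖mulV F⁻¹ e‖ ^ 2 with hs
  have hs0 : 0 ≤ s := sq_nonneg _
  rw [le_div_iff₀ h.rho_pos]
  rcases hs0.eq_or_lt with h0 | hpos
  · rw [← h0]; simpa using hC
  have h6 : ρ * s ^ 2 ≤ s * C j j := by nlinarith [h.rho_pos]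
  nlinarith

/-- For a stationary covariance C_jj = c(0), so a Euclidean error becomes an error in each
coordinate with a constant independent of the lattice. -/
lemma abs_mulV_inv_transpose_le (h : IsPreconditioner C M F ρ) (v : Vec ι) (j : ι) :
    |mulV F.transpose⁻¹ v j| ≤ √(C j j / ρ) * ‖v‖ := by
  rw [← inner_single_mulV, ← Matrix.transpose_nonsing_inv, inner_mulV_right,
    Matrix.transpose_transpose]
  refine (abs_real_inner_le_norm _ _).trans ?_
  gcongr
  exact Real.le_sqrt_of_sq_le (h.norm_sq_inv_single_le j)

end IsPreconditioner

lemma inner_conjInv {ι : Type*} [Fintype ι] [DecidableEq ι] (F B : Matrix ι ι ℝ) (v : Vec ι) :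
    inner ℝ v (mulV (conjInv F B) v)
      = inner ℝ (mulV F⁻¹.transpose v) (mulV B (mulV F⁻¹.transpose v)) := by
  rw [conjInv, mul_mulV, mul_mulV, inner_mulV_right]

lemma isHermitian_conjInv {ι : Type*} [Fintype ι] [DecidableEq ι] (F : Matrix ι ι ℝ)
    {B : Matrix ι ι ℝ} (hB : B.IsHermitian) : (conjInv F B).IsHermitian := by
  rw [Matrix.IsHermitian, Matrix.conjTranspose_eq_transpose_of_trivial, conjInv,
    Matrix.transpose_mul, Matrix.transpose_mul, Matrix.transpose_transpose,
    transpose_eq_of_isHermitian hB, Matrix.mul_assoc]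

/-! ### Eigenvalue counting -/

section Counting

variable {ι : Type*} [Fintype ι] [DecidableEq ι] {C M F : Matrix ι ι ℝ} {ρ : ℝ}

/-- Trace bound for the quadratic form of `C` on the kernel of `φ`. -/
def KernelTraceBound {κ : Type*} (C : Matrix ι ι ℝ) (φ : Vec ι →ₗ[ℝ] κ → ℝ) (R : ℝ) : Prop :=
  ∀ (r : ℕ) (y : Fin r → Vec ι), Orthonormal ℝ y → (∀ i, φ (y i) = 0) →
    ∑ i, inner ℝ (y i) (mulV C (y i)) ≤ R

/-- Rank–nullity on Y: every component of φ removes at most one dimension. -/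
lemma exists_orthonormal_ker {ι : Type*} [Fintype ι] {κ : Type*} [Fintype κ] (φ : Vec ι →ₗ[ℝ] κ → ℝ)
    (Y : Submodule ℝ (Vec ι)) : ∃ (r : ℕ) (y : Fin r → Vec ι), Orthonormal ℝ y ∧
      (∀ i, y i ∈ Y) ∧ (∀ i, φ (y i) = 0) ∧ Module.finrank ℝ Y ≤ r + Fintype.card κ := by
  set W : Submodule ℝ (Vec ι) := Y ⊓ LinearMap.ker φ with hW
  refine ⟨Module.finrank ℝ W, fun i => (stdOrthonormalBasis ℝ W i : Vec ι),
    (stdOrthonormalBasis ℝ W).orthonormal.comp_linearIsometry W.subtypeₗᵢ,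
    fun i => (stdOrthonormalBasis ℝ W i).2.1, fun i => (stdOrthonormalBasis ℝ W i).2.2, ?_⟩
  have h1 := LinearMap.finrank_range_add_finrank_ker (φ.domRestrict Y)
  have h2 : Module.finrank ℝ (LinearMap.range (φ.domRestrict Y)) ≤ Fintype.card κ := by
    simpa using (LinearMap.range (φ.domRestrict Y)).finrank_le
  have h3 : Module.finrank ℝ (LinearMap.ker (φ.domRestrict Y)) = Module.finrank ℝ W := by
    rw [LinearMap.ker_domRestrict, ← Submodule.finrank_map_subtype_eq,
      Submodule.map_comap_subtype]
  omega

/-- One-sided eigenvalue count. -/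
lemma card_mul_le (h : IsPreconditioner C M F ρ) {D : ι → ℝ} {d : ℝ} (hd : 0 ≤ d) (hD : ∀ i, |D i| ≤ d)
    (hE : (conjInv F (Matrix.diagonal D)).IsHermitian) {κ : Type*} [Fintype κ]
    {φ : Vec ι →ₗ[ℝ] κ → ℝ} {R : ℝ} (hR : KernelTraceBound C φ R) {t : ℝ} (ht : 0 < t)
    {σ : ℝ} (hσ : |σ| = 1) {S : Finset ι} (hS : ∀ l ∈ S, t ≤ σ * hE.eigenvalues l) :
    (S.card : ℝ) * (t * ρ) ≤ Fintype.card κ * (t * ρ) + d * R := by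
  set u := hE.eigenvectorBasis with hu
  set U : Submodule ℝ (Vec ι) := Submodule.span ℝ (Set.range fun l : S => u l) with hU
  have hUrank : Module.finrank ℝ U = S.card := by
    rw [hU, finrank_span_eq_card, Fintype.card_coe]
    exact u.orthonormal.linearIndependent.comp _ Subtype.val_injective
  have hUorth : ∀ v ∈ U, ∀ l ∉ S, inner ℝ (u l) v = 0 := by
    intro v hv l hl
    induction hv using Submodule.span_induction with
    | mem x hx =>
      obtain ⟨k, rfl⟩ := hx
      exact u.orthonormal.2 (fun h => hl (h ▸ k.2))
    | zero => simp
    | add x y _ _ hx hy => rw [inner_add_right, hx, hy, add_zero]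
    | smul a x _ hx => rw [real_inner_smul_right, hx, mul_zero]
  have hform : ∀ v ∈ U, t * ‖v‖ ^ 2
      ≤ σ * inner ℝ v (mulV (conjInv F (Matrix.diagonal D)) v) := by
    intro v hv
    rw [inner_mulV_eq_sum hE, ← u.sum_sq_inner_right, Finset.mul_sum, Finset.mul_sum]
    refine Finset.sum_le_sum fun l _ => ?_
    by_cases hl : l ∈ S
    · rw [← mul_assoc]
      exact mul_le_mul_of_nonneg_right (hS l hl) (sq_nonneg _)
    · rw [← hu, hUorth v hv l hl]; simp
  have hinj : Function.Injective (mulVLin F⁻¹.transpose) := by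
    intro v w hvw
    rw [← h.transpose_mulV v, ← h.transpose_mulV w]
    exact congrArg _ hvw
  -- With y = Fᵀ⁻¹ v, the form of E at v becomes that of D at y, and ‖v‖² becomes ⟨y, M y⟩.
  set Y := U.map (mulVLin F⁻¹.transpose) with hY
  have hYrank : Module.finrank ℝ Y = S.card := by
    rw [← hUrank]; exact (Submodule.equivMapOfInjective _ hinj U).finrank_eq.symm
  obtain ⟨r, y, hyo, hyY, hyker, hr⟩ := exists_orthonormal_ker φ Y
  rw [hYrank] at hr
  -- For a unit vector y in Y: t ρ ⟨y, C⁻¹ y⟩ ≤ t ⟨y, M y⟩ ≤ d and 1 ≤ ⟨y, C⁻¹ y⟩ ⟨y, C y⟩.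
  have hlow : ∀ i, t * ρ ≤ d * inner ℝ (y i) (mulV C (y i)) := by
    intro i
    obtain ⟨v, hv, hvy⟩ := hyY i
    rw [mulVLin_apply] at hvy
    have h1 := hform v hv
    rw [h.norm_sq_eq, inner_conjInv, hvy] at h1
    have hn : ‖y i‖ = 1 := hyo.1 i
    have h2 : σ * inner ℝ (y i) (mulV (Matrix.diagonal D) (y i)) ≤ d := by
      refine (le_abs_self _).trans ?_
      rw [abs_mul, hσ, one_mul, inner_diagonal]
      refine (Finset.abs_sum_le_sum_abs _ _).trans ?_
      calc ∑ l, |D l * y i l ^ 2| ≤ ∑ l, d * y i l ^ 2 := by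
            refine Finset.sum_le_sum fun l _ => ?_
            rw [abs_mul, abs_of_nonneg (sq_nonneg (y i l))]
            exact mul_le_mul_of_nonneg_right (hD l) (sq_nonneg _)
        _ = d * ‖y i‖ ^ 2 := by rw [← Finset.mul_sum, EuclideanSpace.real_norm_sq_eq]
        _ = d := by rw [hn]; ring
    have h3 := h.mul_inner_le (y i)
    have h4 := sq_inner_le_mul h.posDef (y i) (y i)
    rw [real_inner_self_eq_norm_sq, hn] at h4
    have h5 := inner_mulV_nonneg h.posDef.posSemidef (y i)
    have h6 : t * (ρ * inner ℝ (y i) (mulV C⁻¹ (y i))) ≤ d :=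
      (mul_le_mul_of_nonneg_left h3 ht.le).trans (h1.trans h2)
    have h7 : 0 < t * ρ := mul_pos ht h.rho_pos
    calc t * ρ ≤ t * ρ * (inner ℝ (y i) (mulV C⁻¹ (y i)) * inner ℝ (y i) (mulV C (y i))) := by
          nlinarith
      _ = t * (ρ * inner ℝ (y i) (mulV C⁻¹ (y i))) * inner ℝ (y i) (mulV C (y i)) := by ring
      _ ≤ _ := mul_le_mul_of_nonneg_right h6 h5
  have hsum : (r : ℝ) * (t * ρ) ≤ d * R := by
    calc (r : ℝ) * (t * ρ) = ∑ _i : Fin r, t * ρ := by simp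
      _ ≤ ∑ i, d * inner ℝ (y i) (mulV C (y i)) := Finset.sum_le_sum fun i _ => hlow i
      _ = d * ∑ i, inner ℝ (y i) (mulV C (y i)) := by rw [Finset.mul_sum]
      _ ≤ d * R := by
        exact mul_le_mul_of_nonneg_left (hR r y hyo hyker) hd
  have hr' : (S.card : ℝ) ≤ r + Fintype.card κ := by exact_mod_cast hr
  have h7 : 0 < t * ρ := mul_pos ht h.rho_pos
  nlinarith

/-- Two-sided eigenvalue count for the preconditioned perturbation. -/
theorem countBound_conjInv (h : IsPreconditioner C M F ρ) {D : ι → ℝ} {d : ℝ} (hd : 0 ≤ d)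
    (hD : ∀ i, |D i| ≤ d) (hE : (conjInv F (Matrix.diagonal D)).IsHermitian) {κ : Type*}
    [Fintype κ] {φ : Vec ι →ₗ[ℝ] κ → ℝ} {R : ℝ} (hR : KernelTraceBound C φ R) :
    CountBound hE.eigenvalues (2 * Fintype.card κ) (2 * d * R / ρ) := by
  intro t ht
  have hρ := h.rho_pos
  -- D may have both signs, so E and -E are counted separately; hence the factor 2 in both
  -- constants.
  have h1 := card_mul_le h hd hD hE hR ht (σ := 1) (by simp)
    (S := Finset.univ.filter fun l => t ≤ hE.eigenvalues l) (fun l hl => by simpa using hl)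
  have h2 := card_mul_le h hd hD hE hR ht (σ := -1) (by simp)
    (S := Finset.univ.filter fun l => t ≤ -hE.eigenvalues l) (fun l hl => by simpa using hl)
  have h3 : ((Finset.univ.filter fun l => t ≤ |hE.eigenvalues l|).card : ℝ)
      ≤ (Finset.univ.filter fun l => t ≤ hE.eigenvalues l).card
        + (Finset.univ.filter fun l => t ≤ -hE.eigenvalues l).card := by
    simp_rw [le_abs, Finset.filter_or]
    exact_mod_cast Finset.card_union_le _ _
  have h4 := mul_le_mul_of_nonneg_right h3 (mul_pos ht hρ).le
  have h5 : 2 * d * R / ρ * ρ = 2 * d * R := div_mul_cancel₀ _ hρ.ne'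
  refine le_of_mul_le_mul_right ?_ hρ
  push_cast
  nlinarith

/-- The full trace bounds the quadratic form on all orthonormal families. -/
lemma kernelTraceBound_trace (hC : C.PosSemidef) :
    KernelTraceBound C (0 : Vec ι →ₗ[ℝ] Fin 0 → ℝ) C.trace :=
  fun _ _ hy _ => sum_inner_mulV_le_trace hC hy

/-- Sums of a vector over the blocks of a partition. -/
def blockSum {κ : Type*} [DecidableEq κ] (key : ι → κ) : Vec ι →ₗ[ℝ] κ → ℝ where
  toFun y b := ∑ i, if key i = b then y i else 0
  map_add' y w := by
    ext b
    simp only [Pi.add_apply, PiLp.add_apply, ← Finset.sum_add_distrib]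
    exact Finset.sum_congr rfl fun i _ => by split_ifs <;> simp
  map_smul' r y := by
    ext b
    simp only [Pi.smul_apply, PiLp.smul_apply, smul_eq_mul, RingHom.id_apply, Finset.mul_sum]
    exact Finset.sum_congr rfl fun i _ => by split_ifs <;> simp

/-- If `C` varies little within blocks, its trace on the orthogonal complement of the block
constants is small. -/
lemma kernelTraceBound_blockSum (hC : C.PosSemidef) {κ : Type*} [DecidableEq κ] (key : ι → κ)
    (rep : κ → ι) {ε : ℝ}
    (hε : ∀ i, C i i - C i (rep (key i)) - C (rep (key i)) i + C (rep (key i)) (rep (key i)) ≤ ε) :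
    KernelTraceBound C (blockSum key) (Fintype.card ι * ε) := by
  set r : ι → ι := fun i => rep (key i) with hr
  -- B subtracts the value at the block representative. Its transpose fixes every vector with
  -- vanishing block sums, so C may be replaced there by B C Bᵀ, whose diagonal entries are the
  -- increments bounded by ε.
  set B : Matrix ι ι ℝ := 1 - Matrix.of fun i j => if j = r i then 1 else 0 with hB
  have hBC : ∀ i j, (B * C * B.transpose) i j = C i j - C i (r j) - C (r i) j + C (r i) (r j) := by
    intro i j
    have hR : ∀ (N : Matrix ι ι ℝ) i j,
        ((Matrix.of fun i j => if j = r i then (1 : ℝ) else 0) * N) i j = N (r i) j := by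
      intro N i j; simp [Matrix.mul_apply]
    have hR' : ∀ (N : Matrix ι ι ℝ) i j,
        (N * (Matrix.of fun i j => if j = r i then (1 : ℝ) else 0).transpose) i j = N i (r j) := by
      intro N i j; simp [Matrix.mul_apply]
    rw [hB, Matrix.transpose_sub, Matrix.transpose_one, Matrix.mul_sub, Matrix.sub_mul,
      Matrix.one_mul, Matrix.mul_one, Matrix.sub_apply, hR', Matrix.sub_apply, Matrix.sub_apply,
      hR, hR]
    ring
  have hpsd : (B * C * B.transpose).PosSemidef := by
    have := hC.mul_mul_conjTranspose_same B
    rwa [Matrix.conjTranspose_eq_transpose_of_trivial] at this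
  intro n y hy hker
  have heq : ∀ i, inner ℝ (y i) (mulV C (y i)) = inner ℝ (y i) (mulV (B * C * B.transpose) (y i)) := by
    intro i
    have hfix : mulV B.transpose (y i) = y i := by
      ext a
      rw [hB, Matrix.transpose_sub, Matrix.transpose_one, sub_mulV, one_mulV, PiLp.sub_apply,
        mulV_apply, sub_eq_self]
      have h0 : ∀ b : κ, ∑ l, (if key l = b then y i l else 0) = 0 := fun b =>
        congrFun (hker i) b
      simp only [Matrix.transpose_apply, Matrix.of_apply, ite_mul, one_mul, zero_mul]
      -- The sum over points with the same representative is regrouped by block; the blocks met are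
      -- finitely many even if κ is not finite.
      have h1 : ∀ l, (if a = r l then y i l else 0)
          = ∑ b ∈ Finset.univ.image key, if a = rep b then (if key l = b then y i l else 0) else 0 := by
        intro l
        rw [Finset.sum_eq_single (key l)]
        · simp [hr]
        · intro b _ hb; simp [Ne.symm hb]
        · simp
      simp_rw [h1]
      rw [Finset.sum_comm]
      refine Finset.sum_eq_zero fun b _ => ?_
      split_ifs
      · exact h0 b
      · simp
    rw [mul_mulV, mul_mulV, hfix, inner_mulV_right B, hfix]
  simp_rw [heq]
  refine (sum_inner_mulV_le_trace hpsd hy).trans ?_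
  rw [Matrix.trace]
  calc ∑ i, (B * C * B.transpose).diag i ≤ ∑ _i : ι, ε := by
        refine Finset.sum_le_sum fun i _ => ?_
        rw [Matrix.diag_apply, hBC]
        exact hε i
    _ = _ := by simp

end Counting

/-! ### Moments of Poisson counts -/

section Poisson

/-- The Poisson identity E[N g(N - 1)] = r E[g(N)]: the factor n lowers the factorial and the index
is shifted by one. It produces all the moments needed. -/
lemma hasSum_poisson_mul_succ {r : ℝ≥0} {g : ℕ → ℝ} {S : ℝ}
    (h : HasSum (fun n : ℕ => Real.exp (-r) * r ^ n / n.factorial * g n) S) :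
    HasSum (fun n : ℕ => Real.exp (-r) * r ^ n / n.factorial * (n * g (n - 1))) (r * S) := by
  rw [← hasSum_nat_add_iff' 1]
  simp only [Finset.range_one, Finset.sum_singleton, Nat.cast_zero, zero_mul, mul_zero, sub_zero]
  convert! h.mul_left (r : ℝ) using 1
  ext n
  rw [Nat.factorial_succ, Nat.add_sub_cancel]
  push_cast
  field_simp
  ring

lemma hasSum_poisson_variance (r : ℝ≥0) :
    HasSum (fun n : ℕ => Real.exp (-r) * r ^ n / n.factorial * ((n : ℝ) - r)) 0 ∧
    HasSum (fun n : ℕ => Real.exp (-r) * r ^ n / n.factorial * ((n : ℝ) - r) ^ 2) r := by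
  have h0 : HasSum (fun n : ℕ => Real.exp (-r) * r ^ n / n.factorial * 1) 1 := by
    simpa using hasSum_one_poissonMeasure r
  have h1 : HasSum (fun n : ℕ => Real.exp (-r) * r ^ n / n.factorial * (n : ℝ)) r := by
    simpa using hasSum_poisson_mul_succ (g := fun _ => 1) h0
  have h2 := hasSum_poisson_mul_succ (g := fun n => (n : ℝ)) h1
  constructor
  · convert! h1.sub (h0.mul_left (r : ℝ)) using 1
    · ext n; ring
    · ring
  · convert! (h2.add h1).add ((h1.mul_left (-2 * (r : ℝ))).add (h0.mul_left ((r : ℝ) ^ 2))) using 1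
    · ext n
      -- The truncated subtraction n - 1 forces the case n = 0 apart.
      rcases n with _ | n
      · simp; ring
      · simp only [Nat.add_sub_cancel, Nat.cast_add, Nat.cast_one]; ring
    · ring

lemma memLp_poisson (r : ℝ≥0) : MemLp (fun n : ℕ => (n : ℝ) - r) 2 (poissonMeasure r) := by
  rw [memLp_two_iff_integrable_sq .of_discrete, integrable_poissonMeasure_iff]
  simpa using (hasSum_poisson_variance r).2.summable

lemma integral_poisson_sub (r : ℝ≥0) : ∫ n : ℕ, ((n : ℝ) - r) ∂(poissonMeasure r) = 0 := by
  rw [integral_poissonMeasure]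
  simpa using (hasSum_poisson_variance r).1.tsum_eq

lemma integral_poisson_sub_sq (r : ℝ≥0) :
    ∫ n : ℕ, ((n : ℝ) - r) ^ 2 ∂(poissonMeasure r) = r := by
  rw [integral_poissonMeasure]
  simpa using (hasSum_poisson_variance r).2.tsum_eq

end Poisson

/-! ### Score and Fisher information -/

section Score

variable {n₁ n₂ : ℕ} {k : ℕ} (x : Lattice n₁ n₂ → ℝ)

/-- The centred count. -/
def centred (r : Fin k) (i : Lattice n₁ n₂) (y : Fin k → Lattice n₁ n₂ → ℕ) : ℝ :=
  (y r i : ℝ) - cellRate x i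

lemma coe_cellRate (i : Lattice n₁ n₂) :
    (cellRate x i : ℝ) = Real.exp (x i) / ((n₁ : ℝ) * n₂) :=
  Real.coe_toNNReal _ (by positivity)

variable {x} in
lemma cellRate_update_ne {i j : Lattice n₁ n₂} (h : j ≠ i) (t : ℝ) :
    cellRate (Function.update x i t) j = cellRate x j := by
  rw [cellRate, cellRate, Function.update_of_ne h]

/-- Up to terms constant in t, the logarithm of the Poisson weight is -h² exp(t) + y t, with
derivative y - h² exp(t). Only the cell i depends on the varied coordinate. -/
lemma score_apply (y : Fin k → Lattice n₁ n₂ → ℕ) (i : Lattice n₁ n₂) :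
    score x y i = ∑ r, centred x r i y := by
  have hn : (0 : ℝ) < (n₁ : ℝ) * n₂ := by
    have h1 : 0 < n₁ := Fin.pos i.1
    have h2 : 0 < n₂ := Fin.pos i.2
    positivity
  have hterm : ∀ (r : Fin k) (j : Lattice n₁ n₂),
      HasDerivAt (fun t : ℝ =>
        Real.log ((poissonMeasure (cellRate (Function.update x i t) j)).real {y r j}))
        (if j = i then centred x r i y else 0) (x i) := by
    intro r j
    split_ifs with hj
    · subst hj
      have hfun : (fun t : ℝ =>
          Real.log ((poissonMeasure (cellRate (Function.update x j t) j)).real {y r j}))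
          = fun t => -(Real.exp t / ((n₁ : ℝ) * n₂)) + y r j * (t - Real.log ((n₁ : ℝ) * n₂))
            - Real.log (y r j).factorial := by
        funext t
        have hpos : 0 < Real.exp t / ((n₁ : ℝ) * n₂) := by positivity
        rw [poissonMeasure_real_singleton, coe_cellRate, Function.update_self,
          Real.log_div (by positivity) (by positivity), Real.log_mul (by positivity) (by positivity),
          Real.log_exp, Real.log_pow, Real.log_div (by positivity) (by positivity), Real.log_exp]
      rw [hfun]
      have := (((Real.hasDerivAt_exp (x j)).div_const ((n₁ : ℝ) * n₂)).neg.add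
        (((hasDerivAt_id (x j)).sub_const (Real.log ((n₁ : ℝ) * n₂))).const_mul
          (y r j : ℝ))).sub_const (Real.log (y r j).factorial)
      refine this.congr_deriv ?_
      rw [centred, coe_cellRate]; ring
    · simp_rw [cellRate_update_ne hj]
      exact hasDerivAt_const _ _
  have hsum : HasDerivAt (fun t : ℝ => logLik (Function.update x i t) y)
      (∑ r, ∑ j, if j = i then centred x r i y else 0) (x i) := by
    unfold logLik
    exact HasDerivAt.fun_sum fun r _ => HasDerivAt.fun_sum fun j _ => hterm r j
  change deriv _ _ = _
  rw [hsum.deriv]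
  simp

lemma memLp_centred (r : Fin k) (i : Lattice n₁ n₂) : MemLp (centred x r i) 2 (obsLaw k x) := by
  have h1 := (memLp_poisson (cellRate x i)).comp_measurePreserving
    (measurePreserving_eval (fun i : Lattice n₁ n₂ => poissonMeasure (cellRate x i)) i)
  exact h1.comp_measurePreserving (measurePreserving_eval
    (fun _ : Fin k => Measure.pi fun i : Lattice n₁ n₂ => poissonMeasure (cellRate x i)) r)

/-- Distinct replicates or distinct cells are independent and centred; on the diagonal this is the
Poisson variance. -/
lemma integral_centred_mul (r r' : Fin k) (i j : Lattice n₁ n₂) :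
    ∫ y, centred x r i y * centred x r' j y ∂(obsLaw k x)
      = if r = r' ∧ i = j then (cellRate x i : ℝ) else 0 := by
  have hinner : ∀ i, ∫ w : Lattice n₁ n₂ → ℕ, ((w i : ℝ) - cellRate x i)
      ∂(Measure.pi fun i => poissonMeasure (cellRate x i)) = 0 := fun i => by
    rw [integral_comp_eval (μ := fun i => poissonMeasure (cellRate x i))
      (f := fun n : ℕ => (n : ℝ) - cellRate x i) .of_discrete, integral_poisson_sub]
  have hmean : ∀ (r : Fin k) i, ∫ y, centred x r i y ∂(obsLaw k x) = 0 := fun r i => by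
    rw [← hinner i]
    exact integral_comp_eval (μ := fun _ : Fin k => Measure.pi fun i : Lattice n₁ n₂ =>
      poissonMeasure (cellRate x i)) (i := r)
      (f := fun w : Lattice n₁ n₂ → ℕ => (w i : ℝ) - cellRate x i) .of_discrete
  by_cases hr : r = r'
  · subst hr
    have h1 : ∫ y, centred x r i y * centred x r j y ∂(obsLaw k x)
        = ∫ w : Lattice n₁ n₂ → ℕ, ((w i : ℝ) - cellRate x i) * ((w j : ℝ) - cellRate x j)
          ∂(Measure.pi fun i => poissonMeasure (cellRate x i)) :=
      integral_comp_eval (μ := fun _ : Fin k => Measure.pi fun i : Lattice n₁ n₂ =>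
        poissonMeasure (cellRate x i)) (i := r)
        (f := fun w : Lattice n₁ n₂ → ℕ => ((w i : ℝ) - cellRate x i) * ((w j : ℝ) - cellRate x j))
        .of_discrete
    rw [h1]
    by_cases hij : i = j
    · subst hij
      have h2 := integral_comp_eval (μ := fun i => poissonMeasure (cellRate x i)) (i := i)
        (f := fun n : ℕ => ((n : ℝ) - cellRate x i) ^ 2) .of_discrete
      rw [integral_poisson_sub_sq] at h2
      rw [if_pos ⟨rfl, rfl⟩]
      refine Eq.trans ?_ h2
      simp_rw [sq]
    · rw [if_neg (fun h => hij h.2)]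
      have hind := (iIndepFun_pi (μ := fun i : Lattice n₁ n₂ => poissonMeasure (cellRate x i))
        (X := fun i (n : ℕ) => (n : ℝ) - cellRate x i)
        (fun _ => .of_discrete)).indepFun hij
      rw [hind.integral_fun_mul_eq_mul_integral .of_discrete .of_discrete, hinner, zero_mul]
  · rw [if_neg (fun h => hr h.1)]
    have hind := (iIndepFun_pi (μ := fun _ : Fin k => Measure.pi fun i : Lattice n₁ n₂ =>
        poissonMeasure (cellRate x i)) (X := fun _ w => w)
        (fun _ => aemeasurable_id)).indepFun hr
    have hind' : IndepFun (centred x r i) (centred x r' j) (obsLaw k x) :=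
      hind.comp (φ := fun w : Lattice n₁ n₂ → ℕ => (w i : ℝ) - cellRate x i)
        (ψ := fun w : Lattice n₁ n₂ → ℕ => (w j : ℝ) - cellRate x j) .of_discrete .of_discrete
    rw [hind'.integral_fun_mul_eq_mul_integral (memLp_centred x r i).1 (memLp_centred x r' j).1,
      hmean, zero_mul]

instance (k : ℕ) (x : Lattice n₁ n₂ → ℝ) : IsProbabilityMeasure (obsLaw k x) := by
  unfold obsLaw; infer_instance

lemma memLp_score (i : Lattice n₁ n₂) :
    MemLp (fun y => score x y i) 2 (obsLaw k x) := by
  simp_rw [score_apply]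
  exact memLp_finsetSum _ fun r _ => memLp_centred x r i

lemma fisher_eq_diagonal (k : ℕ) :
    fisher k x = Matrix.diagonal fun i => k * (cellRate x i : ℝ) := by
  ext i j
  rw [fisher, Matrix.of_apply]
  simp_rw [score_apply, Finset.sum_mul_sum]
  have hint : ∀ r r' : Fin k, Integrable (fun y => centred x r i y * centred x r' j y)
      (obsLaw k x) := fun r r' => (memLp_centred x r i).integrable_mul (memLp_centred x r' j)
  rw [integral_finsetSum _ fun r _ => integrable_finsetSum _ fun r' _ => hint r r']
  simp_rw [integral_finsetSum _ fun r' _ => hint _ r', integral_centred_mul]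
  by_cases hij : i = j
  · subst hij; simp
  · simp [hij]

/-- Mean square of a linear image of the score. -/
lemma integral_norm_sq_mulV_score (B : Matrix (Lattice n₁ n₂) (Lattice n₁ n₂) ℝ) :
    Integrable (fun y => ‖mulV B (score x y)‖ ^ 2) (obsLaw k x) ∧
    ∫ y, ‖mulV B (score x y)‖ ^ 2 ∂(obsLaw k x)
      = ∑ i, k * (cellRate x i : ℝ) * ‖mulV B (EuclideanSpace.single i 1)‖ ^ 2 := by
  have hint : ∀ i j, Integrable (fun y => score x y i * score x y j) (obsLaw k x) := fun i j =>
    (memLp_score x i).integrable_mul (memLp_score x j)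
  have hexp : ∀ y : Fin k → Lattice n₁ n₂ → ℕ, ‖mulV B (score x y)‖ ^ 2
      = ∑ l, ∑ i, ∑ j, B l i * B l j * (score x y i * score x y j) := by
    intro y
    rw [EuclideanSpace.real_norm_sq_eq]
    refine Finset.sum_congr rfl fun l _ => ?_
    rw [mulV_apply, sq, Finset.sum_mul_sum]
    exact Finset.sum_congr rfl fun i _ => Finset.sum_congr rfl fun j _ => by ring
  have hfi : ∀ i j, ∫ y, score x y i * score x y j ∂(obsLaw k x) = fisher k x i j :=
    fun i j => rfl
  simp_rw [hexp]
  have hI1 : ∀ l i, Integrable (fun y => ∑ j, B l i * B l j * (score x y i * score x y j))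
      (obsLaw k x) := fun l i => integrable_finsetSum _ fun j _ => (hint i j).const_mul _
  have hI2 : ∀ l, Integrable (fun y => ∑ i, ∑ j, B l i * B l j * (score x y i * score x y j))
      (obsLaw k x) := fun l => integrable_finsetSum _ fun i _ => hI1 l i
  refine ⟨integrable_finsetSum _ fun l _ => hI2 l, ?_⟩
  rw [integral_finsetSum _ fun l _ => hI2 l]
  simp_rw [integral_finsetSum _ fun i _ => hI1 _ i,
    integral_finsetSum _ fun j _ => (hint _ j).const_mul _, integral_const_mul, hfi,
    fisher_eq_diagonal, Matrix.diagonal_apply, mul_ite, mul_zero, Finset.sum_ite_eq,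
    Finset.mem_univ, if_true]
  rw [Finset.sum_comm]
  refine Finset.sum_congr rfl fun i _ => ?_
  rw [EuclideanSpace.real_norm_sq_eq, Finset.mul_sum]
  refine Finset.sum_congr rfl fun l _ => ?_
  rw [mulV_single]; ring

end Score

/-! ### Continuity of the covariance function -/

/-- The variogram `2 c(0) - c(d) - c(-d)`. -/
def variogram (c : Torus → ℝ) (d : Torus) : ℝ := 2 * c 0 - c d - c (-d)

section Variogram

variable {Ω : Type*} [MeasurableSpace Ω] {P : Measure Ω} {X : Torus → Ω → ℝ} {c : Torus → ℝ}

lemma variance_sub_zero (hX : IsGaussianProcess X P)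
    (hc : ∀ s t : Torus, covariance (X s) (X t) P = c (s - t)) (d : Torus) :
    variance (X d - X 0) P = variogram c d := by
  have := hX.isProbabilityMeasure
  have h1 := (hX.hasGaussianLaw_eval d).memLp_two
  have h2 := (hX.hasGaussianLaw_eval 0).memLp_two
  rw [variance_sub h1 h2, ← covariance_self h1.1.aemeasurable, ← covariance_self h2.1.aemeasurable,
    hc, hc, hc, variogram]
  have h3 : c (-d) = c d := by
    rw [← zero_sub, ← hc, covariance_comm, hc, sub_zero]
  rw [h3]; simp; ring

/-- The increment is Gaussian, and taking the modulus of its characteristic function removes the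
unknown mean. -/
lemma norm_integral_cexp_sub_zero (hX : IsGaussianProcess X P)
    (hc : ∀ s t : Torus, covariance (X s) (X t) P = c (s - t)) (d : Torus) :
    ‖∫ ω, Complex.exp (((X d ω - X 0 ω : ℝ) : ℂ) * Complex.I) ∂P‖
      = Real.exp (-variogram c d / 2) := by
  have hL := hX.hasGaussianLaw_sub (s := d) (t := 0)
  have hv := variance_nonneg (X d - X 0) P
  have h1 : charFun (P.map (X d - X 0)) 1
      = ∫ ω, Complex.exp (((X d ω - X 0 ω : ℝ) : ℂ) * Complex.I) ∂P := by
    rw [charFun_apply_real, integral_map hL.aemeasurable (by fun_prop)]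
    simp
  rw [← h1, hL.map_eq_gaussianReal, charFun_gaussianReal, Complex.norm_exp,
    variance_sub_zero hX hc]
  rw [variance_sub_zero hX hc] at hv
  congr 1
  simp only [Complex.ofReal_one, one_mul, one_pow, mul_one, Complex.sub_re, Complex.mul_re,
    Complex.I_re, Complex.I_im, Complex.ofReal_re, Complex.ofReal_im, mul_zero, sub_zero]
  rw [Complex.div_re]
  simp [hv]
  ring

/-- The characteristic function of the increment at frequency 1 is bounded by 1, so path continuity
and dominated convergence give the limit 1. The logarithm of its modulus recovers the variance,
without any uniform integrability of the increments. -/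
lemma tendsto_variogram (hX : IsGaussianProcess X P)
    (hc : ∀ s t : Torus, covariance (X s) (X t) P = c (s - t))
    (hcont : ∀ᵐ ω ∂P, Continuous fun s => X s ω) :
    Tendsto (variogram c) (𝓝 0) (𝓝 0) := by
  have := hX.isProbabilityMeasure
  have hlim : Tendsto (fun d => ∫ ω, Complex.exp (((X d ω - X 0 ω : ℝ) : ℂ) * Complex.I) ∂P)
      (𝓝 (0 : Torus)) (𝓝 (∫ _ω, (1 : ℂ) ∂P)) := by
    refine tendsto_integral_filter_of_dominated_convergence (fun _ => 1) ?_ ?_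
      (integrable_const _) ?_
    · refine Eventually.of_forall fun d => ?_
      have := hX.aemeasurable d
      have := hX.aemeasurable 0
      exact AEMeasurable.aestronglyMeasurable (by fun_prop)
    · exact Eventually.of_forall fun d => Eventually.of_forall fun ω => by
        rw [Complex.norm_exp_ofReal_mul_I]
    · filter_upwards [hcont] with ω hω
      have h : Continuous fun d => Complex.exp (((X d ω - X 0 ω : ℝ) : ℂ) * Complex.I) := by
        fun_prop
      have := h.tendsto 0
      simpa using this
  have h2 := hlim.norm
  simp_rw [norm_integral_cexp_sub_zero hX hc] at h2
  simp only [integral_const, probReal_univ, one_smul, norm_one] at h2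
  have h3 := (h2.log one_ne_zero).const_mul (-2)
  simp only [Real.log_exp, Real.log_one, mul_zero] at h3
  refine h3.congr fun d => by ring

end Variogram

/-! ### Uniform spectral bounds on all lattices -/

section Uniform

variable {n₁ n₂ : ℕ}

/-- Block of a lattice point in the subdivision of the torus into `N × N` squares. -/
def blockKey (N : ℕ) [NeZero N] (i : Lattice n₁ n₂) : Fin N × Fin N :=
  (⟨N * i.1 / n₁, Nat.div_lt_of_lt_mul (by
      rw [mul_comm n₁]; exact Nat.mul_lt_mul_of_pos_left i.1.2 (NeZero.pos N))⟩,
    ⟨N * i.2 / n₂, Nat.div_lt_of_lt_mul (by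
      rw [mul_comm n₂]; exact Nat.mul_lt_mul_of_pos_left i.2.2 (NeZero.pos N))⟩)

/-- Equal integer parts of N a / n and N b / n mean a difference below 1. -/
lemma abs_div_sub_div_lt {n N : ℕ} (hN : 0 < N) {a b : ℕ} (hn : 0 < n)
    (h : N * a / n = N * b / n) : |(a : ℝ) / n - (b : ℝ) / n| < 1 / N := by
  have hn' : (0 : ℝ) < n := by exact_mod_cast hn
  have hN' : (0 : ℝ) < N := by exact_mod_cast hN
  have key : ∀ a b : ℕ, N * a / n = N * b / n → (a : ℝ) / n - (b : ℝ) / n < 1 / N := by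
    intro a b h
    have h1 : N * a < n * (N * a / n) + n := Nat.lt_mul_div_succ (N * a) hn
    have h2 : n * (N * b / n) ≤ N * b := Nat.mul_div_le _ _
    have h3 : N * a < N * b + n := by rw [h] at h1; omega
    have h4 : (N : ℝ) * a < N * b + n := by exact_mod_cast h3
    rw [← sub_div, div_lt_div_iff₀ hn' hN']
    nlinarith
  rw [abs_lt]
  refine ⟨?_, key a b h⟩
  have := key b a h.symm
  linarith

lemma exists_blocks {c : Torus → ℝ} (hγ : Tendsto (variogram c) (𝓝 0) (𝓝 0)) {ε : ℝ} (hε : 0 < ε) :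
    ∃ N : ℕ, ∃ _ : NeZero N, ∀ (n₁ n₂ : ℕ) (i j : Lattice n₁ n₂), blockKey N i = blockKey N j →
      variogram c (latticePoint i - latticePoint j) ≤ ε := by
  have hmap : Continuous fun p : ℝ × ℝ => (((p.1 : UnitAddCircle), (p.2 : UnitAddCircle)) : Torus) :=
    by
      have h := AddCircle.continuous_mk' (1 : ℝ)
      exact (h.comp continuous_fst).prodMk (h.comp continuous_snd)
  have h1 : Tendsto (fun p : ℝ × ℝ => variogram c ((p.1 : UnitAddCircle), (p.2 : UnitAddCircle)))
      (𝓝 0) (𝓝 0) := by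
    refine hγ.comp ?_
    exact hmap.tendsto 0
  obtain ⟨r, hr, hball⟩ := Metric.eventually_nhds_iff.1 (h1.eventually (gt_mem_nhds hε))
  obtain ⟨N, hN⟩ := exists_nat_one_div_lt hr
  refine ⟨N + 1, ⟨by omega⟩, fun n₁ n₂ i j hij => ?_⟩
  have hk1 := congrArg (fun q => ((q.1 : Fin (N + 1)) : ℕ)) hij
  have hk2 := congrArg (fun q => ((q.2 : Fin (N + 1)) : ℕ)) hij
  simp only [blockKey] at hk1 hk2
  have hd1 := abs_div_sub_div_lt (Nat.succ_pos N) (Fin.pos i.1) hk1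
  have hd2 := abs_div_sub_div_lt (Nat.succ_pos N) (Fin.pos i.2) hk2
  have h2 := @hball (((i.1 : ℕ) : ℝ) / n₁ - ((j.1 : ℕ) : ℝ) / n₁,
    ((i.2 : ℕ) : ℝ) / n₂ - ((j.2 : ℕ) : ℝ) / n₂) (by
      rw [dist_zero_right, Prod.norm_def, max_lt_iff]
      push_cast at hd1 hd2
      exact ⟨hd1.trans hN, hd2.trans hN⟩)
  refine le_of_eq_of_le ?_ h2.le
  congr 1

lemma covMatrix_diag (c : Torus → ℝ) (i : Lattice n₁ n₂) : covMatrix c n₁ n₂ i i = c 0 := by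
  simp [covMatrix]

lemma card_lattice : (Fintype.card (Lattice n₁ n₂) : ℝ) = (n₁ : ℝ) * n₂ := by simp

lemma trace_covMatrix (c : Torus → ℝ) : (covMatrix c n₁ n₂).trace = (n₁ : ℝ) * n₂ * c 0 := by
  simp [Matrix.trace, covMatrix_diag]

/-- The standing assumptions on the covariance function and the preconditioner. -/
structure Setup (c : Torus → ℝ) (α : ℕ → ℝ) (ρ a : ℝ) : Prop where
  posDef : ∀ n₁ n₂ : ℕ, 0 < n₁ → 0 < n₂ → (covMatrix c n₁ n₂).PosDef
  variogram_tendsto : Tendsto (variogram c) (𝓝 0) (𝓝 0)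
  rho_pos : 0 < ρ
  posSemidef : ∀ n₁ n₂ : ℕ, 0 < n₁ → 0 < n₂ →
    (precond c α n₁ n₂ - ρ • precision c n₁ n₂).PosSemidef
  abs_le : ∀ n : ℕ, |(n : ℝ) * α n| ≤ a

namespace Setup

variable {c : Torus → ℝ} {α : ℕ → ℝ} {ρ a : ℝ}

lemma c_zero_pos (h : Setup c α ρ a) : 0 < c 0 := by
  have := (h.posDef 1 1 one_pos one_pos).diag_pos (i := (0, 0))
  rwa [covMatrix_diag] at this

lemma a_nonneg (h : Setup c α ρ a) : 0 ≤ a := (abs_nonneg _).trans (h.abs_le 0)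

lemma isPreconditioner (h : Setup c α ρ a) (h₁ : 0 < n₁) (h₂ : 0 < n₂)
    {F : Matrix (Lattice n₁ n₂) (Lattice n₁ n₂) ℝ} (hF : F * F.transpose = precond c α n₁ n₂) :
    IsPreconditioner (covMatrix c n₁ n₂) (precond c α n₁ n₂) F ρ :=
  ⟨h.posDef _ _ h₁ h₂, h.rho_pos, h.posSemidef _ _ h₁ h₂, hF⟩

lemma abs_alpha_le (h : Setup c α ρ a) (h₁ : 0 < n₁) (h₂ : 0 < n₂) :
    |α (n₁ * n₂)| ≤ a / ((n₁ : ℝ) * n₂) := by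
  have h1 : (0 : ℝ) < (n₁ : ℝ) * n₂ := by positivity
  have := h.abs_le (n₁ * n₂)
  rw [abs_mul, abs_of_nonneg (by positivity)] at this
  rw [le_div_iff₀ h1]
  push_cast at this
  linarith

/-- The diagonal of the perturbation of the preconditioner. -/
def _root_.LGCP.perturbation (α : ℕ → ℝ) (k : ℕ) (x : Lattice n₁ n₂ → ℝ) (i : Lattice n₁ n₂) : ℝ :=
  k * (cellRate x i : ℝ) - α (n₁ * n₂)

lemma _root_.LGCP.postPrecision_eq (c : Torus → ℝ) (α : ℕ → ℝ) (k : ℕ) (x : Lattice n₁ n₂ → ℝ) :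
    postPrecision c k x = precond c α n₁ n₂ + Matrix.diagonal (perturbation α k x) := by
  rw [postPrecision, fisher_eq_diagonal, precond, add_assoc]
  congr 1
  ext i j
  by_cases hij : i = j
  · subst hij; simp [perturbation]
  · simp [hij]

lemma precondMatrix_eq (h : Setup c α ρ a) (h₁ : 0 < n₁) (h₂ : 0 < n₂)
    {F : Matrix (Lattice n₁ n₂) (Lattice n₁ n₂) ℝ} (hF : F * F.transpose = precond c α n₁ n₂)
    (k : ℕ) (x : Lattice n₁ n₂ → ℝ) :
    precondMatrix c k x F = 1 + conjInv F (Matrix.diagonal (perturbation α k x)) := by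
  rw [precondMatrix, postPrecision_eq c α, ← (h.isPreconditioner h₁ h₂ hF).conjInv_self]
  simp only [conjInv, Matrix.mul_add, Matrix.add_mul]

lemma abs_perturbation_le (h : Setup c α ρ a) (h₁ : 0 < n₁) (h₂ : 0 < n₂) (k : ℕ)
    {x : Lattice n₁ n₂ → ℝ} {Λ : ℝ} (hx : ∀ i, Real.exp (x i) ≤ Λ) (i : Lattice n₁ n₂) :
    |perturbation α k x i| ≤ (k * Λ + a) / ((n₁ : ℝ) * n₂) := by
  have h1 : (0 : ℝ) < (n₁ : ℝ) * n₂ := by positivity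
  have h2 := h.abs_alpha_le h₁ h₂
  rw [perturbation, coe_cellRate, add_div]
  refine (abs_sub _ _).trans (add_le_add ?_ h2)
  rw [abs_of_nonneg (by positivity), mul_div_assoc]
  gcongr
  exact hx i

lemma isHermitian_conjInv_perturbation (F : Matrix (Lattice n₁ n₂) (Lattice n₁ n₂) ℝ) (k : ℕ)
    (x : Lattice n₁ n₂ → ℝ) :
    (conjInv F (Matrix.diagonal (perturbation α k x))).IsHermitian :=
  isHermitian_conjInv F (Matrix.isHermitian_diagonal _)

lemma inner_mulV_le_trace {ι : Type*} [Fintype ι] [DecidableEq ι] {C : Matrix ι ι ℝ}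
    (hC : C.PosSemidef) (y : Vec ι) : inner ℝ y (mulV C y) ≤ C.trace * ‖y‖ ^ 2 := by
  rcases eq_or_ne y 0 with rfl | hy
  · simp
  have hn := norm_pos_iff.2 hy
  have ho : Orthonormal ℝ fun _ : Fin 1 => ‖y‖⁻¹ • y :=
    ⟨fun _ => by rw [norm_smul, norm_inv, norm_norm, inv_mul_cancel₀ hn.ne'],
      fun i j hij => absurd (Subsingleton.elim i j) hij⟩
  have := sum_inner_mulV_le_trace hC ho
  simp only [Finset.univ_unique, Finset.sum_singleton, mulV_smul, real_inner_smul_left,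
    real_inner_smul_right] at this
  rw [← mul_assoc, ← mul_inv, inv_mul_le_iff₀ (by positivity)] at this
  linarith

/-- Uniform lower bound for the preconditioned matrices. -/
lemma lower_bound (h : Setup c α ρ a) (h₁ : 0 < n₁) (h₂ : 0 < n₂)
    {F : Matrix (Lattice n₁ n₂) (Lattice n₁ n₂) ℝ} (hF : F * F.transpose = precond c α n₁ n₂)
    (k : ℕ) (x : Lattice n₁ n₂ → ℝ) (v : Vec (Lattice n₁ n₂)) :
    (1 + a * c 0)⁻¹ * ‖v‖ ^ 2 ≤ inner ℝ v (mulV (precondMatrix c k x F) v) := by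
  have hpre := h.isPreconditioner h₁ h₂ hF
  have hN : (0 : ℝ) < (n₁ : ℝ) * n₂ := by positivity
  have ha := h.a_nonneg
  have hc := h.c_zero_pos
  rw [precondMatrix, inner_conjInv, hpre.norm_sq_eq, inv_mul_le_iff₀ (by positivity)]
  set y := mulV F⁻¹.transpose v
  rw [postPrecision, precond, add_mulV, add_mulV, inner_add_right, inner_add_right, smul_mulV,
    one_mulV, real_inner_smul_right, real_inner_self_eq_norm_sq, fisher_eq_diagonal,
    inner_diagonal]
  have hH : 0 ≤ ∑ i, k * (cellRate x i : ℝ) * y i ^ 2 :=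
    Finset.sum_nonneg fun i _ => by positivity
  set q := inner ℝ y (mulV (precision c n₁ n₂) y) with hq
  have hq0 : 0 ≤ q := inner_mulV_nonneg hpre.posDef.inv.posSemidef y
  -- Smallest eigenvalue of Q: Cauchy–Schwarz combined with ⟨y, C y⟩ ≤ tr C ‖y‖².
  have h3 : ‖y‖ ^ 2 ≤ (n₁ : ℝ) * n₂ * c 0 * q := by
    have h4 := sq_inner_le_mul hpre.posDef y y
    have h5 := inner_mulV_le_trace hpre.posDef.posSemidef y
    rw [trace_covMatrix] at h5
    rw [real_inner_self_eq_norm_sq] at h4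
    rcases (sq_nonneg ‖y‖).eq_or_lt with h0 | hpos
    · rw [← h0]; positivity
    · have h6 : (‖y‖ ^ 2) ^ 2 ≤ q * ((n₁ : ℝ) * n₂ * c 0 * ‖y‖ ^ 2) :=
        h4.trans (mul_le_mul_of_nonneg_left h5 hq0)
      nlinarith
  -- The factor n from the trace cancels against α_n = O(1 / n), so M ≤ (1 + a c(0)) Q ≤ (1 + a
  -- c(0)) (Q + H).
  have h4 : α (n₁ * n₂) * ‖y‖ ^ 2 ≤ a * c 0 * q := by
    calc α (n₁ * n₂) * ‖y‖ ^ 2 ≤ |α (n₁ * n₂)| * ‖y‖ ^ 2 := by gcongr; exact le_abs_self _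
      _ ≤ a / ((n₁ : ℝ) * n₂) * ((n₁ : ℝ) * n₂ * c 0 * q) := by
          gcongr
          exact h.abs_alpha_le h₁ h₂
      _ = a * c 0 * q := by field_simp
  have h5 : 0 ≤ a * c 0 := by positivity
  nlinarith

/-- Uniform eigenvalue counting bound. -/
lemma countBound_zero (h : Setup c α ρ a) (h₁ : 0 < n₁) (h₂ : 0 < n₂)
    {F : Matrix (Lattice n₁ n₂) (Lattice n₁ n₂) ℝ} (hF : F * F.transpose = precond c α n₁ n₂)
    (k : ℕ) {x : Lattice n₁ n₂ → ℝ} {Λ : ℝ} (hΛ : 0 ≤ Λ) (hx : ∀ i, Real.exp (x i) ≤ Λ) :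
    CountBound (isHermitian_conjInv_perturbation (α := α) F k x).eigenvalues 0
      (2 * (k * Λ + a) * c 0 / ρ) := by
  have hpre := h.isPreconditioner h₁ h₂ hF
  have hN : (0 : ℝ) < (n₁ : ℝ) * n₂ := by positivity
  have ha := h.a_nonneg
  have := countBound_conjInv hpre (d := (k * Λ + a) / ((n₁ : ℝ) * n₂)) (by positivity)
    (h.abs_perturbation_le h₁ h₂ k hx) (isHermitian_conjInv_perturbation F k x)
    (kernelTraceBound_trace hpre.posDef.posSemidef)
  rw [trace_covMatrix] at this
  simp only [Fintype.card_fin, mul_zero] at this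
  convert this using 1
  field_simp

/-- Uniform smallness of the eigenvalue tails. -/
lemma exists_countBound (h : Setup c α ρ a) (k : ℕ) {Λ : ℝ} (hΛ : 0 ≤ Λ) {r : ℝ} (hr : 0 < r) :
    ∃ p : ℕ, ∀ n₁ n₂ : ℕ, 0 < n₁ → 0 < n₂ → ∀ F : Matrix (Lattice n₁ n₂) (Lattice n₁ n₂) ℝ,
      F * F.transpose = precond c α n₁ n₂ → ∀ x : Lattice n₁ n₂ → ℝ, (∀ i, Real.exp (x i) ≤ Λ) →
      CountBound (isHermitian_conjInv_perturbation (α := α) F k x).eigenvalues p r := by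
  have ha := h.a_nonneg
  have hρ := h.rho_pos
  have hd0 : 0 ≤ (k : ℝ) * Λ + a := by positivity
  -- Chosen so that 2 (kΛ + a) ε / ρ ≤ r; the added 1 keeps the denominator positive.
  set ε := r * ρ / (2 * (k * Λ + a) + 1) with hε
  have hε0 : 0 < ε := by positivity
  obtain ⟨N, hN0, hN⟩ := exists_blocks h.variogram_tendsto hε0
  refine ⟨2 * Fintype.card (Fin N × Fin N), fun n₁ n₂ h₁ h₂ F hF x hx => ?_⟩
  have hpre := h.isPreconditioner h₁ h₂ hF
  have hn : (0 : ℝ) < (n₁ : ℝ) * n₂ := by positivity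
  have : Nonempty (Lattice n₁ n₂) := ⟨(⟨0, h₁⟩, ⟨0, h₂⟩)⟩
  -- `invFun` picks a lattice point in each nonempty block; on coarse lattices some blocks are empty
  -- and their representative is never used.
  have hker := kernelTraceBound_blockSum hpre.posDef.posSemidef (blockKey N)
    (Function.invFun (blockKey N)) (ε := ε) (fun i => by
      have hkey : blockKey N i = blockKey N (Function.invFun (blockKey N) (blockKey N i)) :=
        (Function.invFun_eq ⟨i, rfl⟩).symm
      have := hN n₁ n₂ _ _ hkey
      simp only [covMatrix, Matrix.of_apply, sub_self]
      rw [variogram, neg_sub] at this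
      linarith)
  have hcount := countBound_conjInv hpre (d := (k * Λ + a) / ((n₁ : ℝ) * n₂)) (by positivity)
    (h.abs_perturbation_le h₁ h₂ k hx) (isHermitian_conjInv_perturbation F k x) hker
  intro t ht
  refine (hcount t ht).trans (add_le_add le_rfl ?_)
  rw [card_lattice]
  have h1 : 2 * ((k * Λ + a) / ((n₁ : ℝ) * n₂)) * ((n₁ : ℝ) * n₂ * ε) / ρ
      = 2 * (k * Λ + a) * ε / ρ := by field_simp
  rw [h1, div_le_iff₀ hρ, hε, mul_div_assoc', div_le_iff₀ (by positivity)]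
  have : 0 < r * ρ := by positivity
  nlinarith

end Setup

end Uniform

lemma cfc_self_eq {ι : Type*} [Fintype ι] [DecidableEq ι] {A : Matrix ι ι ℝ}
    (hA : A.IsHermitian) : cfc (fun t : ℝ => t) A = A :=
  cfc_id' ℝ A (ha := hA.isSelfAdjoint)

/-! ### Gaussian vectors -/

section Gaussian

variable {ι : Type*} [Fintype ι] [DecidableEq ι]

/-- Both characteristic functions at t equal exp(i ⟨t, μ⟩ - ‖Bᵀ t‖² / 2). -/
lemma map_stdGaussian_affine (μ : Vec ι) (B : Matrix ι ι ℝ) :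
    (stdGaussian (Vec ι)).map (fun z => μ + mulV B z) = multivariateGaussian μ (B * B.transpose) := by
  have hS : (B * B.transpose).PosSemidef := by
    have := Matrix.posSemidef_self_mul_conjTranspose B
    rwa [Matrix.conjTranspose_eq_transpose_of_trivial] at this
  have hmeas : Measurable fun z : Vec ι => μ + mulV B z := (measurable_mulV B).const_add μ
  have : IsProbabilityMeasure ((stdGaussian (Vec ι)).map fun z => μ + mulV B z) :=
    Measure.isProbabilityMeasure_map hmeas.aemeasurable
  refine Measure.ext_of_charFun (E := Vec ι) (funext fun t => ?_)
  rw [charFun_multivariateGaussian hS, charFun_apply, integral_map hmeas.aemeasurable (by fun_prop)]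
  have h1 : ∀ z : Vec ι, Complex.exp ((inner ℝ (μ + mulV B z) t : ℝ) * Complex.I)
      = Complex.exp ((inner ℝ t μ : ℝ) * Complex.I)
        * Complex.exp ((inner ℝ z (mulV B.transpose t) : ℝ) * Complex.I) := by
    intro z
    rw [← Complex.exp_add, inner_add_left, inner_mulV_left, real_inner_comm]
    push_cast; ring_nf
  simp_rw [h1]
  rw [integral_const_mul, ← charFun_apply, charFun_stdGaussian, ← Complex.exp_add]
  congr 1
  have h2 : ‖mulV B.transpose t‖ ^ 2 = t.ofLp ⬝ᵥ (B * B.transpose).mulVec t.ofLp := by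
    rw [← inner_mulV_eq_dotProduct, mul_mulV, inner_mulV_right, real_inner_self_eq_norm_sq]
  rw [← h2]
  push_cast; ring

lemma integral_inner_sq_stdGaussian {ι : Type*} [Fintype ι] (u : Vec ι) :
    Integrable (fun z : Vec ι => inner ℝ u z ^ 2) (stdGaussian (Vec ι)) ∧
    ∫ z, inner ℝ u z ^ 2 ∂(stdGaussian (Vec ι)) = ‖u‖ ^ 2 := by
  set L : StrongDual ℝ (Vec ι) := innerSL ℝ u with hL
  have hLp : MemLp L 2 (stdGaussian (Vec ι)) :=
    IsGaussian.memLp_two_id.continuousLinearMap_comp L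
  have h1 := variance_dual_stdGaussian L
  rw [variance_eq_integral hLp.1.aemeasurable, integral_strongDual_stdGaussian] at h1
  refine ⟨hLp.integrable_sq, ?_⟩
  rw [hL, innerSL_apply_norm] at h1
  rw [← h1]
  simp

lemma integral_norm_sq_mulV_stdGaussian {E : Matrix ι ι ℝ} (hE : E.IsHermitian) :
    Integrable (fun z : Vec ι => ‖mulV E z‖ ^ 2) (stdGaussian (Vec ι)) ∧
    ∫ z, ‖mulV E z‖ ^ 2 ∂(stdGaussian (Vec ι)) = ∑ l, hE.eigenvalues l ^ 2 := by
  have hexp : ∀ z : Vec ι, ‖mulV E z‖ ^ 2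
      = ∑ l, hE.eigenvalues l ^ 2 * inner ℝ (hE.eigenvectorBasis l) z ^ 2 := by
    intro z
    have := norm_sq_mulV_cfc hE (fun t => t) z
    rwa [cfc_self_eq hE] at this
  have hint : ∀ l, Integrable (fun z : Vec ι =>
      hE.eigenvalues l ^ 2 * inner ℝ (hE.eigenvectorBasis l) z ^ 2) (stdGaussian (Vec ι)) :=
    fun l => (integral_inner_sq_stdGaussian _).1.const_mul _
  simp_rw [hexp]
  refine ⟨integrable_finsetSum _ fun l _ => hint l, ?_⟩
  rw [integral_finsetSum _ fun l _ => hint l]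
  refine Finset.sum_congr rfl fun l _ => ?_
  rw [integral_const_mul, (integral_inner_sq_stdGaussian _).2, OrthonormalBasis.norm_eq_one]
  ring

/-- Markov's inequality for the square of a nonnegative function. -/
lemma measure_lt_le_of_integral_sq_le {Ω : Type*} [MeasurableSpace Ω] {μ : Measure Ω}
    [IsProbabilityMeasure μ] {g : Ω → ℝ}
    (hg : Integrable (fun ω => g ω ^ 2) μ) {S R η : ℝ} (hS : ∫ ω, g ω ^ 2 ∂μ ≤ S) (hR : 0 < R)
    (hη : S ≤ η * R ^ 2) : μ {ω | R < g ω} ≤ ENNReal.ofReal η := by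
  have h1 := mul_meas_ge_le_integral_of_nonneg (Eventually.of_forall fun ω => sq_nonneg (g ω)) hg
    (R ^ 2)
  have h2 : μ.real {ω | R ^ 2 ≤ g ω ^ 2} ≤ η := by
    have : R ^ 2 * μ.real {ω | R ^ 2 ≤ g ω ^ 2} ≤ R ^ 2 * η := by linarith
    exact le_of_mul_le_mul_left this (by positivity)
  refine (measure_mono (t := {ω | R ^ 2 ≤ g ω ^ 2}) fun ω hω => ?_).trans ?_
  · exact pow_le_pow_left₀ hR.le (le_of_lt hω) 2
  · rw [← ofReal_measureReal]
    exact ENNReal.ofReal_le_ofReal h2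

end Gaussian

/-! ### Inverse and inverse square root -/

section InvSqrt

variable {ι : Type*} [Fintype ι] [DecidableEq ι] {A : Matrix ι ι ℝ}

lemma cfc_mul_cfc (f g : ℝ → ℝ) : cfc f A * cfc g A = cfc (fun t => f t * g t) A :=
  (cfc_mul f g A (continuousOn_spectrum f) (continuousOn_spectrum g)).symm

lemma cfc_inv_eq (hA : A.IsHermitian) (hpos : ∀ t ∈ spectrum ℝ A, 0 < t) :
    cfc (fun t : ℝ => t⁻¹) A = A⁻¹ := by
  refine (Matrix.inv_eq_right_inv ?_).symm
  have h1 : A * cfc (fun t : ℝ => t⁻¹) A = cfc (fun t : ℝ => t) A * cfc (fun t : ℝ => t⁻¹) A := by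
    rw [cfc_self_eq hA]
  rw [h1, cfc_mul_cfc, cfc_congr_spectrum (g := fun _ => 1), cfc_const_one ℝ A]
  intro t ht
  exact mul_inv_cancel₀ (hpos t ht).ne'

lemma invSqrt_mul_self (hA : A.IsHermitian) (hpos : ∀ t ∈ spectrum ℝ A, 0 < t) :
    invSqrt A * invSqrt A = A⁻¹ := by
  rw [invSqrt, cfc_mul_cfc, ← cfc_inv_eq hA hpos]
  refine cfc_congr_spectrum fun t ht => ?_
  rw [← mul_inv, Real.mul_self_sqrt (hpos t ht).le]

lemma matSqrt_mul_self (hA : A.IsHermitian) (hpos : ∀ t ∈ spectrum ℝ A, 0 < t) :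
    matSqrt A * matSqrt A = A := by
  rw [matSqrt, cfc_mul_cfc]
  refine Eq.trans ?_ (cfc_self_eq hA)
  exact cfc_congr_spectrum fun t ht => Real.mul_self_sqrt (hpos t ht).le

end InvSqrt

/-! ### Law of the draw and superlinear convergence, uniformly over the lattices -/

namespace Setup

variable {n₁ n₂ : ℕ} {c : Torus → ℝ} {α : ℕ → ℝ} {ρ a : ℝ}

lemma pos_of_mem_spectrum (h : Setup c α ρ a) (h₁ : 0 < n₁) (h₂ : 0 < n₂)
    {F : Matrix (Lattice n₁ n₂) (Lattice n₁ n₂) ℝ} (hF : F * F.transpose = precond c α n₁ n₂)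
    (k : ℕ) (x : Lattice n₁ n₂ → ℝ) :
    (precondMatrix c k x F).IsHermitian ∧
      ∀ t ∈ spectrum ℝ (precondMatrix c k x F), (1 + a * c 0)⁻¹ ≤ t ∧ 0 < t := by
  have hH : (precondMatrix c k x F).IsHermitian := by
    rw [h.precondMatrix_eq h₁ h₂ hF]
    exact Matrix.isHermitian_one.add (isHermitian_conjInv_perturbation F k x)
  refine ⟨hH, fun t ht => ?_⟩
  have h1 := le_of_mem_spectrum hH (h.lower_bound h₁ h₂ hF k x) ht
  have ha := h.a_nonneg
  have hc := h.c_zero_pos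
  have : 0 < (1 + a * c 0)⁻¹ := by positivity
  exact ⟨h1, this.trans_le h1⟩

lemma inv_precondMatrix (h : Setup c α ρ a) (h₁ : 0 < n₁) (h₂ : 0 < n₂)
    {F : Matrix (Lattice n₁ n₂) (Lattice n₁ n₂) ℝ} (hF : F * F.transpose = precond c α n₁ n₂)
    (k : ℕ) (x : Lattice n₁ n₂ → ℝ) :
    F⁻¹.transpose * (precondMatrix c k x F)⁻¹ * F⁻¹ = (postPrecision c k x)⁻¹ := by
  have hpre := h.isPreconditioner h₁ h₂ hF
  have hu := hpre.isUnit_det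
  have hu' := hpre.isUnit_det_transpose
  rw [precondMatrix, conjInv, Matrix.mul_inv_rev, Matrix.mul_inv_rev, Matrix.transpose_nonsing_inv,
    Matrix.nonsing_inv_nonsing_inv _ hu, Matrix.nonsing_inv_nonsing_inv _ hu']
  rw [Matrix.mul_assoc, Matrix.mul_assoc, Matrix.mul_assoc, Matrix.mul_nonsing_inv _ hu,
    Matrix.mul_one, ← Matrix.mul_assoc, Matrix.nonsing_inv_mul _ hu', Matrix.one_mul]

/-- The draw built from the preconditioned sample has the law of the proposal. -/
theorem map_proposalDraw (h : Setup c α ρ a) (h₁ : 0 < n₁) (h₂ : 0 < n₂)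
    {F : Matrix (Lattice n₁ n₂) (Lattice n₁ n₂) ℝ} (hF : F * F.transpose = precond c α n₁ n₂)
    {k : ℕ} (δ : ℝ) (x : Lattice n₁ n₂ → ℝ) (y : Fin k → Lattice n₁ n₂ → ℕ) :
    (stdGaussian (Vec (Lattice n₁ n₂))).map (proposalDraw c δ x y F) = proposalLaw c δ x y := by
  obtain ⟨hA, hpos⟩ := h.pos_of_mem_spectrum h₁ h₂ hF k x
  have hfun : proposalDraw c δ x y F = fun z => proposalMean c δ x y
      + mulV (δ • (F⁻¹.transpose * invSqrt (precondMatrix c k x F))) z := by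
    funext z
    rw [proposalDraw, sampleU, smul_mulV, mul_mulV, Matrix.transpose_nonsing_inv]
  rw [hfun, map_stdGaussian_affine, proposalLaw]
  congr 1
  rw [Matrix.transpose_smul, Matrix.transpose_mul, Matrix.transpose_transpose, Matrix.smul_mul,
    Matrix.mul_smul, smul_smul, ← sq, ← h.inv_precondMatrix h₁ h₂ hF k x,
    ← invSqrt_mul_self hA fun t ht => (hpos t ht).2]
  rw [show (invSqrt (precondMatrix c k x F)).transpose = invSqrt (precondMatrix c k x F) from
    transpose_cfc _]
  simp only [Matrix.mul_assoc]

/-- Superlinear convergence, uniformly over all lattices. -/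
theorem exists_krylov_bound (h : Setup c α ρ a) (k : ℕ) {Λ : ℝ} (hΛ : 0 ≤ Λ) {K : ℝ}
    (hK : 0 < K) :
    ∃ C : ℝ, 0 ≤ C ∧ ∀ n₁ n₂ : ℕ, 0 < n₁ → 0 < n₂ →
      ∀ F : Matrix (Lattice n₁ n₂) (Lattice n₁ n₂) ℝ, F * F.transpose = precond c α n₁ n₂ →
      ∀ x : Lattice n₁ n₂ → ℝ, (∀ i, Real.exp (x i) ≤ Λ) →
      ∀ (z : Vec (Lattice n₁ n₂)) (m : ℕ), 1 ≤ m →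
        ‖sampleU c k x F z - sampleUApprox c k x F z m‖
          ≤ C * (K / m) ^ m * ‖mulV (conjInv F (Matrix.diagonal (perturbation α k x))) z‖ ∧
        ‖mulV (precondMatrix c k x F)⁻¹ z - krylovSolve (precondMatrix c k x F) z m‖
          ≤ C * (K / m) ^ m * ‖mulV (conjInv F (Matrix.diagonal (perturbation α k x))) z‖ := by
  have ha := h.a_nonneg
  have hc := h.c_zero_pos
  set b := (1 + a * c 0)⁻¹ with hb
  have hb0 : 0 < b := by positivity
  -- The tail level depends on K, but the number p of exceptional eigenvalues does not depend on the
  -- lattice. Hence any K > 0 is attainable.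
  obtain ⟨p, hp⟩ := h.exists_countBound k hΛ (r := tailScale b K / 2)
    (half_pos (tailScale_pos hb0 hK))
  set T := 2 * (k * Λ + a) * c 0 / ρ
  set C₁ := superConst b (√b)⁻¹ T K p
  set C₂ := superConst b b⁻¹ T K p
  have hC₁ : 0 ≤ C₁ := superConst_nonneg p hb0 (by positivity) hK
  have hC₂ : 0 ≤ C₂ := superConst_nonneg p hb0 (by positivity) hK
  refine ⟨max C₁ C₂, hC₁.trans (le_max_left _ _), fun n₁ n₂ h₁ h₂ F hF x hx z m hm => ?_⟩
  have heq := h.precondMatrix_eq h₁ h₂ hF k x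
  have hE := isHermitian_conjInv_perturbation (α := α) F k x
  have hlow := h.lower_bound h₁ h₂ hF k x
  obtain ⟨hA, hpos⟩ := h.pos_of_mem_spectrum h₁ h₂ hF k x
  rw [← cfc_inv_eq hA fun t ht => (hpos t ht).2]
  simp only [sampleU, sampleUApprox, krylovSample, krylovSolve, invSqrt]
  rw [heq] at hlow ⊢
  constructor
  · refine (norm_sub_krylov_le_superlinear hE hb0 (by positivity) hK hlow
      (interpolationBound_inv_sqrt hb0) (h.countBound_zero h₁ h₂ hF k hΛ hx)
      (hp n₁ n₂ h₁ h₂ F hF x hx) hm z).trans ?_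
    gcongr
    exact le_max_left _ _
  · refine (norm_sub_krylov_le_superlinear hE hb0 (by positivity) hK hlow
      (interpolationBound_inv hb0) (h.countBound_zero h₁ h₂ hF k hΛ hx)
      (hp n₁ n₂ h₁ h₂ F hF x hx) hm z).trans ?_
    gcongr
    exact le_max_right _ _

/-- Uniform bound for the operator norm and the Hilbert–Schmidt norm of the perturbation. -/
theorem exists_perturbation_bound (h : Setup c α ρ a) (k : ℕ) {Λ : ℝ} (hΛ : 0 ≤ Λ) :
    ∃ T : ℝ, 0 < T ∧ ∀ n₁ n₂ : ℕ, 0 < n₁ → 0 < n₂ →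
      ∀ F : Matrix (Lattice n₁ n₂) (Lattice n₁ n₂) ℝ, F * F.transpose = precond c α n₁ n₂ →
      ∀ x : Lattice n₁ n₂ → ℝ, (∀ i, Real.exp (x i) ≤ Λ) →
        (∀ z, ‖mulV (conjInv F (Matrix.diagonal (perturbation α k x))) z‖ ≤ T * ‖z‖) ∧
        (∀ t ∈ spectrum ℝ (precondMatrix c k x F), t ≤ 1 + T) ∧
        ∑ l, (isHermitian_conjInv_perturbation (α := α) F k x).eigenvalues l ^ 2 ≤ T := by
  have ha := h.a_nonneg
  have hc := h.c_zero_pos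
  have hρ := h.rho_pos
  set T := 2 * (k * Λ + a) * c 0 / ρ
  have hT : 0 ≤ T := by positivity
  set S := (2 * T) ^ 2 * ∑' j : ℕ, (1 / ((j : ℝ) + 1) ^ 2) with hS
  -- T bounds the modulus of every eigenvalue of E and S bounds the sum of their squares; T + 1
  -- makes the common constant positive.
  refine ⟨max (T + 1) S, lt_max_of_lt_left (by positivity), fun n₁ n₂ h₁ h₂ F hF x hx => ?_⟩
  have hE := isHermitian_conjInv_perturbation (α := α) F k x
  have hcount := h.countBound_zero h₁ h₂ hF k hΛ hx
  have hsp : ∀ t ∈ spectrum ℝ (conjInv F (Matrix.diagonal (perturbation α k x))),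
      |t| ≤ T := by
    intro t ht
    rw [spectrum_eq_range hE] at ht
    obtain ⟨l, rfl⟩ := ht
    exact hcount.abs_le hT l
  have hle : T ≤ max (T + 1) S := (by linarith : T ≤ T + 1).trans (le_max_left _ _)
  have hmul : ∀ z, ‖mulV (conjInv F (Matrix.diagonal (perturbation α k x))) z‖ ≤ T * ‖z‖ := by
    intro z
    have := norm_mulV_cfc_le hE (f := fun t => t) (g := fun _ => 1) hT
      (fun t ht => by simpa using hsp t ht) z
    rwa [cfc_self_eq hE, cfc_const_one ℝ _, one_mulV] at this
  refine ⟨fun z => (hmul z).trans (by gcongr), fun t ht => ?_,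
    (hcount.sum_sq_le hT).trans (le_max_right _ _)⟩
  rw [h.precondMatrix_eq h₁ h₂ hF] at ht
  have hA : (1 + conjInv F (Matrix.diagonal (perturbation α k x))).IsHermitian :=
    Matrix.isHermitian_one.add hE
  rw [spectrum_eq_range hA] at ht
  obtain ⟨l, rfl⟩ := ht
  have h1 := mulV_eigenvectorBasis hA l
  rw [add_mulV, one_mulV] at h1
  have h2 : mulV (conjInv F (Matrix.diagonal (perturbation α k x))) (hA.eigenvectorBasis l)
      = (hA.eigenvalues l - 1) • hA.eigenvectorBasis l := by
    rw [sub_smul, one_smul, ← h1]; abel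
  have h3 := hmul (hA.eigenvectorBasis l)
  rw [h2, norm_smul, OrthonormalBasis.norm_eq_one, mul_one, mul_one, Real.norm_eq_abs] at h3
  linarith [le_abs_self (hA.eigenvalues l - 1)]

end Setup

/-! ### Calculus of straight-line programs -/

section Programs

variable {I : Type}

/-- `f` is obtained from the functions in `A` by one elementary operation. -/
inductive OpStep (A : Set ((I → ℝ) → ℝ)) : ((I → ℝ) → ℝ) → Prop
  | const (a : ℝ) : OpStep A fun _ => a
  | add {f g} (hf : f ∈ A) (hg : g ∈ A) : OpStep A fun x => f x + g x
  | sub {f g} (hf : f ∈ A) (hg : g ∈ A) : OpStep A fun x => f x - g x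
  | mul {f g} (hf : f ∈ A) (hg : g ∈ A) : OpStep A fun x => f x * g x
  | exp {f} (hf : f ∈ A) : OpStep A fun x => Real.exp (f x)

/-- `Chain N A B`: starting from the functions in `A`, `N` elementary operations produce `B`. -/
inductive Chain : ℕ → Set ((I → ℝ) → ℝ) → Set ((I → ℝ) → ℝ) → Prop
  | refl (A) : Chain 0 A A
  | step {N A B f} (h : Chain N A B) (hf : OpStep B f) : Chain (N + 1) A (insert f B)

lemma OpStep.mono {A B : Set ((I → ℝ) → ℝ)} (hAB : A ⊆ B) {f : (I → ℝ) → ℝ} (h : OpStep A f) :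
    OpStep B f := by
  cases h with
  | const a => exact .const a
  | add hf hg => exact .add (hAB hf) (hAB hg)
  | sub hf hg => exact .sub (hAB hf) (hAB hg)
  | mul hf hg => exact .mul (hAB hf) (hAB hg)
  | exp hf => exact .exp (hAB hf)

lemma Chain.subset {N : ℕ} {A B : Set ((I → ℝ) → ℝ)} (h : Chain N A B) : A ⊆ B := by
  induction h with
  | refl => exact subset_rfl
  | step _ _ ih => exact ih.trans (Set.subset_insert _ _)

lemma Chain.union {N : ℕ} {A B : Set ((I → ℝ) → ℝ)} (h : Chain N A B)
    (D : Set ((I → ℝ) → ℝ)) : Chain N (A ∪ D) (B ∪ D) := by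
  induction h with
  | refl => exact .refl _
  | step _ hf ih =>
    rw [Set.insert_union]
    exact ih.step (hf.mono Set.subset_union_left)

lemma Chain.trans {N M : ℕ} {A B D : Set ((I → ℝ) → ℝ)} (h : Chain N A B) (h' : Chain M B D) :
    Chain (N + M) A D := by
  induction h' with
  | refl => exact h
  | step _ hf ih => exact (ih h).step hf

/-- A chain of operations is realised by a program. -/
lemma Chain.exists_ops {N : ℕ} {A B : Set ((I → ℝ) → ℝ)} (h : Chain N A B)
    (hA : ∀ f ∈ A, ∃ q, ∀ inp, f inp = inp q) :
    ∃ ops : List (ℕ × Op (Reg I)), ops.length = N ∧ ∀ f ∈ B, ∃ r : Reg I,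
      (∀ l, r = Sum.inr l → l < N) ∧ ∀ inp, Sum.elim inp (runOps inp ops) r = f inp := by
  induction h with
  | refl A =>
    refine ⟨[], rfl, fun f hf => ?_⟩
    obtain ⟨q, hq⟩ := hA f hf
    exact ⟨Sum.inl q, by simp, fun inp => by simp [hq]⟩
  | @step N A B f h hf ih =>
    obtain ⟨ops, hlen, hops⟩ := ih hA
    obtain ⟨o, ho⟩ : ∃ o : Op (Reg I), ∀ inp, o.eval (Sum.elim inp (runOps inp ops)) = f inp := by
      cases hf with
      | const a => exact ⟨.const a, fun _ => rfl⟩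
      | add hf hg =>
        obtain ⟨r, -, hr⟩ := hops _ hf
        obtain ⟨s, -, hs⟩ := hops _ hg
        exact ⟨.add r s, fun inp => by rw [Op.eval, hr, hs]⟩
      | sub hf hg =>
        obtain ⟨r, -, hr⟩ := hops _ hf
        obtain ⟨s, -, hs⟩ := hops _ hg
        exact ⟨.sub r s, fun inp => by rw [Op.eval, hr, hs]⟩
      | mul hf hg =>
        obtain ⟨r, -, hr⟩ := hops _ hf
        obtain ⟨s, -, hs⟩ := hops _ hg
        exact ⟨.mul r s, fun inp => by rw [Op.eval, hr, hs]⟩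
      | exp hf =>
        obtain ⟨r, -, hr⟩ := hops _ hf
        exact ⟨.exp r, fun inp => by rw [Op.eval, hr]⟩
    -- Each step writes to the fresh register N, so earlier results stay readable.
    have hrun : ∀ inp, runOps inp (ops ++ [(N, o)])
        = Function.update (runOps inp ops) N (f inp) := by
      intro inp
      rw [runOps, List.foldl_append, List.foldl_cons, List.foldl_nil, ← ho]
      rfl
    refine ⟨ops ++ [(N, o)], by simp [hlen], fun g hg => ?_⟩
    rcases hg with rfl | hg
    · refine ⟨Sum.inr N, fun l hl => ?_, fun inp => ?_⟩
      · rw [← Sum.inr.inj hl]; exact Nat.lt_succ_self _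
      · rw [hrun]; simp
    · obtain ⟨r, hr1, hr2⟩ := hops g hg
      refine ⟨r, fun l hl => (hr1 l hl).trans (Nat.lt_succ_self _), fun inp => ?_⟩
      rw [hrun, ← hr2 inp]
      cases r with
      | inl q => rfl
      | inr l =>
        have := hr1 l rfl
        simp [Function.update_of_ne this.ne]

/-- `Gen N A B`: the functions in `B` can be computed from those in `A` by `N` operations. -/
def Gen (N : ℕ) (A B : Set ((I → ℝ) → ℝ)) : Prop := ∃ M ≤ N, ∃ D, Chain M A D ∧ B ⊆ D

variable {A B D : Set ((I → ℝ) → ℝ)} {N M : ℕ}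

lemma Gen.of_subset (h : B ⊆ A) : Gen 0 A B := ⟨0, le_rfl, A, .refl A, h⟩

lemma Gen.mono_left (h : Gen N A B) (hAD : A ⊆ D) : Gen N D B := by
  obtain ⟨M, hM, E, hE, hB⟩ := h
  refine ⟨M, hM, E ∪ D, ?_, hB.trans Set.subset_union_left⟩
  have := hE.union D
  rwa [Set.union_eq_self_of_subset_left hAD] at this

lemma Gen.mono_right (h : Gen N A B) (hD : D ⊆ B) : Gen N A D := by
  obtain ⟨M, hM, E, hE, hB⟩ := h
  exact ⟨M, hM, E, hE, hD.trans hB⟩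

lemma Gen.mono_cost (h : Gen N A B) (hNM : N ≤ M) : Gen M A B := by
  obtain ⟨L, hL, E, hE, hB⟩ := h
  exact ⟨L, hL.trans hNM, E, hE, hB⟩

lemma Gen.trans (h : Gen N A B) (h' : Gen M (A ∪ B) D) : Gen (N + M) A (B ∪ D) := by
  obtain ⟨L, hL, E, hE, hB⟩ := h
  obtain ⟨L', hL', E', hE', hD⟩ := h'.mono_left (Set.union_subset hE.subset hB)
  exact ⟨L + L', by omega, E', hE.trans hE', Set.union_subset (hB.trans hE'.subset) hD⟩

lemma Gen.trans_right (h : Gen N A B) (h' : Gen M (A ∪ B) D) : Gen (N + M) A D :=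
  (h.trans h').mono_right Set.subset_union_right

lemma Gen.comp (h : Gen N A B) (h' : Gen M B D) : Gen (N + M) A D :=
  h.trans_right (h'.mono_left Set.subset_union_right)

lemma Gen.union (h : Gen N A B) (h' : Gen M A D) : Gen (N + M) A (B ∪ D) :=
  h.trans (h'.mono_left Set.subset_union_left)

lemma Gen.iUnion {κ : Type*} (s : Finset κ) {B : κ → Set ((I → ℝ) → ℝ)}
    (h : ∀ i ∈ s, Gen N A (B i)) : Gen (s.card * N) A (⋃ i ∈ s, B i) := by
  classical
  induction s using Finset.induction_on with
  | empty => simpa using Gen.of_subset (Set.empty_subset A)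
  | insert a s ha ih =>
    rw [Finset.card_insert_of_notMem ha, add_mul, one_mul, Finset.set_biUnion_insert, add_comm]
    exact (h a (Finset.mem_insert_self _ _)).union
      (ih fun i hi => h i (Finset.mem_insert_of_mem hi))

lemma Gen.range {κ : Type*} [Fintype κ] {v : κ → (I → ℝ) → ℝ} (h : ∀ i, Gen N A {v i}) :
    Gen (Fintype.card κ * N) A (Set.range v) := by
  refine (Gen.iUnion Finset.univ fun i _ => h i).mono_right ?_
  rintro _ ⟨i, rfl⟩
  simp

lemma Gen.op {f : (I → ℝ) → ℝ} (h : OpStep A f) : Gen 1 A {f} :=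
  ⟨1, le_rfl, insert f A, (Chain.refl A).step h, by simp⟩

lemma Gen.const_mul {f : (I → ℝ) → ℝ} (a : ℝ) (h : f ∈ A) : Gen 2 A {fun x => a * f x} :=
  (Gen.op (.const a)).trans_right
    (Gen.op (OpStep.mul (f := fun _ => a) (by simp) (Or.inl h)))

/-- Composition with a binary operation. -/
lemma Gen.add {f g : (I → ℝ) → ℝ} (hf : Gen N A {f}) (hg : Gen M A {g}) :
    Gen (N + M + 1) A {fun x => f x + g x} :=
  (hf.union hg).comp (Gen.op (OpStep.add (by simp) (by simp)))

lemma Gen.sub {f g : (I → ℝ) → ℝ} (hf : Gen N A {f}) (hg : Gen M A {g}) :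
    Gen (N + M + 1) A {fun x => f x - g x} :=
  (hf.union hg).comp (Gen.op (OpStep.sub (by simp) (by simp)))

lemma Gen.cmul {f : (I → ℝ) → ℝ} (a : ℝ) (hf : Gen N A {f}) : Gen (N + 2) A {fun x => a * f x} :=
  hf.comp (Gen.const_mul a rfl)

lemma Gen.mem {f : (I → ℝ) → ℝ} (h : f ∈ A) : Gen 0 A {f} := .of_subset (by simpa using h)

lemma Gen.sum {κ : Type*} (s : Finset κ) {f : κ → (I → ℝ) → ℝ} (hf : ∀ i ∈ s, f i ∈ A) :
    Gen (s.card + 1) A {fun x => ∑ i ∈ s, f i x} := by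
  classical
  induction s using Finset.induction_on with
  | empty => simpa using Gen.op (OpStep.const 0)
  | insert a s ha ih =>
    rw [Finset.card_insert_of_notMem ha]
    have h1 := (Gen.mem (hf a (Finset.mem_insert_self _ _))).add
      (ih fun i hi => hf i (Finset.mem_insert_of_mem hi))
    simp_rw [Finset.sum_insert ha]
    exact h1.mono_cost (by omega)

/-- Programs from generation statements. -/
lemma Gen.exists_program {κ : Type} {v : κ → (I → ℝ) → ℝ}
    (h : Gen N (Set.range fun (q : I) (inp : I → ℝ) => inp q) (Set.range v)) :
    ∃ p : Program I κ, p.cost ≤ N ∧ ∀ inp a, p.run inp a = v a inp := by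
  obtain ⟨M, hM, D, hD, hv⟩ := h
  obtain ⟨ops, hlen, hops⟩ := hD.exists_ops (by rintro _ ⟨q, rfl⟩; exact ⟨q, fun _ => rfl⟩)
  choose r hr using fun a => (hops (v a) (hv ⟨a, rfl⟩))
  exact ⟨⟨ops, r⟩, by rw [Program.cost, hlen]; exact hM, fun inp a => (hr a).2 inp⟩

end Programs

/-! ### Fast convolution -/

section Convolution

open Polynomial

variable {I : Type}

/-- Real and imaginary parts of the first `N` entries of a complex vector. -/
def parts (f : ℕ → (I → ℝ) → ℂ) (N : ℕ) : Set ((I → ℝ) → ℝ) :=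
  {g | ∃ i < N, g = (fun x => (f i x).re) ∨ g = fun x => (f i x).im}

/-- Real and imaginary part of a complex function. -/
def reim (f : (I → ℝ) → ℂ) : Set ((I → ℝ) → ℝ) := {fun x => (f x).re, fun x => (f x).im}

variable {A : Set ((I → ℝ) → ℝ)} {N M : ℕ}

lemma Gen.parts {f : ℕ → (I → ℝ) → ℂ} {L : ℕ} (h : ∀ i < L, Gen N A (reim (f i))) :
    Gen (L * N) A (parts f L) := by
  have := Gen.iUnion (Finset.range L) fun i hi => h i (Finset.mem_range.1 hi)
  rw [Finset.card_range] at this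
  refine this.mono_right ?_
  rintro g ⟨i, hi, hg⟩
  simp only [Finset.mem_range, Set.mem_iUnion]
  exact ⟨i, hi, hg⟩

lemma reim_subset_parts {f : ℕ → (I → ℝ) → ℂ} {L i : ℕ} (hi : i < L) :
    reim (f i) ⊆ LGCP.parts f L := fun _ hg => ⟨i, hi, hg⟩

lemma Gen.complex_add {f g : (I → ℝ) → ℂ} (hf : Gen N A (reim f)) (hg : Gen M A (reim g)) :
    Gen (N + M + 2) A (reim fun x => f x + g x) := by
  refine (hf.union hg).comp ?_
  have h1 : Gen 1 (reim f ∪ reim g) {fun x => (f x + g x).re} :=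
    Gen.op (.add (f := fun x => (f x).re) (g := fun x => (g x).re) (by simp [reim]) (by simp [reim]))
  have h2 : Gen 1 (reim f ∪ reim g) {fun x => (f x + g x).im} :=
    Gen.op (.add (f := fun x => (f x).im) (g := fun x => (g x).im) (by simp [reim]) (by simp [reim]))
  exact h1.union h2

lemma Gen.complex_sub {f g : (I → ℝ) → ℂ} (hf : Gen N A (reim f)) (hg : Gen M A (reim g)) :
    Gen (N + M + 2) A (reim fun x => f x - g x) := by
  refine (hf.union hg).comp ?_
  have h1 : Gen 1 (reim f ∪ reim g) {fun x => (f x - g x).re} :=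
    Gen.op (.sub (f := fun x => (f x).re) (g := fun x => (g x).re) (by simp [reim]) (by simp [reim]))
  have h2 : Gen 1 (reim f ∪ reim g) {fun x => (f x - g x).im} :=
    Gen.op (.sub (f := fun x => (f x).im) (g := fun x => (g x).im) (by simp [reim]) (by simp [reim]))
  exact h1.union h2

lemma Gen.complex_cmul {f : (I → ℝ) → ℂ} (w : ℂ) (hf : Gen N A (reim f)) :
    Gen (N + 10) A (reim fun x => w * f x) := by
  refine hf.comp ?_
  have hr : ∀ a : ℝ, Gen 2 (reim f) {fun x => a * (f x).re} := fun a =>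
    Gen.const_mul (f := fun x => (f x).re) a (by simp [reim])
  have hi : ∀ a : ℝ, Gen 2 (reim f) {fun x => a * (f x).im} := fun a =>
    Gen.const_mul (f := fun x => (f x).im) a (by simp [reim])
  have h1 : Gen 5 (reim f) {fun x => (w * f x).re} := (hr w.re).sub (hi w.im)
  have h2 : Gen 5 (reim f) {fun x => (w * f x).im} := (hi w.re).add (hr w.im)
  exact h1.union h2

/-- The polynomial with coefficients `f 0 x, …, f (N - 1) x`. -/
def polyOf (f : ℕ → (I → ℝ) → ℂ) (N : ℕ) (x : I → ℝ) : ℂ[X] :=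
  ∑ i ∈ Finset.range N, C (f i x) * X ^ i

lemma polyOf_add_self (f : ℕ → (I → ℝ) → ℂ) (N : ℕ) (x : I → ℝ) :
    polyOf f (N + N) x = polyOf f N x + X ^ N * polyOf (fun i => f (N + i)) N x := by
  rw [polyOf, Finset.sum_range_add, polyOf, polyOf, Finset.mul_sum]
  congr 1
  exact Finset.sum_congr rfl fun i _ => by rw [pow_add]; ring

lemma coeff_polyOf (f : ℕ → (I → ℝ) → ℂ) {N i : ℕ} (hi : i < N) (x : I → ℝ) :
    (polyOf f N x).coeff i = f i x := by
  rw [polyOf, finsetSum_coeff, Finset.sum_eq_single i]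
  · simp
  · intro j _ hj; rw [coeff_C_mul, coeff_X_pow, if_neg (Ne.symm hj), mul_zero]
  · intro h; exact absurd (Finset.mem_range.2 hi) h

lemma degree_polyOf_lt (f : ℕ → (I → ℝ) → ℂ) (N : ℕ) (x : I → ℝ) :
    (polyOf f N x).degree < N := by
  refine (degree_sum_le _ _).trans_lt ((Finset.sup_lt_iff (WithBot.bot_lt_coe N)).2 fun i hi => ?_)
  refine (degree_C_mul_X_pow_le _ _).trans_lt ?_
  exact Nat.cast_lt.2 (Finset.mem_range.1 hi)

/-- Fast multiplication by a fixed polynomial modulo `X ^ (2 ^ a) - ζ`. -/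
theorem exists_gen_mulMod (G : ℂ[X]) (a : ℕ) {ζ : ℂ} (hζ : ζ ≠ 0) (f : ℕ → (I → ℝ) → ℂ) :
    ∃ h : ℕ → (I → ℝ) → ℂ, Gen (24 * 2 ^ a * (a + 1)) (LGCP.parts f (2 ^ a)) (LGCP.parts h (2 ^ a)) ∧
      ∀ x, X ^ (2 ^ a) - C ζ ∣ G * polyOf f (2 ^ a) x - polyOf h (2 ^ a) x := by
  induction a generalizing ζ f with
  | zero =>
    refine ⟨fun i x => G.eval ζ * f i x, ?_, fun x => ?_⟩
    · have : Gen (1 * (0 + 10)) (LGCP.parts f 1) (LGCP.parts (fun i x => G.eval ζ * f i x) 1) :=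
        Gen.parts fun i hi => (Gen.of_subset (reim_subset_parts hi)).complex_cmul _
      simpa using this.mono_cost (by norm_num)
    · simp only [pow_zero, pow_one, polyOf, Finset.range_one, Finset.sum_singleton, mul_one]
      rw [dvd_iff_isRoot]
      simp
  | succ a ih =>
    -- Splitting step of the fast Fourier transform: with ω² = ζ, X^{2N} - ζ = (X^N - ω)(X^N + ω).
    -- Reduction modulo the two factors gives fp and fm, and h recombines the two products.
    obtain ⟨ω, hω⟩ : ∃ ω : ℂ, ω ^ 2 = ζ := IsAlgClosed.exists_pow_nat_eq ζ two_pos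
    have hω0 : ω ≠ 0 := by rintro rfl; simp at hω; exact hζ hω.symm
    set N := 2 ^ a with hN
    have h2N : 2 ^ (a + 1) = N + N := by rw [pow_succ]; omega
    set fp : ℕ → (I → ℝ) → ℂ := fun i x => f i x + ω * f (N + i) x with hfp
    set fm : ℕ → (I → ℝ) → ℂ := fun i x => f i x - ω * f (N + i) x with hfm
    obtain ⟨gp, hgp, hgpd⟩ := ih hω0 fp
    obtain ⟨gm, hgm, hgmd⟩ := ih (neg_ne_zero.2 hω0) fm
    set h : ℕ → (I → ℝ) → ℂ := fun i x => if i < N then (1 / 2) * (gp i x + gm i x)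
      else (1 / (2 * ω)) * (gp (i - N) x - gm (i - N) x) with hh
    refine ⟨h, ?_, fun x => ?_⟩
    · rw [h2N]
      have hfirst : Gen (N * 24) (LGCP.parts f (N + N)) (LGCP.parts fp N ∪ LGCP.parts fm N) := by
        have hp : Gen (N * 12) (LGCP.parts f (N + N)) (LGCP.parts fp N) := Gen.parts fun i hi =>
          (Gen.of_subset (reim_subset_parts (by omega))).complex_add
            ((Gen.of_subset (reim_subset_parts (by omega))).complex_cmul ω)
        have hm : Gen (N * 12) (LGCP.parts f (N + N)) (LGCP.parts fm N) := Gen.parts fun i hi =>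
          (Gen.of_subset (reim_subset_parts (by omega))).complex_sub
            ((Gen.of_subset (reim_subset_parts (by omega))).complex_cmul ω)
        exact (hp.union hm).mono_cost (by omega)
      have hsecond : Gen (24 * N * (a + 1) + 24 * N * (a + 1)) (LGCP.parts fp N ∪ LGCP.parts fm N)
          (LGCP.parts gp N ∪ LGCP.parts gm N) :=
        (hgp.mono_left Set.subset_union_left).union (hgm.mono_left Set.subset_union_right)
      have hthird : Gen ((N + N) * 12) (LGCP.parts gp N ∪ LGCP.parts gm N)
          (LGCP.parts h (N + N)) := by
        refine Gen.parts fun i hi => ?_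
        by_cases hiN : i < N
        · have : h i = fun x => (1 / 2) * (gp i x + gm i x) := by funext x; simp [hh, hiN]
          rw [this]
          exact ((Gen.of_subset ((reim_subset_parts hiN).trans Set.subset_union_left)).complex_add
            (Gen.of_subset ((reim_subset_parts hiN).trans Set.subset_union_right))).complex_cmul _
        · have : h i = fun x => (1 / (2 * ω)) * (gp (i - N) x - gm (i - N) x) := by
            funext x; simp [hh, hiN]
          have hi' : i - N < N := by omega
          rw [this]
          exact ((Gen.of_subset ((reim_subset_parts hi').trans Set.subset_union_left)).complex_sub
            (Gen.of_subset ((reim_subset_parts hi').trans Set.subset_union_right))).complex_cmul _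
      -- The recursion is T(2N) = 2 T(N) + 48 N, with 24 N operations each for splitting and
      -- recombining.
      refine ((hfirst.comp hsecond).comp hthird).mono_cost ?_
      apply le_of_eq
      ring
    · have hf2 := polyOf_add_self f N x
      have hh2 := polyOf_add_self h N x
      set f0 := polyOf f N x
      set f1 := polyOf (fun i => f (N + i)) N x
      have hlo : polyOf h N x = C (1 / 2) * (polyOf gp N x + polyOf gm N x) := by
        simp only [polyOf, ← Finset.sum_add_distrib, Finset.mul_sum]
        refine Finset.sum_congr rfl fun i hi => ?_
        rw [hh]; simp only [if_pos (Finset.mem_range.1 hi), C_mul, C_add]; ring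
      have hhi : polyOf (fun i => h (N + i)) N x
          = C (1 / (2 * ω)) * (polyOf gp N x - polyOf gm N x) := by
        simp only [polyOf, ← Finset.sum_sub_distrib, Finset.mul_sum]
        refine Finset.sum_congr rfl fun i hi => ?_
        rw [hh]
        simp only [if_neg (by omega : ¬ N + i < N), Nat.add_sub_cancel_left, C_mul, C_sub]; ring
      have hfp' : polyOf fp N x = f0 + C ω * f1 := by
        simp only [polyOf, f0, f1, Finset.mul_sum, ← Finset.sum_add_distrib]
        exact Finset.sum_congr rfl fun i _ => by rw [hfp]; simp only [C_mul, C_add]; ring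
      have hfm' : polyOf fm N x = f0 - C ω * f1 := by
        simp only [polyOf, f0, f1, Finset.mul_sum, ← Finset.sum_sub_distrib]
        exact Finset.sum_congr rfl fun i _ => by rw [hfm]; simp only [C_mul, C_sub]; ring
      set P := polyOf gp N x
      set Q := polyOf gm N x
      have hc1 : C (1 / 2 : ℂ) + C ω * C (1 / (2 * ω)) = 1 := by
        rw [← C_mul, ← C_add, ← C_1]; congr 1; field_simp; norm_num
      have hc2 : C (1 / 2 : ℂ) - C ω * C (1 / (2 * ω)) = 0 := by
        rw [← C_mul, ← C_sub, ← C_0]; congr 1; field_simp; norm_num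
      have hd1 : X ^ N - C ω ∣ G * polyOf f (N + N) x - polyOf h (N + N) x := by
        have h1 := hgpd x
        rw [hfp'] at h1
        have h2 : G * polyOf f (N + N) x - polyOf h (N + N) x
            = (G * (f0 + C ω * f1) - P)
              + (X ^ N - C ω) * (G * f1 - C (1 / (2 * ω)) * (P - Q)) := by
          rw [hf2, hh2, hlo, hhi]
          linear_combination (-P) * hc1 - Q * hc2
        rw [h2]
        exact dvd_add h1 (dvd_mul_right _ _)
      have hd2 : X ^ N + C ω ∣ G * polyOf f (N + N) x - polyOf h (N + N) x := by
        have h1 := hgmd x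
        rw [hfm', C_neg, sub_neg_eq_add] at h1
        have h2 : G * polyOf f (N + N) x - polyOf h (N + N) x
            = (G * (f0 - C ω * f1) - Q)
              + (X ^ N + C ω) * (G * f1 - C (1 / (2 * ω)) * (P - Q)) := by
          rw [hf2, hh2, hlo, hhi]
          linear_combination (-Q) * hc1 - P * hc2
        rw [h2]
        exact dvd_add h1 (dvd_mul_right _ _)
      -- The factors differ by the nonzero constant 2 ω.
      have hcop : IsCoprime (X ^ N - C ω) (X ^ N + C ω) := by
        refine ⟨-C (1 / (2 * ω)), C (1 / (2 * ω)), ?_⟩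
        have : C (1 / (2 * ω)) * C ω = C (1 / 2 : ℂ) := by
          rw [← C_mul]; congr 1; field_simp
        have h12 : C (1 / 2 : ℂ) + C (1 / 2) = 1 := by rw [← C_add, ← C_1]; norm_num
        linear_combination 2 * this + h12
      have := hcop.mul_dvd hd1 hd2
      rw [h2N]
      convert this using 1
      rw [← hω, C_pow]; ring

end Convolution

/-! ### Fast multiplication by Toeplitz matrices -/

section Toeplitz

open Polynomial

/-- Multiplication by a matrix whose entries depend on the difference of the encoded indices. -/
theorem gen_toeplitz {I : Type} {ι : Type*} [Fintype ι] {B : Matrix ι ι ℝ} {p t : ι → ℕ} {L a : ℕ}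
    (hp : Function.Injective p) (hpL : ∀ j, p j < L) (hpt : ∀ i j, p j ≤ t i)
    (ht : ∀ i, t i < 2 * L)
    (hB : ∀ i j i' j', t i - p j = t i' - p j' → B i j = B i' j') (ha : 3 * L ≤ 2 ^ a)
    (v : ι → (I → ℝ) → ℝ) :
    Gen (1 + 24 * 2 ^ a * (a + 1)) (Set.range v) (Set.range fun i inp => ∑ j, B i j * v j inp) := by
  classical
  set f : ℕ → (I → ℝ) → ℂ := fun q inp => ∑ j, if p j = q then (v j inp : ℂ) else 0 with hf
  have hf1 : ∀ j inp, f (p j) inp = v j inp := by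
    intro j inp
    rw [hf]; simp only
    rw [Finset.sum_eq_single j (fun l _ hl => if_neg fun h => hl (hp h)) (by simp), if_pos rfl]
  have hf0 : ∀ q, (∀ j, p j ≠ q) → ∀ inp, f q inp = 0 := fun q hq inp =>
    Finset.sum_eq_zero fun j _ => if_neg (hq j)
  -- An entry of B depends only on the difference d, so g is well defined; it is zero at differences
  -- that do not occur.
  set g : ℕ → ℝ := fun d => if h : ∃ ij : ι × ι, t ij.1 - p ij.2 = d then B h.choose.1 h.choose.2
    else 0 with hg
  have hg1 : ∀ i j, g (t i - p j) = B i j := by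
    intro i j
    have h : ∃ ij : ι × ι, t ij.1 - p ij.2 = t i - p j := ⟨(i, j), rfl⟩
    rw [hg]; simp only [dif_pos h]
    exact hB _ _ _ _ h.choose_spec
  set G : ℂ[X] := polyOf (fun d (_ : I → ℝ) => (g d : ℂ)) (2 * L) 0 with hG
  obtain ⟨h, hgen, hdvd⟩ := exists_gen_mulMod G a (ζ := 1) one_ne_zero f
  -- The one operation supplies the constant 0, used for unoccupied positions and for imaginary
  -- parts.
  have hin : Gen 1 (Set.range v) (parts f (2 ^ a)) := by
    refine (Gen.trans (Gen.op (OpStep.const 0)) (Gen.of_subset (B := Set.range v)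
      Set.subset_union_left)).mono_right ?_
    rintro u ⟨q, -, hu⟩
    by_cases hq : ∃ j, p j = q
    · obtain ⟨j, rfl⟩ := hq
      rcases hu with rfl | rfl
      · exact Or.inr ⟨j, by funext inp; simp [hf1]⟩
      · exact Or.inl (by simp [hf1])
    · have := hf0 q (not_exists.1 hq)
      rcases hu with rfl | rfl <;> exact Or.inl (by simp [this])
  refine (hin.comp hgen).mono_right ?_
  rintro _ ⟨i, rfl⟩
  have hLpos : 0 < L := (Nat.zero_le _).trans_lt (hpL i)
  refine ⟨t i, (ht i).trans_le (by omega), Or.inl ?_⟩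
  funext inp
  have hP : polyOf f (2 ^ a) inp = ∑ j, C (v j inp : ℂ) * X ^ p j := by
    ext q
    rw [finsetSum_coeff]
    simp only [coeff_C_mul_X_pow]
    by_cases hq : q < 2 ^ a
    · rw [coeff_polyOf f hq, hf]
      exact Finset.sum_congr rfl fun j _ => by simp only [eq_comm]
    · rw [coeff_eq_zero_of_degree_lt ((degree_polyOf_lt f _ inp).trans_le
        (Nat.cast_le.2 (not_lt.1 hq))), Finset.sum_eq_zero]
      intro j _
      exact if_neg fun hj => by have := hpL j; omega
  have hdP : (polyOf f (2 ^ a) inp).degree < L := by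
    rw [hP]
    refine (degree_sum_le _ _).trans_lt
      ((Finset.sup_lt_iff (WithBot.bot_lt_coe L)).2 fun j _ => ?_)
    exact (degree_C_mul_X_pow_le _ _).trans_lt (Nat.cast_lt.2 (hpL j))
  -- No wrap-around: the product has degree below 3 L ≤ 2^a, so the congruence modulo X^(2^a) - 1 is
  -- an equality.
  have hdGP : (G * polyOf f (2 ^ a) inp).degree < (2 ^ a : ℕ) := by
    by_cases hz : G = 0
    · rw [hz, zero_mul, degree_zero]; exact WithBot.bot_lt_coe _
    by_cases hz' : polyOf f (2 ^ a) inp = 0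
    · rw [hz', mul_zero, degree_zero]; exact WithBot.bot_lt_coe _
    have h1 : G.natDegree < 2 * L := (natDegree_lt_iff_degree_lt hz).2 (degree_polyOf_lt _ _ _)
    have h2 := (natDegree_lt_iff_degree_lt hz').2 hdP
    rw [← natDegree_lt_iff_degree_lt (mul_ne_zero hz hz'), natDegree_mul hz hz']
    omega
  have heq : G * polyOf f (2 ^ a) inp = polyOf h (2 ^ a) inp := by
    refine sub_eq_zero.1 (eq_zero_of_dvd_of_degree_lt (hdvd inp) ?_)
    rw [degree_X_pow_sub_C (by positivity)]
    exact (degree_sub_le _ _).trans_lt (max_lt hdGP (degree_polyOf_lt _ _ _))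
  have hti : t i < 2 ^ a := (ht i).trans_le (by omega)
  rw [← coeff_polyOf h hti, ← heq, hP, Finset.mul_sum, finsetSum_coeff, Complex.re_sum]
  refine Finset.sum_congr rfl fun j _ => ?_
  rw [← mul_assoc, coeff_mul_X_pow', if_pos (hpt i j), coeff_mul_C, hG,
    coeff_polyOf _ ((Nat.sub_le _ _).trans_lt (ht i)), hg1]
  simp

end Toeplitz

/-! ### Translation invariance on the lattice -/

section Translation

variable {n₁ n₂ : ℕ} [NeZero n₁] [NeZero n₂]

/-- Cyclic addition of indices differs from addition of integers by a multiple of n, which after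
division by n is an integer and vanishes on the circle. -/
lemma coe_fin_add_div {n : ℕ} [NeZero n] (i g : Fin n) :
    ((((i + g : Fin n) : ℕ) : ℝ) / n : ℝ) = (((((i : ℕ) : ℝ) / n : ℝ) : UnitAddCircle)
      + ((((g : ℕ) : ℝ) / n : ℝ) : UnitAddCircle)) := by
  have hn : (n : ℝ) ≠ 0 := Nat.cast_ne_zero.2 (NeZero.ne n)
  have h1 : ((((i : ℕ) : ℝ) / n : ℝ)) + (((g : ℕ) : ℝ) / n : ℝ)
      = (((i + g : Fin n) : ℕ) : ℝ) / n + ((((i : ℕ) + g) / n : ℕ) : ℝ) := by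
    rw [Fin.val_add]
    have := Nat.mod_add_div ((i : ℕ) + g) n
    have h2 : ((((i : ℕ) + g) % n : ℕ) : ℝ) + n * ((((i : ℕ) + g) / n : ℕ) : ℝ)
        = ((i : ℕ) : ℝ) + ((g : ℕ) : ℝ) := by exact_mod_cast this
    field_simp
    linarith
  rw [← AddCircle.coe_add, h1, AddCircle.coe_add]
  have h0 : ∀ m : ℕ, (((m : ℝ)) : UnitAddCircle) = 0 := by
    intro m
    have := AddCircle.coe_nsmul (1 : ℝ) (n := m) (x := (1 : ℝ))
    rw [nsmul_one, AddCircle.coe_period, nsmul_zero] at this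
    exact this
  rw [h0, add_zero]

lemma latticePoint_add (i g : Lattice n₁ n₂) :
    latticePoint (i + g) = latticePoint i + latticePoint g :=
  Prod.ext (coe_fin_add_div i.1 g.1) (coe_fin_add_div i.2 g.2)

/-- Invariance of a matrix under all lattice translations. -/
def TransInvariant (B : Matrix (Lattice n₁ n₂) (Lattice n₁ n₂) ℝ) : Prop :=
  ∀ g : Lattice n₁ n₂, B.submatrix (Equiv.addRight g) (Equiv.addRight g) = B

lemma transInvariant_covMatrix (c : Torus → ℝ) : TransInvariant (covMatrix c n₁ n₂) := by
  intro g
  ext i j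
  simp [covMatrix, latticePoint_add]

lemma transInvariant_precond (c : Torus → ℝ) (α : ℕ → ℝ) : TransInvariant (precond c α n₁ n₂) := by
  intro g
  have h1 : (precision c n₁ n₂).submatrix (Equiv.addRight g) (Equiv.addRight g)
      = precision c n₁ n₂ := by
    rw [precision, ← Matrix.inv_submatrix_equiv, transInvariant_covMatrix c g]
  have h2 := Matrix.submatrix_one_equiv (α := ℝ) (Equiv.addRight g)
  ext i j
  have h3 := congrFun (congrFun h1 i) j
  have h4 := congrFun (congrFun h2 i) j
  simp only [Matrix.submatrix_apply] at h3 h4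
  simp only [precond, Matrix.submatrix_apply, Matrix.add_apply, Matrix.smul_apply, h3, h4]

/-- The inverse square root is a polynomial in B, and simultaneous translation of rows and columns
is an algebra automorphism fixing B. -/
lemma TransInvariant.invSqrt {B : Matrix (Lattice n₁ n₂) (Lattice n₁ n₂) ℝ}
    (h : TransInvariant B) (hB : B.IsHermitian) : TransInvariant (invSqrt B) := by
  intro g
  rw [LGCP.invSqrt, cfc_eq_aeval_interpolate hB _ (s := B.finite_real_spectrum.toFinset) (by simp)]
  have h1 := Polynomial.aeval_algHom_apply
    (Matrix.reindexAlgEquiv ℝ ℝ (Equiv.addRight g).symm).toAlgHom B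
    (Lagrange.interpolate B.finite_real_spectrum.toFinset id fun t : ℝ => (√t)⁻¹)
  have h2 : (Matrix.reindexAlgEquiv ℝ ℝ (Equiv.addRight g).symm).toAlgHom B = B := h g
  rw [h2] at h1
  exact h1.symm

/-- Fast multiplication by a translation invariant matrix. -/
theorem TransInvariant.gen {I : Type} {B : Matrix (Lattice n₁ n₂) (Lattice n₁ n₂) ℝ}
    (h : TransInvariant B) (v : Lattice n₁ n₂ → (I → ℝ) → ℝ) :
    Gen (1 + 24 * 2 ^ Nat.clog 2 (6 * (n₁ * n₂)) * (Nat.clog 2 (6 * (n₁ * n₂)) + 1))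
      (Set.range v) (Set.range fun i inp => ∑ j, B i j * v j inp) := by
  have hlt : ∀ j : Lattice n₁ n₂, (j.1 : ℕ) * (2 * n₂) + j.2 < 2 * (n₁ * n₂) := by
    intro j
    have h1 : ((j.1 : ℕ) + 1) * (2 * n₂) ≤ n₁ * (2 * n₂) := Nat.mul_le_mul_right _ j.1.2
    have h2 := j.2.2
    nlinarith
  have key : ∀ a b a' b' : ℕ, b < 2 * n₂ → b' < 2 * n₂ →
      a * (2 * n₂) + b = a' * (2 * n₂) + b' → a = a' ∧ b = b' := by
    intro a b a' b' hb hb' hab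
    have haa : a = a' := by
      have h1 := congrArg (· / (2 * n₂)) hab
      have hpos : 0 < 2 * n₂ := by omega
      simpa [Nat.mul_add_div hpos, mul_comm _ (2 * n₂), Nat.div_eq_of_lt hb, Nat.div_eq_of_lt hb']
        using h1
    subst haa
    exact ⟨rfl, by omega⟩
  -- Rows are stored with stride 2 n₂, so sums of two column indices do not carry and equal
  -- differences of codes give i + j' = i' + j. The shift by 2 n₁ n₂ keeps the differences
  -- nonnegative.
  refine gen_toeplitz (p := fun j => (j.1 : ℕ) * (2 * n₂) + j.2)
    (t := fun i => (i.1 : ℕ) * (2 * n₂) + i.2 + 2 * (n₁ * n₂)) (L := 2 * (n₁ * n₂))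
    ?_ hlt ?_ ?_ ?_ ?_ v
  · intro i j hij
    have := i.2.2
    have := j.2.2
    obtain ⟨h1, h2⟩ := key _ _ _ _ (by omega) (by omega) hij
    exact Prod.ext (Fin.ext h1) (Fin.ext h2)
  · intro i j
    have := hlt j
    omega
  · intro i
    have := hlt i
    omega
  · intro i j i' j' hij
    have a1 := hlt j
    have a2 := hlt j'
    have := i.2.2
    have := j.2.2
    have := i'.2.2
    have := j'.2.2
    obtain ⟨h1, h2⟩ := key ((i.1 : ℕ) + j'.1) ((i.2 : ℕ) + j'.2) (i'.1 + j.1) (i'.2 + j.2)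
      (by omega) (by omega) (by rw [add_mul, add_mul]; omega)
    have hsum : i + j' = i' + j := by
      refine Prod.ext (Fin.ext ?_) (Fin.ext ?_)
      · simp only [Prod.fst_add, Fin.val_add, h1]
      · simp only [Prod.snd_add, Fin.val_add, h2]
    -- Translation by i' - i maps (i, j) to (i', j').
    have h3 := congrFun (congrFun (h (i' - i)) i) j
    rw [Matrix.submatrix_apply, Equiv.coe_addRight] at h3
    have h4 : j + (i' - i) = j' := by rw [← add_sub_assoc, add_comm j, ← hsum, add_sub_cancel_left]
    rw [← h3]
    simp only [add_sub_cancel, h4]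
  · refine le_trans (by omega) (Nat.le_pow_clog one_lt_two (6 * (n₁ * n₂)))

end Translation

/-! ### Programs for polynomial approximations of the proposal -/

section PolyProgram

open Polynomial

variable {I : Type} {ι : Type*}

/-- The coordinate functions of a vector of functions. -/
def coords (V : (I → ℝ) → Vec ι) : Set ((I → ℝ) → ℝ) := Set.range fun i inp => V inp i

variable {N : ℕ} {A : Set ((I → ℝ) → ℝ)}

lemma mem_coords (V : (I → ℝ) → Vec ι) (i : ι) : (fun inp => V inp i) ∈ coords V := ⟨i, rfl⟩

lemma Gen.coords [Fintype ι] {V : (I → ℝ) → Vec ι} (h : ∀ i, Gen N A {fun inp => V inp i}) :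
    Gen (Fintype.card ι * N) A (coords V) := Gen.range h

variable [Fintype ι] [DecidableEq ι]

/-- Approximate draw of the proposal: the functions `t⁻¹` and `(t^{-1/2} - 1) / (t - 1)` of
`1 + B D B` are replaced by the polynomials `p₁` and `p₂`. -/
def polyDraw (B : Matrix ι ι ℝ) (δ : ℝ) (p₁ p₂ : ℝ[X]) (x : Vec ι) (D : ι → ℝ) (s z : Vec ι) :
    Vec ι :=
  x + (δ ^ 2 / 2) • mulV B (mulV (aeval (1 + B * Matrix.diagonal D * B) p₁) (mulV B s))
    + δ • mulV B (z + mulV (aeval (1 + B * Matrix.diagonal D * B) p₂)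
      (mulV (B * Matrix.diagonal D * B) z))

variable {B : Matrix ι ι ℝ}

lemma gen_perturbation
  (hB : ∀ V : (I → ℝ) → Vec ι, Gen N (coords V) (coords fun inp => mulV B (V inp)))
    (D V : (I → ℝ) → Vec ι) :
    Gen (2 * N + Fintype.card ι) (coords D ∪ coords V)
      (coords fun inp => mulV (B * Matrix.diagonal (D inp) * B) (V inp)) := by
  have h1 := (hB V).mono_left (Set.subset_union_right (s := coords D))
  have h2 : Gen (Fintype.card ι * 1) (coords D ∪ coords fun inp => mulV B (V inp))
      (coords fun inp => mulV (Matrix.diagonal (D inp)) (mulV B (V inp))) := by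
    refine Gen.coords fun i => ?_
    simp_rw [mulV_diagonal]
    exact Gen.op (.mul (Or.inl (mem_coords D i)) (Or.inr (mem_coords _ i)))
  have h3 := h1.trans_right ((h2.mono_left (D := _ ∪ _) (by
    intro f hf
    rcases hf with hf | hf
    · exact Or.inl (Or.inl hf)
    · exact Or.inr hf)).comp (hB _))
  simp_rw [mul_mulV]
  exact h3.mono_cost (by omega)

/-- Horner's scheme: each degree costs one application of 1 + B D B, which is two convolutions and
O(n) further operations. -/
lemma gen_aeval
  (hB : ∀ V : (I → ℝ) → Vec ι, Gen N (coords V) (coords fun inp => mulV B (V inp)))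
    (D V : (I → ℝ) → Vec ι) (d : ℕ) (p : ℝ[X]) (hd : p.natDegree ≤ d) :
    Gen ((d + 1) * (2 * N + 5 * Fintype.card ι)) (coords D ∪ coords V)
      (coords fun inp => mulV (aeval (1 + B * Matrix.diagonal (D inp) * B) p) (V inp)) := by
  induction d generalizing p with
  | zero =>
    obtain ⟨a, rfl⟩ := natDegree_eq_zero.1 (Nat.le_zero.1 hd)
    simp_rw [aeval_mulV_C]
    refine (Gen.coords (N := 2) fun i => ?_).mono_cost (by omega)
    exact Gen.const_mul a (Or.inr (mem_coords V i))
  | succ d ih =>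
    have hq := ih p.divX (by rw [natDegree_divX_eq_natDegree_tsub_one]; omega)
    set W : (I → ℝ) → Vec ι := fun inp =>
      mulV (aeval (1 + B * Matrix.diagonal (D inp) * B) p.divX) (V inp) with hW
    have hE := gen_perturbation hB D W
    have h1 := hq.trans (hE.mono_left (D := coords D ∪ coords V ∪ coords W) (by
      intro f hf
      rcases hf with hf | hf
      · exact Or.inl (Or.inl hf)
      · exact Or.inr hf))
    have h2 : Gen (Fintype.card ι * 4) (coords D ∪ coords V ∪
        (coords W ∪ coords fun inp => mulV (B * Matrix.diagonal (D inp) * B) (W inp)))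
        (coords fun inp => mulV (aeval (1 + B * Matrix.diagonal (D inp) * B) p) (V inp)) := by
      refine Gen.coords fun i => ?_
      have hp : ∀ inp, mulV (aeval (1 + B * Matrix.diagonal (D inp) * B) p) (V inp) i
          = p.coeff 0 * V inp i
            + (W inp i + mulV (B * Matrix.diagonal (D inp) * B) (W inp) i) := by
        intro inp
        conv_lhs => rw [← X_mul_divX_add p]
        rw [aeval_mulV_add, aeval_mulV_X_mul, aeval_mulV_C, add_mulV, one_mulV]
        simp only [PiLp.add_apply, PiLp.smul_apply, smul_eq_mul]
        rw [add_comm]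
      simp_rw [hp]
      have ha := Gen.const_mul (A := coords D ∪ coords V ∪
        (coords W ∪ coords fun inp => mulV (B * Matrix.diagonal (D inp) * B) (W inp)))
        (p.coeff 0) (Or.inl (Or.inr (mem_coords V i)))
      exact ha.add ((Gen.mem (Or.inr (Or.inl (mem_coords W i)))).add
        (Gen.mem (Or.inr (Or.inr (mem_coords _ i)))))
    refine (h1.trans_right h2).mono_cost ?_
    rw [add_mul (d + 1)]
    omega

lemma gen_polyDraw
  (hB : ∀ V : (I → ℝ) → Vec ι, Gen N (coords V) (coords fun inp => mulV B (V inp)))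
    (δ : ℝ) (p₁ p₂ : ℝ[X]) (x D s z : (I → ℝ) → Vec ι) :
    Gen ((p₁.natDegree + p₂.natDegree + 10) * (2 * N + 5 * Fintype.card ι))
      (coords x ∪ coords D ∪ (coords s ∪ coords z))
      (coords fun inp => polyDraw B δ p₁ p₂ (x inp) (D inp) (s inp) (z inp)) := by
  set S := coords x ∪ coords D ∪ (coords s ∪ coords z) with hS
  have hxS : coords x ⊆ S := fun f hf => Or.inl (Or.inl hf)
  have hDS : coords D ⊆ S := fun f hf => Or.inl (Or.inr hf)
  have hsS : coords s ⊆ S := fun f hf => Or.inr (Or.inl hf)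
  have hzS : coords z ⊆ S := fun f hf => Or.inr (Or.inr hf)
  have a1 := (hB s).mono_left hsS
  have a2 := a1.trans_right ((gen_aeval hB D (fun inp => mulV B (s inp)) _ p₁ le_rfl).mono_left
    (Set.union_subset_union_left _ hDS))
  have a3 := a2.comp (hB _)
  have b1 := (gen_perturbation hB D z).mono_left (Set.union_subset hDS hzS)
  have b2 := b1.trans_right ((gen_aeval hB D
    (fun inp => mulV (B * Matrix.diagonal (D inp) * B) (z inp)) _ p₂ le_rfl).mono_left
    (Set.union_subset_union_left _ hDS))
  set W : (I → ℝ) → Vec ι := fun inp => mulV (aeval (1 + B * Matrix.diagonal (D inp) * B) p₂)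
    (mulV (B * Matrix.diagonal (D inp) * B) (z inp)) with hW
  have b3 : Gen (Fintype.card ι * 1) (S ∪ coords W) (coords fun inp => z inp + W inp) := by
    refine Gen.coords fun i => ?_
    exact Gen.op (.add (f := fun inp => z inp i) (g := fun inp => W inp i)
      (Or.inl (hzS (mem_coords z i))) (Or.inr (mem_coords W i)))
  have b4 := (b2.trans_right b3).comp (hB _)
  have c1 := a3.union b4
  set U : (I → ℝ) → Vec ι := fun inp => mulV B (mulV (aeval
    (1 + B * Matrix.diagonal (D inp) * B) p₁) (mulV B (s inp))) with hU
  set Y : (I → ℝ) → Vec ι := fun inp => mulV B (z inp + W inp) with hY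
  have c2 : Gen (Fintype.card ι * 6) (S ∪ (coords U ∪ coords Y))
      (coords fun inp => polyDraw B δ p₁ p₂ (x inp) (D inp) (s inp) (z inp)) := by
    refine Gen.coords fun i => ?_
    have h := ((Gen.mem (A := S ∪ (coords U ∪ coords Y)) (Or.inl (hxS (mem_coords x i)))).add
      (Gen.const_mul (δ ^ 2 / 2) (Or.inr (Or.inl (mem_coords U i))))).add
      (Gen.const_mul δ (Or.inr (Or.inr (mem_coords Y i))))
    exact h.mono_right (by rintro _ rfl; rfl)
  refine (c1.trans_right c2).mono_cost ?_
  have e : (p₁.natDegree + p₂.natDegree + 10) * (2 * N + 5 * Fintype.card ι)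
      = (p₁.natDegree + 1) * (2 * N + 5 * Fintype.card ι)
        + (p₂.natDegree + 1) * (2 * N + 5 * Fintype.card ι)
        + 8 * (2 * N + 5 * Fintype.card ι) := by ring
  rw [e]
  omega

end PolyProgram

/-! ### Cost of the proposal program -/

section Cost

open Polynomial

lemma convolution_cost_le {n : ℕ} (hn : 2 ≤ n) :
    ((2 * (1 + 24 * 2 ^ Nat.clog 2 (6 * n) * (Nat.clog 2 (6 * n) + 1)) + 5 * n : ℕ) : ℝ)
      ≤ 7000 * (n * Real.log n) := by
  set a := Nat.clog 2 (6 * n) with ha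
  -- By minimality of a, 2^(a-1) < 6 n.
  have h1 : 2 ^ a < 12 * n := by
    have h0 : 0 < a := Nat.clog_pos one_lt_two (by omega)
    have := Nat.pow_pred_clog_lt_self one_lt_two (x := 6 * n) (by omega)
    rw [← ha] at this
    have h2 : 2 ^ a = 2 * 2 ^ a.pred := by
      rw [← pow_succ', ← Nat.succ_eq_add_one, Nat.succ_pred_eq_of_pos h0]
    omega
  have h2 : (2 : ℝ) ^ a ≤ 12 * n := by exact_mod_cast h1.le
  have hn' : (2 : ℝ) ≤ n := by exact_mod_cast hn
  have hlog2 : 0.69 < Real.log 2 := lt_trans (by norm_num) Real.log_two_gt_d9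
  have hlogn : Real.log 2 ≤ Real.log n := Real.log_le_log (by norm_num) hn'
  have h3 : (a : ℝ) * Real.log 2 ≤ 5 * Real.log n := by
    rw [← Real.log_pow]
    -- The estimate 12 n ≤ n^5 for n ≥ 2 turns a into a multiple of log n.
    have h4 : (2 : ℝ) ^ a ≤ (n : ℝ) ^ 5 := by
      refine h2.trans ?_
      have : (16 : ℝ) ≤ (n : ℝ) ^ 4 := by
        calc (16 : ℝ) = 2 ^ 4 := by norm_num
          _ ≤ _ := pow_le_pow_left₀ (by norm_num) hn' 4
      calc 12 * (n : ℝ) ≤ (n : ℝ) ^ 4 * n := by gcongr; linarith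
        _ = _ := by ring
    have h5 := Real.log_le_log (by positivity) h4
    rw [Real.log_pow (n : ℝ) 5] at h5
    exact_mod_cast h5
  set l := Real.log n
  have h6 : (a : ℝ) + 1 ≤ 10 * l := by
    have : (a : ℝ) * 0.69 ≤ 5 * l := by nlinarith [Nat.cast_nonneg (α := ℝ) a]
    linarith
  have h7 : (2 : ℝ) ^ a * (a + 1) ≤ 12 * n * (10 * l) := by gcongr
  have h8 : (n : ℝ) * 0.69 ≤ n * l := by gcongr; linarith
  push_cast
  nlinarith

variable {n₁ n₂ : ℕ} [NeZero n₁] [NeZero n₂]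

/-- A program of length `O(n log n)` for a polynomial approximation of the proposal. -/
theorem exists_program_polyDraw (k : ℕ) {B : Matrix (Lattice n₁ n₂) (Lattice n₁ n₂) ℝ}
    (hB : TransInvariant B) (α : ℕ → ℝ) (δ : ℝ) (p₁ p₂ : ℝ[X]) :
    ∃ P : Program (ProposalInput k n₁ n₂) (Lattice n₁ n₂),
      P.cost ≤ (p₁.natDegree + p₂.natDegree + k + 30) *
        (2 * (1 + 24 * 2 ^ Nat.clog 2 (6 * (n₁ * n₂)) * (Nat.clog 2 (6 * (n₁ * n₂)) + 1))
          + 5 * (n₁ * n₂)) ∧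
      ∀ x (y : Fin k → Lattice n₁ n₂ → ℕ) z i, P.run (proposalInput x y z) i
        = polyDraw B δ p₁ p₂ (WithLp.toLp 2 x) (perturbation α k x) (score x y) z i := by
  set I := ProposalInput k n₁ n₂
  set S : Set ((I → ℝ) → ℝ) := Set.range fun (q : I) (inp : I → ℝ) => inp q with hS
  have hcard : Fintype.card (Lattice n₁ n₂) = n₁ * n₂ := by simp
  set M := 1 + 24 * 2 ^ Nat.clog 2 (6 * (n₁ * n₂)) * (Nat.clog 2 (6 * (n₁ * n₂)) + 1)
  have hgen : ∀ V : (I → ℝ) → Vec (Lattice n₁ n₂),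
      Gen M (coords V) (coords fun inp => mulV B (V inp)) :=
    fun V => hB.gen fun i inp => V inp i
  set x : (I → ℝ) → Vec (Lattice n₁ n₂) := fun inp => WithLp.toLp 2 fun i => inp (Sum.inl i)
  set z : (I → ℝ) → Vec (Lattice n₁ n₂) := fun inp =>
    WithLp.toLp 2 fun i => inp (Sum.inr (Sum.inr i))
  set R : (I → ℝ) → Vec (Lattice n₁ n₂) := fun inp => WithLp.toLp 2 fun i =>
    (k * ((n₁ : ℝ) * n₂)⁻¹) * Real.exp (inp (Sum.inl i)) with hR
  set D : (I → ℝ) → Vec (Lattice n₁ n₂) := fun inp => WithLp.toLp 2 fun i =>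
    R inp i - α (n₁ * n₂) with hD
  set s : (I → ℝ) → Vec (Lattice n₁ n₂) := fun inp => WithLp.toLp 2 fun i =>
    (∑ r : Fin k, inp (Sum.inr (Sum.inl (r, i)))) - R inp i with hs
  have hx : coords x ⊆ S := by rintro _ ⟨i, rfl⟩; exact ⟨Sum.inl i, rfl⟩
  have hz : coords z ⊆ S := by rintro _ ⟨i, rfl⟩; exact ⟨Sum.inr (Sum.inr i), rfl⟩
  have gR : ∀ i, Gen 3 S {fun inp => R inp i} := fun i =>
    (Gen.op (.exp (f := fun inp => inp (Sum.inl i)) (Set.mem_range_self (Sum.inl i)))).cmul _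
  have gD : Gen (Fintype.card (Lattice n₁ n₂) * 5) S (coords D) :=
    Gen.coords fun i => (gR i).sub (Gen.op (.const (α (n₁ * n₂))))
  have gs : Gen (Fintype.card (Lattice n₁ n₂) * (k + 5)) S (coords s) := by
    refine Gen.coords fun i => ?_
    have h := (Gen.sum (A := S) (Finset.univ : Finset (Fin k))
      (f := fun r inp => inp (Sum.inr (Sum.inl (r, i)))) fun r _ => Set.mem_range_self (Sum.inr (Sum.inl (r, i)))).sub (gR i)
    rw [Finset.card_univ, Fintype.card_fin] at h
    exact h.mono_cost (by omega)
  have g1 := (gD.union gs).trans_right ((gen_polyDraw hgen δ p₁ p₂ x D s z).mono_left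
    (D := S ∪ (coords D ∪ coords s)) (by
      rintro f ((hf | hf) | (hf | hf))
      · exact Or.inl (hx hf)
      · exact Or.inr (Or.inl hf)
      · exact Or.inr (Or.inr hf)
      · exact Or.inl (hz hf)))
  obtain ⟨P, hP, hrun⟩ := Gen.exists_program g1
  refine ⟨P, hP.trans ?_, fun x' y z' i => ?_⟩
  · rw [hcard]
    have e : (p₁.natDegree + p₂.natDegree + k + 30) * (2 * M + 5 * (n₁ * n₂))
        = (p₁.natDegree + p₂.natDegree + 10) * (2 * M + 5 * (n₁ * n₂))
          + ((k + 20) * (2 * M) + n₁ * n₂ * (5 * k + 100)) := by ring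
    have e2 : n₁ * n₂ * 5 + n₁ * n₂ * (k + 5) ≤ n₁ * n₂ * (5 * k + 100) := by
      rw [← mul_add]
      exact Nat.mul_le_mul_left _ (by omega)
    omega
  · rw [hrun]
    have e1 : (D (proposalInput x' y z')).ofLp = perturbation α k x' := by
      funext i
      simp only [hD, hR, proposalInput, Sum.elim_inl, perturbation, coe_cellRate]
      ring
    have e2 : s (proposalInput x' y z') = score x' y := by
      ext i
      rw [score_apply]
      simp only [hs, hR, proposalInput, Sum.elim_inl, Sum.elim_inr, centred, coe_cellRate,
        Finset.sum_sub_distrib, Finset.sum_const, Finset.card_univ, Fintype.card_fin, nsmul_eq_mul]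
      ring
    beta_reduce
    rw [e1, e2]
    rfl

end Cost

/-! ### Accuracy of the computed proposals -/

lemma transpose_matSqrt {ι : Type*} [Fintype ι] [DecidableEq ι] (M : Matrix ι ι ℝ) :
    (matSqrt M).transpose = matSqrt M := transpose_cfc _

/-- Union bound: data and noise each receive half of the failure probability. -/
lemma prod_le_of_imp {Ω₁ Ω₂ : Type*} [MeasurableSpace Ω₁] [MeasurableSpace Ω₂] {μ : Measure Ω₁}
    {ν : Measure Ω₂} [IsProbabilityMeasure μ] [IsProbabilityMeasure ν] {p : Ω₁ → Prop}
    {q : Ω₂ → Prop} {r : Ω₁ × Ω₂ → Prop} {η : ℝ} (hη : 0 ≤ η)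
    (hp : μ {y | p y} ≤ ENNReal.ofReal (η / 2)) (hq : ν {z | q z} ≤ ENNReal.ofReal (η / 2))
    (hr : ∀ w, ¬ p w.1 → ¬ q w.2 → r w) : (μ.prod ν) {w | ¬ r w} ≤ ENNReal.ofReal η := by
  have hsub : {w | ¬ r w} ⊆ ({y | p y} ×ˢ Set.univ) ∪ (Set.univ ×ˢ {z | q z}) := by
    intro w hw
    by_contra hcon
    simp only [Set.mem_union, Set.mem_prod, Set.mem_ofPred_eq, Set.mem_univ, and_true, true_and,
      not_or] at hcon
    exact hw (hr w hcon.1 hcon.2)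
  calc (μ.prod ν) {w | ¬ r w} ≤ _ := measure_mono hsub
    _ ≤ _ := measure_union_le _ _
    _ = μ {y | p y} + ν {z | q z} := by
      rw [Measure.prod_prod, Measure.prod_prod, measure_univ, measure_univ, mul_one, one_mul]
    _ ≤ ENNReal.ofReal (η / 2) + ENNReal.ofReal (η / 2) := add_le_add hp hq
    _ = ENNReal.ofReal η := by
      rw [← ENNReal.ofReal_add (by positivity) (by positivity), add_halves]

namespace Setup

open Polynomial

variable {n₁ n₂ : ℕ} {c : Torus → ℝ} {α : ℕ → ℝ} {ρ a : ℝ}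

/-- With high probability, uniformly over the lattices, the preconditioned score and the perturbed
noise vector are bounded. -/
theorem exists_tight (h : Setup c α ρ a) (k : ℕ) {Λ : ℝ} (hΛ : 0 ≤ Λ) {η : ℝ} (hη : 0 < η) :
    ∃ R : ℝ, 0 < R ∧ ∀ n₁ n₂ : ℕ, 0 < n₁ → 0 < n₂ →
      ∀ F : Matrix (Lattice n₁ n₂) (Lattice n₁ n₂) ℝ, F * F.transpose = precond c α n₁ n₂ →
      ∀ x : Lattice n₁ n₂ → ℝ, (∀ i, Real.exp (x i) ≤ Λ) →
        stdGaussian (Vec (Lattice n₁ n₂))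
          {z | R < ‖mulV (conjInv F (Matrix.diagonal (perturbation α k x))) z‖}
            ≤ ENNReal.ofReal η ∧
        obsLaw k x {y | R < ‖mulV F⁻¹ (score x y)‖} ≤ ENNReal.ofReal η := by
  have hc := h.c_zero_pos
  have hρ := h.rho_pos
  obtain ⟨T, hT, hTb⟩ := h.exists_perturbation_bound k hΛ
  -- S dominates the second moments of both norms, and Markov's inequality then requires R² = S / η.
  set S := max T (k * Λ * (c 0 / ρ)) with hS
  have hS0 : 0 < S := lt_max_of_lt_left hT
  refine ⟨√(S / η), Real.sqrt_pos.2 (by positivity), fun n₁ n₂ h₁ h₂ F hF x hx => ?_⟩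
  have hR : S ≤ η * √(S / η) ^ 2 := by
    rw [Real.sq_sqrt (by positivity), mul_div_cancel₀ _ hη.ne']
  obtain ⟨-, -, hsum⟩ := hTb n₁ n₂ h₁ h₂ F hF x hx
  constructor
  · obtain ⟨hi, he⟩ := integral_norm_sq_mulV_stdGaussian
      (isHermitian_conjInv_perturbation (α := α) F k x)
    exact measure_lt_le_of_integral_sq_le hi (he.le.trans (hsum.trans (le_max_left _ _)))
      (Real.sqrt_pos.2 (by positivity)) hR
  · obtain ⟨hi, he⟩ := integral_norm_sq_mulV_score (k := k) x F⁻¹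
    refine measure_lt_le_of_integral_sq_le hi (he.le.trans (le_trans ?_ (le_max_right _ _)))
      (Real.sqrt_pos.2 (by positivity)) hR
    have hn : (0 : ℝ) < (n₁ : ℝ) * n₂ := by positivity
    -- Each of the n cells has variance O(1 / n) and preconditioned norm squared at most c(0) / ρ,
    -- so the sum is bounded.
    calc ∑ i, (k : ℝ) * cellRate x i * ‖mulV F⁻¹ (EuclideanSpace.single i 1)‖ ^ 2
        ≤ ∑ _i : Lattice n₁ n₂, (k : ℝ) * (Λ / ((n₁ : ℝ) * n₂)) * (c 0 / ρ) := by
          gcongr with i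
          · rw [coe_cellRate]
            gcongr
            exact hx i
          · have := (h.isPreconditioner h₁ h₂ hF).norm_sq_inv_single_le i
            rwa [covMatrix_diag] at this
      _ = _ := by
          rw [Finset.sum_const, nsmul_eq_mul, Finset.card_univ, card_lattice]
          field_simp

lemma proposalDraw_eq (h : Setup c α ρ a) (h₁ : 0 < n₁) (h₂ : 0 < n₂)
    {F : Matrix (Lattice n₁ n₂) (Lattice n₁ n₂) ℝ} (hF : F * F.transpose = precond c α n₁ n₂)
    {k : ℕ} (δ : ℝ) (x : Lattice n₁ n₂ → ℝ) (y : Fin k → Lattice n₁ n₂ → ℕ)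
    (z : Vec (Lattice n₁ n₂)) :
    proposalDraw c δ x y F z = WithLp.toLp 2 x
      + (δ ^ 2 / 2) • mulV F.transpose⁻¹ (mulV (precondMatrix c k x F)⁻¹ (mulV F⁻¹ (score x y)))
      + δ • mulV F.transpose⁻¹ (sampleU c k x F z) := by
  rw [proposalDraw, proposalMean, ← h.inv_precondMatrix h₁ h₂ hF k x, mul_mulV, mul_mulV,
    Matrix.transpose_nonsing_inv]

lemma abs_sub_proposalDraw_le (h : Setup c α ρ a) (h₁ : 0 < n₁) (h₂ : 0 < n₂)
    {F : Matrix (Lattice n₁ n₂) (Lattice n₁ n₂) ℝ} (hF : F * F.transpose = precond c α n₁ n₂)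
    {k : ℕ} (δ : ℝ) (x : Lattice n₁ n₂ → ℝ) (y : Fin k → Lattice n₁ n₂ → ℕ)
    (z v w : Vec (Lattice n₁ n₂)) {b d : ℝ}
    (hv : ‖mulV (precondMatrix c k x F)⁻¹ (mulV F⁻¹ (score x y)) - v‖ ≤ b)
    (hw : ‖sampleU c k x F z - w‖ ≤ d) (j : Lattice n₁ n₂) :
    |(WithLp.toLp 2 x + (δ ^ 2 / 2) • mulV F.transpose⁻¹ v + δ • mulV F.transpose⁻¹ w :
        Vec (Lattice n₁ n₂)) j - proposalDraw c δ x y F z j|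
      ≤ √(c 0 / ρ) * (δ ^ 2 / 2 * b + |δ| * d) := by
  have hp := h.isPreconditioner h₁ h₂ hF
  rw [h.proposalDraw_eq h₁ h₂ hF]
  set v' := mulV (precondMatrix c k x F)⁻¹ (mulV F⁻¹ (score x y))
  set w' := sampleU c k x F z
  have e : (WithLp.toLp 2 x + (δ ^ 2 / 2) • mulV F.transpose⁻¹ v + δ • mulV F.transpose⁻¹ w :
        Vec (Lattice n₁ n₂)) j - (WithLp.toLp 2 x + (δ ^ 2 / 2) • mulV F.transpose⁻¹ v'
          + δ • mulV F.transpose⁻¹ w' : Vec (Lattice n₁ n₂)) j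
      = -((δ ^ 2 / 2) * mulV F.transpose⁻¹ (v' - v) j + δ * mulV F.transpose⁻¹ (w' - w) j) := by
    rw [mulV_sub, mulV_sub]
    simp only [PiLp.add_apply, PiLp.smul_apply, PiLp.sub_apply, smul_eq_mul]
    ring
  have h1 := hp.abs_mulV_inv_transpose_le (v' - v) j
  have h2 := hp.abs_mulV_inv_transpose_le (w' - w) j
  rw [covMatrix_diag] at h1 h2
  rw [e, abs_neg]
  refine (abs_add_le _ _).trans ?_
  rw [abs_mul, abs_mul, abs_of_nonneg (by positivity : 0 ≤ δ ^ 2 / 2)]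
  calc δ ^ 2 / 2 * |mulV F.transpose⁻¹ (v' - v) j| + |δ| * |mulV F.transpose⁻¹ (w' - w) j|
      ≤ δ ^ 2 / 2 * (√(c 0 / ρ) * b) + |δ| * (√(c 0 / ρ) * d) := by
        gcongr
        · exact h1.trans (by gcongr)
        · exact h2.trans (by gcongr)
    _ = _ := by ring

lemma matSqrt_facts (h : Setup c α ρ a) (h₁ : 0 < n₁) (h₂ : 0 < n₂) :
    (precond c α n₁ n₂).IsHermitian ∧
    matSqrt (precond c α n₁ n₂) * (matSqrt (precond c α n₁ n₂)).transpose = precond c α n₁ n₂ ∧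
    (matSqrt (precond c α n₁ n₂))⁻¹ = invSqrt (precond c α n₁ n₂) := by
  set M := precond c α n₁ n₂
  have hM : M.PosDef := by
    have := ((h.posDef n₁ n₂ h₁ h₂).inv.smul h.rho_pos).posSemidef_add (h.posSemidef n₁ n₂ h₁ h₂)
    simpa [M, precision] using this
  have hpos : ∀ t ∈ spectrum ℝ M, 0 < t := by
    intro t ht
    rw [spectrum_eq_range hM.isHermitian] at ht
    obtain ⟨l, rfl⟩ := ht
    exact hM.eigenvalues_pos l
  refine ⟨hM.isHermitian, ?_, ?_⟩
  · rw [transpose_matSqrt, matSqrt_mul_self hM.isHermitian hpos]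
  · refine Matrix.inv_eq_right_inv ?_
    rw [matSqrt, invSqrt, cfc_mul_cfc, cfc_congr_spectrum (g := fun _ => 1),
      cfc_const_one ℝ M hM.isHermitian.isSelfAdjoint]
    intro t ht
    exact mul_inv_cancel₀ (Real.sqrt_pos.2 (hpos t ht)).ne'

/-- Accuracy of the polynomial approximation of the proposal. -/
lemma abs_polyDraw_sub_le (h : Setup c α ρ a) (h₁ : 0 < n₁) (h₂ : 0 < n₂)
    {k : ℕ} (δ : ℝ) (x : Lattice n₁ n₂ → ℝ) (y : Fin k → Lattice n₁ n₂ → ℕ)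
    (z : Vec (Lattice n₁ n₂)) {p₁ p₂ : ℝ[X]} {τ R : ℝ} (hτ : 0 ≤ τ)
    (hp₁ : ∀ t ∈ spectrum ℝ (precondMatrix c k x (matSqrt (precond c α n₁ n₂))),
      |p₁.eval t - t⁻¹| ≤ τ)
    (hp₂ : ∀ t ∈ spectrum ℝ (precondMatrix c k x (matSqrt (precond c α n₁ n₂))),
      |p₂.eval t - -(t + √t)⁻¹| ≤ τ)
    (hs : ‖mulV (matSqrt (precond c α n₁ n₂))⁻¹ (score x y)‖ ≤ R)
    (hz : ‖mulV (conjInv (matSqrt (precond c α n₁ n₂)) (Matrix.diagonal (perturbation α k x))) z‖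
      ≤ R) (j : Lattice n₁ n₂) :
    |polyDraw (invSqrt (precond c α n₁ n₂)) δ p₁ p₂ (WithLp.toLp 2 x) (perturbation α k x)
        (score x y) z j - proposalDraw c δ x y (matSqrt (precond c α n₁ n₂)) z j|
      ≤ √(c 0 / ρ) * (δ ^ 2 / 2 * (τ * R) + |δ| * (τ * R)) := by
  obtain ⟨-, hF, hinv⟩ := h.matSqrt_facts h₁ h₂
  set F := matSqrt (precond c α n₁ n₂) with hFdef
  have hFt : F.transpose = F := transpose_matSqrt _
  obtain ⟨hA, hpos⟩ := h.pos_of_mem_spectrum h₁ h₂ hF k x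
  have hBt : F⁻¹.transpose = F⁻¹ := by rw [Matrix.transpose_nonsing_inv, hFt]
  have heq := h.precondMatrix_eq h₁ h₂ hF k x
  set A := precondMatrix c k x F with hAdef
  set E := conjInv F (Matrix.diagonal (perturbation α k x)) with hE
  have hEeq : F⁻¹ * Matrix.diagonal (perturbation α k x) * F⁻¹ = E := by rw [hE, conjInv, hBt]
  have hpoly : polyDraw (invSqrt (precond c α n₁ n₂)) δ p₁ p₂ (WithLp.toLp 2 x)
      (perturbation α k x) (score x y) z = WithLp.toLp 2 x
      + (δ ^ 2 / 2) • mulV F.transpose⁻¹ (mulV (aeval A p₁) (mulV F⁻¹ (score x y)))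
      + δ • mulV F.transpose⁻¹ (z + mulV (aeval A p₂) (mulV E z)) := by
    rw [polyDraw, ← hinv, hEeq, ← heq, hFt]
  rw [hpoly]
  refine h.abs_sub_proposalDraw_le h₁ h₂ hF δ x y z _ _ ?_ ?_ j
  · rw [← cfc_inv_eq hA fun t ht => (hpos t ht).2, ← cfc_eval_eq_aeval hA, ← sub_mulV, ← cfc_sub _ _ A
      (continuousOn_spectrum _) (continuousOn_spectrum _)]
    refine (norm_mulV_cfc_le hA (g := fun _ => 1) hτ (fun t ht => ?_) _).trans ?_
    · rw [abs_sub_comm, abs_one, mul_one]; exact hp₁ t ht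
    · rw [cfc_const_one ℝ A, one_mulV]
      gcongr
  · have hu : sampleU c k x F z = z + mulV (cfc (fun t : ℝ => -(t + √t)⁻¹) A) (mulV E z) := by
      have hEA : E = A - 1 := by rw [heq, add_sub_cancel_left]
      -- From t^{-1/2} - 1 = -(t - 1) / (t + √t): the polynomial approximates only the factor in
      -- front of E z, so its error is multiplied by ‖E z‖ and not by ‖z‖, which grows like √n.
      have h1 : invSqrt A = 1 + cfc (fun t : ℝ => -(t + √t)⁻¹) A * (A - 1) := by
        have e1 : cfc (fun t : ℝ => t - 1) A = A - 1 := by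
          rw [cfc_sub _ _ A (continuousOn_spectrum _) (continuousOn_spectrum _), cfc_self_eq hA,
            cfc_const_one ℝ A]
        rw [← e1, cfc_mul_cfc, ← cfc_const_one ℝ A, ← cfc_add A _ _
          (continuousOn_spectrum _) (continuousOn_spectrum _), invSqrt]
        refine cfc_congr_spectrum fun t ht => ?_
        have ht0 := (hpos t ht).2
        have hs0 : 0 < √t := Real.sqrt_pos.2 ht0
        have hne : t + √t ≠ 0 := by positivity
        field_simp
        have := Real.mul_self_sqrt ht0.le
        nlinarith
      rw [sampleU, ← hAdef, h1, add_mulV, one_mulV, mul_mulV, hEA]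
    rw [hu, add_sub_add_left_eq_sub, ← cfc_eval_eq_aeval hA, ← sub_mulV, ← cfc_sub _ _ A
      (continuousOn_spectrum _) (continuousOn_spectrum _)]
    refine (norm_mulV_cfc_le hA (g := fun _ => 1) hτ (fun t ht => ?_) _).trans ?_
    · rw [abs_sub_comm, abs_one, mul_one]; exact hp₂ t ht
    · rw [cfc_const_one ℝ A, one_mulV]
      gcongr

/-- Any accuracy is reached, with high probability, by a number of iterations that does not depend
on the lattice. -/
theorem exists_accuracy (h : Setup c α ρ a) (k : ℕ) (δ : ℝ) {Λ : ℝ} (hΛ : 0 ≤ Λ) {p₁ p₂ : ℕ → ℝ[X]}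
    (hp₁ : ∀ m : ℕ, ∀ t ∈ Set.Icc ((m : ℝ) + 1)⁻¹ (m + 1), |(p₁ m).eval t - t⁻¹| ≤ ((m : ℝ) + 1)⁻¹)
    (hp₂ : ∀ m : ℕ, ∀ t ∈ Set.Icc ((m : ℝ) + 1)⁻¹ (m + 1),
      |(p₂ m).eval t - -(t + √t)⁻¹| ≤ ((m : ℝ) + 1)⁻¹)
    {ε η : ℝ} (hε : 0 < ε) (hη : 0 < η) :
    ∃ m : ℕ, ∀ n₁ n₂ : ℕ, 0 < n₁ → 0 < n₂ → ∀ x : Lattice n₁ n₂ → ℝ, (∀ i, Real.exp (x i) ≤ Λ) →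
      (∀ F : Matrix (Lattice n₁ n₂) (Lattice n₁ n₂) ℝ, F * F.transpose = precond c α n₁ n₂ →
        ((obsLaw k x).prod (stdGaussian (Vec (Lattice n₁ n₂))))
          {q | ¬ (‖sampleU c k x F q.2 - sampleUApprox c k x F q.2 m‖ ≤ ε ∧
            ∀ j, |proposalApprox c δ x q.1 F q.2 m j - proposalDraw c δ x q.1 F q.2 j| ≤ ε)}
          ≤ ENNReal.ofReal η) ∧
      ((obsLaw k x).prod (stdGaussian (Vec (Lattice n₁ n₂))))
        {q | ¬ ∀ j, |polyDraw (invSqrt (precond c α n₁ n₂)) δ (p₁ m) (p₂ m) (WithLp.toLp 2 x)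
            (perturbation α k x) (score x q.1) q.2 j
          - proposalDraw c δ x q.1 (matSqrt (precond c α n₁ n₂)) q.2 j| ≤ ε}
        ≤ ENNReal.ofReal η := by
  have ha := h.a_nonneg
  have hc := h.c_zero_pos
  obtain ⟨R, hR, htight⟩ := h.exists_tight k hΛ (half_pos hη)
  -- Only convergence to zero matters here, so any K would do.
  obtain ⟨C, hC, hkry⟩ := h.exists_krylov_bound k hΛ (K := 1) one_pos
  obtain ⟨T, hT, hTb⟩ := h.exists_perturbation_bound k hΛ
  set G := √(c 0 / ρ) * (δ ^ 2 / 2 * (T + 1) + |δ|) with hG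
  have hG0 : 0 ≤ G := by positivity
  have hlim : Tendsto (fun m : ℕ => ((m : ℝ) + 1)⁻¹) atTop (𝓝 0) := by
    simpa using tendsto_one_div_add_atTop_nhds_zero_nat (𝕜 := ℝ)
  have hpow : ∀ m : ℕ, 1 ≤ m → (1 / (m : ℝ)) ^ m ≤ 2 * ((m : ℝ) + 1)⁻¹ := by
    intro m hm
    have hm' : (1 : ℝ) ≤ m := by exact_mod_cast hm
    calc (1 / (m : ℝ)) ^ m ≤ (1 / (m : ℝ)) ^ 1 :=
          pow_le_pow_of_le_one (by positivity) (by rw [div_le_one (by positivity)]; exact hm') hm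
      _ ≤ _ := by
        rw [pow_one, ← div_eq_mul_inv, div_le_div_iff₀ (by positivity) (by positivity)]
        linarith
  have hsmall : ∀ᶠ m : ℕ in atTop, (1 + G) * ((2 * C + 1) * R) * ((m : ℝ) + 1)⁻¹ < ε := by
    have := hlim.const_mul ((1 + G) * ((2 * C + 1) * R))
    rw [mul_zero] at this
    exact this.eventually_lt_const hε
  -- For such m the spectrum of A lies in [1 / (m + 1), m + 1], where the polynomials of index m are
  -- accurate. The same m serves the iterations and the program.
  have hlarge : ∀ᶠ m : ℕ in atTop, 1 + a * c 0 + T ≤ m := by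
    exact tendsto_natCast_atTop_atTop.eventually_ge_atTop _
  obtain ⟨m, hm1, hmsmall, hmlarge⟩ := ((eventually_ge_atTop 1).and (hsmall.and hlarge)).exists
  refine ⟨m, fun n₁ n₂ h₁ h₂ x hx => ⟨fun F hF => ?_, ?_⟩⟩
  · obtain ⟨hz, hs⟩ := htight n₁ n₂ h₁ h₂ F hF x hx
    obtain ⟨hE, -, -⟩ := hTb n₁ n₂ h₁ h₂ F hF x hx
    refine prod_le_of_imp hη.le hs hz fun q hq1 hq2 => ?_
    rw [not_lt] at hq1 hq2
    obtain ⟨hk1, -⟩ := hkry n₁ n₂ h₁ h₂ F hF x hx q.2 m hm1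
    obtain ⟨-, hk2⟩ := hkry n₁ n₂ h₁ h₂ F hF x hx (mulV F⁻¹ (score x q.1)) m hm1
    set β := C * (2 * ((m : ℝ) + 1)⁻¹) * R with hβ
    have hβ0 : 0 ≤ β := by positivity
    have hb1 : ‖sampleU c k x F q.2 - sampleUApprox c k x F q.2 m‖ ≤ β := by
      refine hk1.trans ?_
      rw [hβ]
      gcongr
      exact hpow m hm1
    have hb2 : ‖mulV (precondMatrix c k x F)⁻¹ (mulV F⁻¹ (score x q.1))
        - krylovSolve (precondMatrix c k x F) (mulV F⁻¹ (score x q.1)) m‖ ≤ T * β := by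
      refine hk2.trans ?_
      calc _ ≤ C * (2 * ((m : ℝ) + 1)⁻¹) * (T * R) := by
            gcongr
            · exact hpow m hm1
            · exact (hE _).trans (by gcongr)
        _ = _ := by rw [hβ]; ring
    have hβε : (1 + G) * β ≤ ε := by
      refine le_trans ?_ hmsmall.le
      have : 0 ≤ (1 + G) * R * ((m : ℝ) + 1)⁻¹ := by positivity
      rw [hβ]
      linarith
    refine ⟨hb1.trans (by nlinarith), fun j => ?_⟩
    refine (h.abs_sub_proposalDraw_le h₁ h₂ hF δ x q.1 q.2 _ _ hb2 hb1 j).trans ?_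
    have : √(c 0 / ρ) * (δ ^ 2 / 2 * (T * β) + |δ| * β) ≤ G * β := by
      have e : G * β - √(c 0 / ρ) * (δ ^ 2 / 2 * (T * β) + |δ| * β)
        = √(c 0 / ρ) * (δ ^ 2 / 2 * β) := by rw [hG]; ring
      have : 0 ≤ √(c 0 / ρ) * (δ ^ 2 / 2 * β) := by positivity
      linarith
    linarith
  · obtain ⟨-, hF, -⟩ := h.matSqrt_facts h₁ h₂
    obtain ⟨hz, hs⟩ := htight n₁ n₂ h₁ h₂ _ hF x hx
    obtain ⟨-, hspec, -⟩ := hTb n₁ n₂ h₁ h₂ _ hF x hx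
    obtain ⟨-, hpos⟩ := h.pos_of_mem_spectrum h₁ h₂ hF k x
    have hIcc : ∀ t ∈ spectrum ℝ (precondMatrix c k x (matSqrt (precond c α n₁ n₂))),
        t ∈ Set.Icc ((m : ℝ) + 1)⁻¹ (m + 1) := by
      intro t ht
      have hac : 0 ≤ a * c 0 := by positivity
      refine ⟨le_trans ?_ (hpos t ht).1, (hspec t ht).trans (by linarith)⟩
      exact inv_anti₀ (by positivity) (by linarith)
    refine prod_le_of_imp hη.le hs hz fun q hq1 hq2 j => ?_
    rw [not_lt] at hq1 hq2
    refine (h.abs_polyDraw_sub_le h₁ h₂ δ x q.1 q.2 (by positivity) (fun t ht => hp₁ m t (hIcc t ht))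
      (fun t ht => hp₂ m t (hIcc t ht)) hq1 hq2 j).trans (le_trans ?_ hmsmall.le)
    set τ := ((m : ℝ) + 1)⁻¹ with hτ
    have hτ0 : 0 ≤ τ := by positivity
    have e : (1 + G) * ((2 * C + 1) * R) * τ
        - √(c 0 / ρ) * (δ ^ 2 / 2 * (τ * R) + |δ| * (τ * R))
        = (1 + G) * (2 * C * R) * τ + R * τ + √(c 0 / ρ) * (δ ^ 2 / 2 * T) * (R * τ) := by
      rw [hG]; ring
    have : 0 ≤ (1 + G) * (2 * C * R) * τ + R * τ + √(c 0 / ρ) * (δ ^ 2 / 2 * T) * (R * τ) := by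
      positivity
    linarith

end Setup

open Polynomial in
/-- Polynomial approximation of continuous functions on the intervals `[1/(m+1), m+1]`. -/
lemma exists_polynomials {f : ℝ → ℝ} (hf : ContinuousOn f (Set.Ioi 0)) :
    ∃ p : ℕ → ℝ[X], ∀ m : ℕ, ∀ t ∈ Set.Icc ((m : ℝ) + 1)⁻¹ (m + 1),
      |(p m).eval t - f t| ≤ ((m : ℝ) + 1)⁻¹ := by
  have h : ∀ m : ℕ, ∃ p : ℝ[X], ∀ t ∈ Set.Icc ((m : ℝ) + 1)⁻¹ (m + 1),
      |p.eval t - f t| ≤ ((m : ℝ) + 1)⁻¹ := by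
    intro m
    have hm : (0 : ℝ) < ((m : ℝ) + 1)⁻¹ := by positivity
    obtain ⟨p, hp⟩ := exists_polynomial_near_of_continuousOn ((m : ℝ) + 1)⁻¹ (m + 1) f
      (hf.mono fun t ht => hm.trans_le ht.1) _ hm
    exact ⟨p, fun t ht => (hp t ht).le⟩
  choose p hp using h
  exact ⟨p, hp⟩

end

end LGCP

/-! ### Assembly of the theorem -/

theorem theorem2
    {Ω : Type*} [MeasurableSpace Ω] (P : Measure Ω) [IsProbabilityMeasure P]
    -- a Gaussian random field on the torus with stationary covariance and continuous paths
    (X : LGCP.Torus → Ω → ℝ) (hX : IsGaussianProcess X P)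
    (c : LGCP.Torus → ℝ)
    (hc : ∀ s t : LGCP.Torus, ProbabilityTheory.covariance (X s) (X t) P = c (s - t))
    (hcont : ∀ᵐ ω ∂P, Continuous fun s => X s ω)
    -- the precision matrices exist
    (hpos : ∀ n₁ n₂ : ℕ, 0 < n₁ → 0 < n₂ → (LGCP.covMatrix c n₁ n₂).PosDef)
    -- number of realisations and step size
    (k : ℕ) (δ : ℝ)
    -- the preconditioner: `n α_n → Cα`, and `M_n` is positive definite, uniformly relative to `Q_n`
    (α : ℕ → ℝ) (Cα : ℝ)
    (hα : Tendsto (fun n : ℕ => (n : ℝ) * α n) atTop (𝓝 Cα))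
    (hM : ∃ ρ : ℝ, 0 < ρ ∧ ∀ n₁ n₂ : ℕ, 0 < n₁ → 0 < n₂ →
      (LGCP.precond c α n₁ n₂ - ρ • LGCP.precision c n₁ n₂).PosSemidef) :
    -- the draw built from `u` has the law of the proposal
    (∀ (n₁ n₂ : ℕ), 0 < n₁ → 0 < n₂ →
      ∀ F : Matrix (LGCP.Lattice n₁ n₂) (LGCP.Lattice n₁ n₂) ℝ,
        F * F.transpose = LGCP.precond c α n₁ n₂ →
      ∀ (x : LGCP.Lattice n₁ n₂ → ℝ) (y : Fin k → LGCP.Lattice n₁ n₂ → ℕ),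
        (stdGaussian (LGCP.Vec (LGCP.Lattice n₁ n₂))).map (LGCP.proposalDraw c δ x y F)
          = LGCP.proposalLaw c δ x y) ∧
    -- superlinear convergence, with constants that depend neither on the lattice nor on `m`
    (∀ᵐ ω ∂P, (∫ s, Real.exp (X s ω)) ≠ Cα →
      (∃ C : ℝ, ∀ n₁ n₂ : ℕ, 0 < n₁ → 0 < n₂ →
        ∀ F : Matrix (LGCP.Lattice n₁ n₂) (LGCP.Lattice n₁ n₂) ℝ,
          F * F.transpose = LGCP.precond c α n₁ n₂ →
        ∀ (z : LGCP.Vec (LGCP.Lattice n₁ n₂)) (m : ℕ), 1 ≤ m →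
          ‖LGCP.sampleU c k (fun i => X (LGCP.latticePoint i) ω) F z
              - LGCP.sampleUApprox c k (fun i => X (LGCP.latticePoint i) ω) F z m‖
            ≤ C * ‖z‖ * (|(∫ s, Real.exp (X s ω)) - Cα| / m) ^ m) ∧
      (∀ η : ℝ, 0 < η → ∃ C : ℝ, ∀ n₁ n₂ : ℕ, 0 < n₁ → 0 < n₂ →
        ∀ F : Matrix (LGCP.Lattice n₁ n₂) (LGCP.Lattice n₁ n₂) ℝ,
          F * F.transpose = LGCP.precond c α n₁ n₂ →
          stdGaussian (LGCP.Vec (LGCP.Lattice n₁ n₂))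
            {z | ¬ ∀ m : ℕ, 1 ≤ m →
              ‖LGCP.sampleU c k (fun i => X (LGCP.latticePoint i) ω) F z
                  - LGCP.sampleUApprox c k (fun i => X (LGCP.latticePoint i) ω) F z m‖
                ≤ C * (|(∫ s, Real.exp (X s ω)) - Cα| / m) ^ m}
            ≤ ENNReal.ofReal η)) ∧
    -- any accuracy, with `O(n log n)` operations and a number of iterations independent of `n`
    (∃ (prog : (m n₁ n₂ : ℕ) →
          LGCP.Program (LGCP.ProposalInput k n₁ n₂) (LGCP.Lattice n₁ n₂)) (K : ℕ → ℝ),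
      (∀ m n₁ n₂ : ℕ, 2 ≤ n₁ * n₂ →
        ((prog m n₁ n₂).cost : ℝ)
          ≤ K m * (((n₁ * n₂ : ℕ) : ℝ) * Real.log ((n₁ * n₂ : ℕ) : ℝ))) ∧
      ∀ᵐ ω ∂P, ∀ ε η : ℝ, 0 < ε → 0 < η → ∃ m : ℕ, ∀ n₁ n₂ : ℕ, 0 < n₁ → 0 < n₂ →
        (∀ F : Matrix (LGCP.Lattice n₁ n₂) (LGCP.Lattice n₁ n₂) ℝ,
          F * F.transpose = LGCP.precond c α n₁ n₂ →
          ((LGCP.obsLaw k (fun i : LGCP.Lattice n₁ n₂ => X (LGCP.latticePoint i) ω)).prod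
            (stdGaussian (LGCP.Vec (LGCP.Lattice n₁ n₂))))
            {q | ¬ (‖LGCP.sampleU c k (fun i => X (LGCP.latticePoint i) ω) F q.2
                    - LGCP.sampleUApprox c k (fun i => X (LGCP.latticePoint i) ω) F q.2 m‖ ≤ ε ∧
                ∀ j, |LGCP.proposalApprox c δ (fun i => X (LGCP.latticePoint i) ω) q.1 F q.2 m j
                    - LGCP.proposalDraw c δ (fun i => X (LGCP.latticePoint i) ω) q.1 F q.2 j|
                  ≤ ε)}
            ≤ ENNReal.ofReal η) ∧
        ((LGCP.obsLaw k (fun i : LGCP.Lattice n₁ n₂ => X (LGCP.latticePoint i) ω)).prod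
          (stdGaussian (LGCP.Vec (LGCP.Lattice n₁ n₂))))
          {q | ¬ ∀ j, |(prog m n₁ n₂).run
                  (LGCP.proposalInput (fun i => X (LGCP.latticePoint i) ω) q.1 q.2) j
                - LGCP.proposalDraw c δ (fun i => X (LGCP.latticePoint i) ω) q.1
                    (LGCP.matSqrt (LGCP.precond c α n₁ n₂)) q.2 j| ≤ ε}
          ≤ ENNReal.ofReal η) := by
  obtain ⟨ρ, hρ, hM⟩ := hM
  obtain ⟨a, ha⟩ : ∃ a : ℝ, ∀ n : ℕ, |(n : ℝ) * α n| ≤ a := by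
    obtain ⟨a, ha⟩ := (Metric.isBounded_range_of_tendsto _ hα).exists_norm_le
    exact ⟨a, fun n => ha _ ⟨n, rfl⟩⟩
  have h : LGCP.Setup c α ρ a :=
    ⟨hpos, LGCP.tendsto_variogram hX hc hcont, hρ, hM, ha⟩
  -- The torus is compact, so a continuous path has one bound Λ that serves all lattices; the
  -- realisation enters the constants only through Λ and K.
  have hbound : ∀ ω, (Continuous fun s => X s ω) → ∃ Λ : ℝ, 0 ≤ Λ ∧ ∀ s, Real.exp (X s ω) ≤ Λ := by
    intro ω hω
    obtain ⟨Λ, hΛ⟩ := (isCompact_range (Real.continuous_exp.comp hω)).bddAbove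
    exact ⟨Λ, (Real.exp_pos _).le.trans (hΛ ⟨0, rfl⟩), fun s => hΛ ⟨s, rfl⟩⟩
  refine ⟨fun n₁ n₂ h₁ h₂ F hF x y => h.map_proposalDraw h₁ h₂ hF δ x y, ?_, ?_⟩
  · filter_upwards [hcont] with ω hω hne
    obtain ⟨Λ, hΛ, hx⟩ := hbound ω hω
    have hK : 0 < |(∫ s, Real.exp (X s ω)) - Cα| := abs_pos.2 (sub_ne_zero.2 hne)
    obtain ⟨C, hC, hkry⟩ := h.exists_krylov_bound k hΛ hK
    constructor
    · obtain ⟨T, hT, hTb⟩ := h.exists_perturbation_bound k hΛ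
      refine ⟨C * T, fun n₁ n₂ h₁ h₂ F hF z m hm => ?_⟩
      refine (hkry n₁ n₂ h₁ h₂ F hF _ (fun i => hx _) z m hm).1.trans ?_
      refine (mul_le_mul_of_nonneg_left ((hTb n₁ n₂ h₁ h₂ F hF _ fun i => hx _).1 z)
        (by positivity)).trans (le_of_eq ?_)
      ring
    · intro η hη
      obtain ⟨R, hR, htight⟩ := h.exists_tight k hΛ hη
      refine ⟨C * R, fun n₁ n₂ h₁ h₂ F hF => ?_⟩
      refine (measure_mono fun z hz => ?_).trans
        (htight n₁ n₂ h₁ h₂ F hF (fun i => X (LGCP.latticePoint i) ω) fun i => hx _).1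
      by_contra hcon
      rw [Set.mem_ofPred_eq, not_lt] at hcon
      refine hz fun m hm => (hkry n₁ n₂ h₁ h₂ F hF _ (fun i => hx _) z m hm).1.trans ?_
      refine (mul_le_mul_of_nonneg_left hcon (by positivity)).trans (le_of_eq ?_)
      ring
  -- The polynomials are fixed before the realisation, so the programs do not depend on it; only the
  -- index m does, through Λ.
  · obtain ⟨p₁, hp₁⟩ := LGCP.exists_polynomials (f := fun t => t⁻¹)
      (continuousOn_inv₀.mono fun t ht => (Set.mem_Ioi.1 ht).ne')
    obtain ⟨p₂, hp₂⟩ := LGCP.exists_polynomials (f := fun t => -(t + √t)⁻¹)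
      (((continuous_id.add Real.continuous_sqrt).continuousOn.inv₀ fun t ht =>
        (add_pos_of_pos_of_nonneg (Set.mem_Ioi.1 ht) (Real.sqrt_nonneg t)).ne').neg)
    have hprog : ∀ m n₁ n₂ : ℕ,
        ∃ Q : LGCP.Program (LGCP.ProposalInput k n₁ n₂) (LGCP.Lattice n₁ n₂), 0 < n₁ → 0 < n₂ →
          Q.cost ≤ ((p₁ m).natDegree + (p₂ m).natDegree + k + 30) *
            (2 * (1 + 24 * 2 ^ Nat.clog 2 (6 * (n₁ * n₂)) * (Nat.clog 2 (6 * (n₁ * n₂)) + 1))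
              + 5 * (n₁ * n₂)) ∧
          ∀ x (y : Fin k → LGCP.Lattice n₁ n₂ → ℕ) z i, Q.run (LGCP.proposalInput x y z) i
            = LGCP.polyDraw (LGCP.invSqrt (LGCP.precond c α n₁ n₂)) δ (p₁ m) (p₂ m)
              (WithLp.toLp 2 x) (LGCP.perturbation α k x) (LGCP.score x y) z i := by
      intro m n₁ n₂
      by_cases hn : 0 < n₁ ∧ 0 < n₂
      · have : NeZero n₁ := ⟨hn.1.ne'⟩
        have : NeZero n₂ := ⟨hn.2.ne'⟩
        obtain ⟨Q, hQ⟩ := LGCP.exists_program_polyDraw k ((LGCP.transInvariant_precond c α).invSqrt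
          (h.matSqrt_facts hn.1 hn.2).1) α δ (p₁ m) (p₂ m)
        exact ⟨Q, fun _ _ => hQ⟩
      -- On empty lattices an arbitrary program will do.
      · exact ⟨⟨[], fun _ => Sum.inr 0⟩, fun h₁ h₂ => absurd ⟨h₁, h₂⟩ hn⟩
    choose prog hprog using hprog
    refine ⟨prog, fun m => ((p₁ m).natDegree + (p₂ m).natDegree + k + 30 : ℕ) * 7000,
      fun m n₁ n₂ hn => ?_, ?_⟩
    · have h₁ : 0 < n₁ := Nat.pos_of_ne_zero fun h0 => by simp [h0] at hn
      have h₂ : 0 < n₂ := Nat.pos_of_ne_zero fun h0 => by simp [h0] at hn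
      refine (Nat.cast_le.2 (hprog m n₁ n₂ h₁ h₂).1).trans ?_
      rw [Nat.cast_mul]
      refine (mul_le_mul_of_nonneg_left (LGCP.convolution_cost_le hn)
        (Nat.cast_nonneg _)).trans (le_of_eq ?_)
      rw [← mul_assoc]
    · filter_upwards [hcont] with ω hω ε η hε hη
      obtain ⟨Λ, hΛ, hx⟩ := hbound ω hω
      obtain ⟨m, hm⟩ := h.exists_accuracy k δ hΛ hp₁ hp₂ hε hη
      refine ⟨m, fun n₁ n₂ h₁ h₂ => ?_⟩
      obtain ⟨hA, hB⟩ := hm n₁ n₂ h₁ h₂ (fun i => X (LGCP.latticePoint i) ω) fun i => hx _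
      refine ⟨hA, ?_⟩
      simp_rw [(hprog m n₁ n₂ h₁ h₂).2]
      exact hB
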